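/- Let $d\ge 2$, $\ell>0$, and let $(M,g)$ be pure AdS$_{d+1}$ of scale $\ell$ (universal cover): $M=\mathbb R\times B$ with $B\subset\mathbb R^d$ the open unit ball, and, with $r=2\ell|y|/(1-|y|^2)$, $$g=-\Big(\frac{1+|y|^2}{1-|y|^2}\Big)^2dt^2+\frac{4\ell^2|dy|^2}{(1-|y|^2)^2}=-\Big(1+\frac{r^2}{\ell^2}\Big)dt^2+\frac{dr^2}{1+r^2/\ell^2}+r^2d\Omega_{d-1}^2 .$$ Let $\Omega=(1-|y|^2)/(1+|y|^2)$. Then $\tilde g=\Omega^2g$ is regular on $\bar M=\mathbb R\times\bar B$, whose boundary $\partial M=\mathbb R\times S^{d-1}$ is the conformal boundary of AdS. Let $\delta g$ be a $C^2$ symmetric 2-tensor on $M$ that is regular at the boundary and leaves the boundary causal structure unchanged: $\Omega^2\delta g$ extends to a $C^1$ tensor field on $\bar M$, and this extension satisfies $(\Omega^2\delta g)(v,v)=0$ at $\partial M$ for every $\tilde g$-null vector $v$ tangent to $\partial M$. For a complete null geodesic $\gamma:\mathbb R\to M$ of $g$ with affine parameter $\lambda$ and tangent $k=d\gamma/d\lambda$,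 let $I(\gamma)=\int_{-\infty}^{\infty}\delta g_{ab}k^ak^b\,d\lambda$ be the averaged light cone tilt. A deviation field along $\gamma$ is a $C^2$ vector field $\eta$ along $\gamma$ such that $\gamma+\varepsilon\eta$ satisfies, up to $o(\varepsilon)$ as $\varepsilon\to0$, the equations of an affinely parametrized null geodesic of $\bar g=g+\varepsilon\,\delta g$. Suppose $\gamma$ is future-directed, and let $p_+\in\partial M$ be its future endpoint; write $\eta_\pm(\gamma)=\lim_{\lambda\to\pm\infty}\eta$ (in the coordinates $(t,y)$, which are regular at $\partial M$). Boundary causality is said to be preserved to linear order in $\delta g$ if, for every future-directed complete null geodesic $\gamma$ of $g$, and every deviation field $\eta$ along $\gamma$ with $\eta_-(\gamma)=0$ and whose limit $\eta_+(\gamma)$ exists, $\eta_+(\gamma)$ is not past-directed, i.e. is not a nonzero vector that is timelike or null for $\tilde g$ at $p_+$ and points to the past. (That is: no null geodesic of the perturbed metric starting at the same boundary point as $\gamma$ arrives, to first order, to the past of $p_+$.) Then: 1. the integral defining $I(\gamma)$ converges absolutely for every complete null geodesic $\gamma$ of $g$; 2. every future-directed complete null geodesic $\gamma$ of $g$ has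 a future endpoint $p_+\in\partial M$, and there is exactly one vector $\eta_+(\gamma)$ that is the limit as $\lambda\to+\infty$ of a deviation field along $\gamma$ with $\eta_-(\gamma)=0$; 3. $I(\gamma)\ge0$ for all complete null geodesics $\gamma$ of $g$ is necessary and sufficient for boundary causality to be preserved to linear order in $\delta g$. -/

import Mathlib

noncomputable section

namespace AdS

/-- The vector space carrying the global chart `(t, y)` of `AdS_{d+1}`: `t` is global time,
`y` a Cartesian coordinate on the ball, with areal radius `r = 2 ℓ ‖y‖ / (1 - ‖y‖ ^ 2)`. -/
abbrev Chart (d : ℕ) : Type := ℝ × EuclideanSpace ℝ (Fin d)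

/-- Covariant rank-two tensors on the chart. -/
abbrev Form (d : ℕ) : Type := Chart d →L[ℝ] Chart d →L[ℝ] ℝ

/-- The points of the (universal cover of) anti-de Sitter space: `ℝ ×` open unit ball. -/
def bulk (d : ℕ) : Set (Chart d) := {x | ‖x.2‖ < 1}

/-- The conformal compactification of anti-de Sitter space: `ℝ ×` closed unit ball. -/
def compactification (d : ℕ) : Set (Chart d) := {x | ‖x.2‖ ≤ 1}

/-- The conformal boundary of anti-de Sitter space: `ℝ ×` unit sphere. -/
def boundary (d : ℕ) : Set (Chart d) := {x | ‖x.2‖ = 1}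

/-- The form `dt ⊗ dt`. -/
def timeForm (d : ℕ) : Form d :=
  (ContinuousLinearMap.fst ℝ ℝ (EuclideanSpace ℝ (Fin d))).smulRight
    (ContinuousLinearMap.fst ℝ ℝ (EuclideanSpace ℝ (Fin d)))

/-- The form `∑ i, dy i ⊗ dy i`. -/
def spaceForm (d : ℕ) : Form d :=
  (innerSL ℝ (E := EuclideanSpace ℝ (Fin d))).bilinearComp
    (ContinuousLinearMap.snd ℝ ℝ (EuclideanSpace ℝ (Fin d)))
    (ContinuousLinearMap.snd ℝ ℝ (EuclideanSpace ℝ (Fin d)))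

@[simp] theorem timeForm_apply {d : ℕ} (u v : Chart d) : timeForm d u v = u.1 * v.1 := by
  simp [timeForm]

@[simp] theorem spaceForm_apply {d : ℕ} (u v : Chart d) :
    spaceForm d u v = inner ℝ u.2 v.2 := by
  simp [spaceForm, ContinuousLinearMap.bilinearComp]

/-- The metric of pure AdS with scale `ℓ`. In terms of `r = 2 ℓ ‖y‖ / (1 - ‖y‖ ^ 2)` it is
`-(1 + r² / ℓ²) dt² + dr² / (1 + r² / ℓ²) + r² dΩ²`. It is meaningful on `bulk d`. -/
def metric {d : ℕ} (ℓ : ℝ) (x : Chart d) : Form d :=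
  -(((1 + ‖x.2‖ ^ 2) / (1 - ‖x.2‖ ^ 2)) ^ 2) • timeForm d
    + (4 * ℓ ^ 2 / (1 - ‖x.2‖ ^ 2) ^ 2) • spaceForm d

/-- The conformal factor `Ω`, positive on the bulk and vanishing to first order on the boundary. -/
def confFactor {d : ℕ} (x : Chart d) : ℝ := (1 - ‖x.2‖ ^ 2) / (1 + ‖x.2‖ ^ 2)

/-- The compactified metric `Ω² g`, which is regular on the whole compactification
(the Einstein static universe, in stereographic coordinates). -/
def confMetric {d : ℕ} (ℓ : ℝ) (x : Chart d) : Form d :=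
  -timeForm d + (4 * ℓ ^ 2 / (1 + ‖x.2‖ ^ 2) ^ 2) • spaceForm d

theorem metric_apply {d : ℕ} (ℓ : ℝ) (x u v : Chart d) :
    metric ℓ x u v = -(((1 + ‖x.2‖ ^ 2) / (1 - ‖x.2‖ ^ 2)) ^ 2) * (u.1 * v.1)
      + 4 * ℓ ^ 2 / (1 - ‖x.2‖ ^ 2) ^ 2 * inner ℝ u.2 v.2 := by
  rw [← timeForm_apply, ← spaceForm_apply]
  rfl

theorem confMetric_apply {d : ℕ} (ℓ : ℝ) (x u v : Chart d) :
    confMetric ℓ x u v = -(u.1 * v.1)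
      + 4 * ℓ ^ 2 / (1 + ‖x.2‖ ^ 2) ^ 2 * inner ℝ u.2 v.2 := by
  rw [← timeForm_apply, ← spaceForm_apply]
  rfl

theorem confFactor_sq_mul_metric {d : ℕ} (ℓ : ℝ) {x : Chart d} (hx : x ∈ bulk d)
    (u v : Chart d) : confFactor x ^ 2 * metric ℓ x u v = confMetric ℓ x u v := by
  have h0 : 0 ≤ ‖x.2‖ := norm_nonneg _
  have h1 : 1 - ‖x.2‖ ^ 2 ≠ 0 := by
    have : ‖x.2‖ < 1 := hx
    nlinarith
  have h2 : 1 + ‖x.2‖ ^ 2 ≠ 0 := by positivity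
  rw [metric_apply, confMetric_apply, confFactor]
  field_simp

/-- Christoffel symbols of the first kind of a metric `g` in the chart:
`½ (∂_u g(v, w) + ∂_v g(u, w) - ∂_w g(u, v))`. -/
def christoffel {d : ℕ} (g : Chart d → Form d) (x u v w : Chart d) : ℝ :=
  (1 / 2) * (fderiv ℝ g x u v w + fderiv ℝ g x v u w - fderiv ℝ g x w u v)

/-- The `w`-component, with lowered index, of the acceleration `∇_v v` of a curve passing through
`x` with velocity `v` and second derivative `a`; all components vanish for affinely parametrized
geodesics. -/
def acceleration {d : ℕ} (g : Chart d → Form d) (x v a w : Chart d) : ℝ :=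
  g x a w + christoffel g x v v w

/-- Complete affinely parametrized null geodesics of pure AdS. -/
structure IsCompleteNullGeodesic {d : ℕ} (ℓ : ℝ) (γ : ℝ → Chart d) : Prop where
  mem_bulk : ∀ s, γ s ∈ bulk d
  contDiff : ContDiff ℝ 2 γ
  velocity_ne_zero : ∀ s, deriv γ s ≠ 0
  geodesic : ∀ s w, acceleration (metric ℓ) (γ s) (deriv γ s) (deriv (deriv γ) s) w = 0
  null : ∀ s, metric ℓ (γ s) (deriv γ s) (deriv γ s) = 0

/-- The curve is everywhere future-directed (for causal curves). -/
def IsFutureDirected {d : ℕ} (γ : ℝ → Chart d) : Prop := ∀ s, 0 < (deriv γ s).1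

/-- Regular `C²` perturbations `h = δg` of pure AdS which leave the causal structure of the
boundary unchanged: `h` is a `C²` symmetric tensor in the bulk, `Ω² h` has a `C¹` extension to the
conformal boundary, and the vectors tangent to the boundary which are null for the boundary metric
remain null (to first order). -/
structure IsAdmissiblePerturbation {d : ℕ} (ℓ : ℝ) (h : Chart d → Form d) : Prop where
  symm : ∀ x ∈ bulk d, ∀ u v, h x u v = h x v u
  contDiffOn : ContDiffOn ℝ 2 h (bulk d)
  boundary_regular : ∃ H : Chart d → Form d,
    ContDiffOn ℝ 1 H (compactification d) ∧
    (∀ x ∈ bulk d, H x = confFactor x ^ 2 • h x) ∧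
    ∀ x ∈ boundary d, ∀ v : Chart d, inner ℝ x.2 v.2 = 0 →
      confMetric ℓ x v v = 0 → H x v v = 0

/-- The integrand `δg_ab k^a k^b` of the averaged light cone tilt, `k` being the velocity. -/
def tiltDensity {d : ℕ} (h : Chart d → Form d) (γ : ℝ → Chart d) (s : ℝ) : ℝ :=
  h (γ s) (deriv γ s) (deriv γ s)

/-- The averaged light cone tilt `I(γ)`. -/
def averagedTilt {d : ℕ} (h : Chart d → Form d) (γ : ℝ → Chart d) : ℝ :=
  ∫ s, tiltDensity h γ s

/-- The perturbed metric `g + ε δg`. -/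
def perturbedMetric {d : ℕ} (ℓ : ℝ) (h : Chart d → Form d) (ε : ℝ) (x : Chart d) : Form d :=
  metric ℓ x + ε • h x

/-- `η` is the deviation vector field from the null geodesic `γ` of pure AdS to a null geodesic of
the perturbed metric: `γ + ε η` satisfies the equations of an affinely parametrized null geodesic
of `g + ε δg` up to `o(ε)`. -/
structure IsDeviationField {d : ℕ} (ℓ : ℝ) (h : Chart d → Form d) (γ η : ℝ → Chart d) :
    Prop where
  contDiff : ContDiff ℝ 2 η
  geodesic : ∀ s w, HasDerivAt (fun ε : ℝ =>
    acceleration (perturbedMetric ℓ h ε) (γ s + ε • η s) (deriv γ s + ε • deriv η s)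
      (deriv (deriv γ) s + ε • deriv (deriv η) s) w) 0 0
  null : ∀ s, HasDerivAt (fun ε : ℝ =>
    perturbedMetric ℓ h ε (γ s + ε • η s) (deriv γ s + ε • deriv η s)
      (deriv γ s + ε • deriv η s)) 0 0

/-- `v` is the limiting value `η₊` at the future endpoint of `γ` of a deviation vector field which
vanishes at the past endpoint of `γ`, that is, whose perturbed null geodesic starts at the same
boundary point as `γ`. Limits are taken in the chart, which is regular at the boundary. -/
def IsArrivalDeviation {d : ℕ} (ℓ : ℝ) (h : Chart d → Form d) (γ : ℝ → Chart d)
    (v : Chart d) : Prop :=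
  ∃ η : ℝ → Chart d, IsDeviationField ℓ h γ η ∧
    Filter.Tendsto η Filter.atBot (nhds 0) ∧ Filter.Tendsto η Filter.atTop (nhds v)

/-- The vector `v` at the point `p` is past-directed (timelike or null, and nonzero). -/
def IsPastDirected {d : ℕ} (ℓ : ℝ) (p v : Chart d) : Prop :=
  confMetric ℓ p v v ≤ 0 ∧ v.1 < 0

/-- Boundary causality is preserved to linear order in `δg`: a null geodesic of the perturbed
metric starting at the same boundary point `p₋` as a null geodesic `γ` of pure AdS does not, to
first order, arrive at the boundary to the past of the future endpoint `p₊` of `γ`. -/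
def BoundaryCausalityToLinearOrder {d : ℕ} (ℓ : ℝ) (h : Chart d → Form d) : Prop :=
  ∀ γ : ℝ → Chart d, IsCompleteNullGeodesic ℓ γ → IsFutureDirected γ →
    ∀ p ∈ boundary d, Filter.Tendsto γ Filter.atTop (nhds p) →
      ∀ v : Chart d, IsArrivalDeviation ℓ h γ v → ¬ IsPastDirected ℓ p v

end AdS

end

/-!
Anti-de Sitter space is the universal cover of the quadric `⟨X, X⟩ = -ℓ²` of the flat space
`ℝ^{2,d}`, and its null geodesics are straight lines there. Consequently every complete null
geodesic is, up to an affine reparametrization, one of the explicit curves `stdGeodesic ℓ t₀ n e`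
(`IsCompleteNullGeodesic.exists_eq_stdGeodesic`): the null geodesics that leave the boundary point
`(t₀ - π ℓ / 2, -n)` all meet again at `(t₀ + π ℓ / 2, n)`, and they are parametrized by the vectors
`e` orthogonal to `n` with `‖e‖ < 1`.

In the flat space the equation of a deviation field says that its displacement `ζ` obeys Newton's
law with a force determined by the perturbation (`isDeviationField_iff`). Regularity at the boundary
makes this force integrable, except for a component along the geodesic which does not affect the
arrival point (`exists_integrable_force`). So `ζ` has asymptotic velocities at both ends; the past
endpoint fixes the initial one, and the final one determines the arrival deviation. This gives its
existence and uniqueness (`exists_isArrivalDeviation`, `IsArrivalDeviation.eq_of_stdGeodesic`).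

Let `v` be the arrival deviation, `I` the averaged tilt, and `ψ e = (1 - ‖e‖²) I`. Integrating the
equation of motion gives `ψ e = 2 ℓ (v.1 + ℓ ⟨v.2, e⟩)`, and comparison with the first variation of
the averaged tilt shows that the gradient of `ψ` is `2 ℓ² v.2`.

* If `v` is past-directed, then `ℓ ‖v.2‖ ≤ -v.1`, so that `‖e‖ < 1` forces `ψ e < 0`
  (`averagedTilt_neg_of_isPastDirected`).
* The function `ψ` extends continuously to `‖e‖ ≤ 1`. It vanishes for `‖e‖ = 1`, where the
  geodesics become null geodesics of the boundary, since the perturbation leaves the boundary causal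
  structure unchanged. If `ψ` is negative somewhere, it therefore has a negative minimum with
  `‖e‖ < 1`. There `v.2 = 0` and `v.1 < 0`, so that the perturbed geodesic arrives too early
  (`averagedTilt_stdGeodesic_nonneg`).
-/

noncomputable section

set_option maxSynthPendingDepth 5

namespace AdS

open Filter Topology MeasureTheory Asymptotics

variable {d : ℕ}

/-! ### The embedding of anti-de Sitter space into a flat space -/

/-- The flat space `ℝ^{2,d}` containing anti-de Sitter space as a quadric: two timelike
coordinates followed by `d` spacelike ones. -/
abbrev Ambient (d : ℕ) : Type := ℝ × ℝ × EuclideanSpace ℝ (Fin d)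

/-- The flat form of signature `(2, d)` on the ambient space. -/
def ambientForm (d : ℕ) : Ambient d →L[ℝ] Ambient d →L[ℝ] ℝ :=
  let p : Ambient d →L[ℝ] ℝ := ContinuousLinearMap.fst ℝ ℝ (ℝ × EuclideanSpace ℝ (Fin d))
  let r : Ambient d →L[ℝ] ℝ := (ContinuousLinearMap.fst ℝ ℝ (EuclideanSpace ℝ (Fin d))).comp
    (ContinuousLinearMap.snd ℝ ℝ (ℝ × EuclideanSpace ℝ (Fin d)))
  let z : Ambient d →L[ℝ] EuclideanSpace ℝ (Fin d) :=
    (ContinuousLinearMap.snd ℝ ℝ (EuclideanSpace ℝ (Fin d))).comp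
      (ContinuousLinearMap.snd ℝ ℝ (ℝ × EuclideanSpace ℝ (Fin d)))
  let q : Ambient d →L[ℝ] Ambient d →L[ℝ] ℝ :=
    (innerSL ℝ (E := EuclideanSpace ℝ (Fin d))).bilinearComp z z
  q - p.smulRight p - r.smulRight r

theorem ambientForm_apply (u v : Ambient d) :
    ambientForm d u v = -(u.1 * v.1) - u.2.1 * v.2.1 + inner ℝ u.2.2 v.2.2 := by
  simp [ambientForm, ContinuousLinearMap.bilinearComp]
  ring

theorem ambientForm_symm (u v : Ambient d) : ambientForm d u v = ambientForm d v u := by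
  simp only [ambientForm_apply, real_inner_comm]
  ring

/-- The redshift factor `√(-g_tt)` of anti-de Sitter space, the inverse of the conformal factor. -/
def redshift (x : Chart d) : ℝ := (1 + ‖x.2‖ ^ 2) / (1 - ‖x.2‖ ^ 2)

/-- The isometric immersion of anti-de Sitter space of scale `ℓ` onto the quadric `⟨X, X⟩ = -ℓ²`.
The origin `t₀` of the angle in the timelike plane is arbitrary. -/
def embedding (ℓ t₀ : ℝ) (x : Chart d) : Ambient d :=
  (ℓ * redshift x * Real.cos ((x.1 - t₀) / ℓ), ℓ * redshift x * Real.sin ((x.1 - t₀) / ℓ),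
    (2 * ℓ / (1 - ‖x.2‖ ^ 2)) • x.2)

theorem one_sub_normSq_pos {x : Chart d} (hx : x ∈ bulk d) : 0 < 1 - ‖x.2‖ ^ 2 := by
  have h0 : 0 ≤ ‖x.2‖ := norm_nonneg _
  have : ‖x.2‖ < 1 := hx
  nlinarith

theorem isOpen_bulk : IsOpen (bulk d) := by
  have : Continuous fun x : Chart d => ‖x.2‖ := by fun_prop
  exact isOpen_lt this continuous_const

theorem redshift_pos {x : Chart d} (hx : x ∈ bulk d) : 0 < redshift x :=
  div_pos (by positivity) (one_sub_normSq_pos hx)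

theorem contDiffOn_redshift {n : WithTop ℕ∞} : ContDiffOn ℝ n (redshift (d := d)) (bulk d) := by
  have h : ContDiffOn ℝ n (fun x : Chart d => ‖x.2‖ ^ 2) (bulk d) :=
    (contDiff_snd.norm_sq ℝ).contDiffOn
  exact (contDiffOn_const.add h).div (contDiffOn_const.sub h)
    fun x hx => (one_sub_normSq_pos hx).ne'

theorem contDiffOn_embedding {n : WithTop ℕ∞} (ℓ t₀ : ℝ) :
    ContDiffOn ℝ n (embedding (d := d) ℓ t₀) (bulk d) := by
  have h : ContDiffOn ℝ n (fun x : Chart d => ‖x.2‖ ^ 2) (bulk d) :=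
    (contDiff_snd.norm_sq ℝ).contDiffOn
  have hA := contDiffOn_redshift (d := d) (n := n)
  have hτ : ContDiffOn ℝ n (fun x : Chart d => (x.1 - t₀) / ℓ) (bulk d) := by
    have : ContDiff ℝ n (fun x : Chart d => (x.1 - t₀) / ℓ) :=
      (contDiff_fst.sub contDiff_const).div_const ℓ
    exact this.contDiffOn
  refine ((contDiffOn_const.mul hA).mul (Real.contDiff_cos.comp_contDiffOn hτ)).prodMk
    (((contDiffOn_const.mul hA).mul (Real.contDiff_sin.comp_contDiffOn hτ)).prodMk
    (ContDiffOn.smul (contDiffOn_const.div (contDiffOn_const.sub h)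
      fun x hx => (one_sub_normSq_pos hx).ne') contDiff_snd.contDiffOn))

theorem contDiffAt_embedding {n : WithTop ℕ∞} (ℓ t₀ : ℝ) {x : Chart d} (hx : x ∈ bulk d) :
    ContDiffAt ℝ n (embedding ℓ t₀) x :=
  (contDiffOn_embedding ℓ t₀).contDiffAt (isOpen_bulk.mem_nhds hx)

theorem contDiffOn_metric {n : WithTop ℕ∞} (ℓ : ℝ) :
    ContDiffOn ℝ n (metric (d := d) ℓ) (bulk d) := by
  have h : ContDiffOn ℝ n (fun x : Chart d => ‖x.2‖ ^ 2) (bulk d) :=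
    (contDiff_snd.norm_sq ℝ).contDiffOn
  have hA := contDiffOn_redshift (d := d) (n := n)
  have hB : ContDiffOn ℝ n (fun x : Chart d => 4 * ℓ ^ 2 / (1 - ‖x.2‖ ^ 2) ^ 2) (bulk d) :=
    contDiffOn_const.div ((contDiffOn_const.sub h).pow 2)
      fun x hx => (pow_pos (one_sub_normSq_pos hx) 2).ne'
  exact ((hA.pow 2).neg.smul contDiffOn_const).add (hB.smul contDiffOn_const)

theorem hasFDerivAt_normSq (x : Chart d) :
    HasFDerivAt (fun x : Chart d => ‖x.2‖ ^ 2)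
      ((2 : ℝ) • (innerSL ℝ x.2).comp (ContinuousLinearMap.snd ℝ ℝ (EuclideanSpace ℝ (Fin d)))) x := by
  have := (hasFDerivAt_snd (𝕜 := ℝ) (p := x)).norm_sq
  rw [ofNat_smul_eq_nsmul ℝ 2]
  exact this

theorem hasDerivAt_redshift_line {x : Chart d} (hx : x ∈ bulk d) (w : Chart d) :
    HasDerivAt (fun ε : ℝ => redshift (x + ε • w))
      (4 * inner ℝ x.2 w.2 / (1 - ‖x.2‖ ^ 2) ^ 2) 0 := by
  have hl : HasDerivAt (fun ε : ℝ => x + ε • w) w 0 := by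
    simpa using ((hasDerivAt_id (0 : ℝ)).smul_const w).const_add x
  have h := (hasFDerivAt_normSq (x + (0 : ℝ) • w)).comp_hasDerivAt (0 : ℝ) hl
  have hne := (one_sub_normSq_pos hx).ne'
  have := (h.const_add 1).div (h.const_sub 1) (by simpa using hne)
  refine this.congr_deriv ?_
  simp
  field_simp
  ring

/-- The differential of the embedding. -/
theorem fderiv_embedding_apply {ℓ : ℝ} (hℓ : ℓ ≠ 0) (t₀ : ℝ) {x : Chart d} (hx : x ∈ bulk d)
    (w : Chart d) :
    fderiv ℝ (embedding ℓ t₀) x w =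
      (ℓ * (4 * inner ℝ x.2 w.2 / (1 - ‖x.2‖ ^ 2) ^ 2) * Real.cos ((x.1 - t₀) / ℓ)
          - redshift x * Real.sin ((x.1 - t₀) / ℓ) * w.1,
        ℓ * (4 * inner ℝ x.2 w.2 / (1 - ‖x.2‖ ^ 2) ^ 2) * Real.sin ((x.1 - t₀) / ℓ)
          + redshift x * Real.cos ((x.1 - t₀) / ℓ) * w.1,
        (2 * ℓ / (1 - ‖x.2‖ ^ 2)) • w.2
          + (4 * ℓ * inner ℝ x.2 w.2 / (1 - ‖x.2‖ ^ 2) ^ 2) • x.2) := by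
  have hne := (one_sub_normSq_pos hx).ne'
  have hl : HasDerivAt (fun ε : ℝ => x + ε • w) w 0 := by
    simpa using ((hasDerivAt_id (0 : ℝ)).smul_const w).const_add x
  have h1 : HasDerivAt (fun ε : ℝ => embedding ℓ t₀ (x + ε • w))
      (fderiv ℝ (embedding ℓ t₀) x w) 0 := by
    have h := ((contDiffAt_embedding (n := 1) ℓ t₀ hx).differentiableAt (by simp)).hasFDerivAt
    have h' : HasFDerivAt (embedding ℓ t₀) (fderiv ℝ (embedding ℓ t₀) x) (x + (0 : ℝ) • w) := by
      simpa using h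
    exact h'.comp_hasDerivAt (0 : ℝ) hl
  refine h1.unique ?_
  have hA := (hasDerivAt_redshift_line hx w).const_mul ℓ
  have hτ : HasDerivAt (fun ε : ℝ => ((x + ε • w).1 - t₀) / ℓ) (w.1 / ℓ) 0 :=
    (HasDerivAt.sub_const t₀ hl.fst).div_const ℓ
  have hN := (hasFDerivAt_normSq (x + (0 : ℝ) • w)).comp_hasDerivAt (0 : ℝ) hl
  have hB := (hasDerivAt_const (0 : ℝ) (2 * ℓ)).div (hN.const_sub 1) (by simpa using hne)
  refine ((hA.mul hτ.cos).prodMk ((hA.mul hτ.sin).prodMk (hB.smul hl.snd))).congr_deriv ?_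
  refine Prod.ext ?_ (Prod.ext ?_ ?_)
  · simp
    field_simp
    ring
  · simp
    field_simp
  · simp
    congr 2
    ring

/-- The embedding is isometric. -/
theorem ambientForm_fderiv_embedding {ℓ : ℝ} (hℓ : ℓ ≠ 0) (t₀ : ℝ) {x : Chart d} (hx : x ∈ bulk d)
    (u v : Chart d) :
    ambientForm d (fderiv ℝ (embedding ℓ t₀) x u) (fderiv ℝ (embedding ℓ t₀) x v) =
      metric ℓ x u v := by
  have hne := (one_sub_normSq_pos hx).ne'
  have hsc := Real.sin_sq_add_cos_sq ((x.1 - t₀) / ℓ)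
  rw [fderiv_embedding_apply hℓ t₀ hx, fderiv_embedding_apply hℓ t₀ hx, ambientForm_apply,
    metric_apply]
  simp only [inner_add_left, inner_add_right, real_inner_smul_left, real_inner_smul_right,
    real_inner_self_eq_norm_sq, real_inner_comm x.2 u.2]
  set c := Real.cos ((x.1 - t₀) / ℓ)
  set s := Real.sin ((x.1 - t₀) / ℓ)
  have hs : s ^ 2 = 1 - c ^ 2 := by linarith
  rw [redshift]
  field_simp
  ring_nf
  simp only [hs]
  ring

theorem ambientForm_embedding_self (ℓ t₀ : ℝ) {x : Chart d} (hx : x ∈ bulk d) :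
    ambientForm d (embedding ℓ t₀ x) (embedding ℓ t₀ x) = -ℓ ^ 2 := by
  have hne := (one_sub_normSq_pos hx).ne'
  have hsc := Real.sin_sq_add_cos_sq ((x.1 - t₀) / ℓ)
  rw [ambientForm_apply]
  simp only [embedding, redshift, real_inner_smul_left, real_inner_smul_right]
  rw [real_inner_self_eq_norm_sq]
  set c := Real.cos ((x.1 - t₀) / ℓ)
  set s := Real.sin ((x.1 - t₀) / ℓ)
  have hs : s ^ 2 = 1 - c ^ 2 := by linarith
  field_simp
  ring_nf
  simp only [hs]
  ring

/-- The position vector is normal to the quadric. -/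
theorem ambientForm_fderiv_embedding_position {ℓ : ℝ} (t₀ : ℝ) {x : Chart d}
    (hx : x ∈ bulk d) (w : Chart d) :
    ambientForm d (fderiv ℝ (embedding ℓ t₀) x w) (embedding ℓ t₀ x) = 0 := by
  have hd := ((contDiffAt_embedding (n := 1) ℓ t₀ hx).differentiableAt (by simp)).hasFDerivAt
  have h1 := (ambientForm d).hasFDerivAt_of_bilinear hd hd
  have h2 : HasFDerivAt (fun y => ambientForm d (embedding ℓ t₀ y) (embedding ℓ t₀ y))
      (0 : Chart d →L[ℝ] ℝ) x := by
    refine (hasFDerivAt_const (-ℓ ^ 2) x).congr_of_eventuallyEq ?_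
    filter_upwards [isOpen_bulk.mem_nhds hx] with y hy using ambientForm_embedding_self ℓ t₀ hy
  have := congrArg (fun L : Chart d →L[ℝ] ℝ => L w) (h1.unique h2)
  simp [ambientForm_symm (embedding ℓ t₀ x)] at this
  linarith

theorem metric_nondegenerate {ℓ : ℝ} (hℓ : ℓ ≠ 0) {x : Chart d} (hx : x ∈ bulk d) {u : Chart d}
    (hu : ∀ w, metric ℓ x u w = 0) : u = 0 := by
  have hne := one_sub_normSq_pos hx
  have h1 := hu (1, 0)
  have h2 := hu (0, u.2)
  simp only [metric_apply, inner_zero_right, mul_one, mul_zero, add_zero, zero_add,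
    real_inner_self_eq_norm_sq] at h1 h2
  refine Prod.ext ?_ ?_
  · have : ((1 + ‖x.2‖ ^ 2) / (1 - ‖x.2‖ ^ 2)) ^ 2 ≠ 0 := by positivity
    simpa [this] using h1
  · have : 4 * ℓ ^ 2 / (1 - ‖x.2‖ ^ 2) ^ 2 ≠ 0 := by positivity
    simpa [this] using h2

/-- Tangent vectors of the quadric and its position vector span the ambient space; as the form
there is nondegenerate, a vector orthogonal to all of them vanishes. -/
theorem eq_zero_of_orthogonal {ℓ : ℝ} (hℓ : ℓ ≠ 0) (t₀ : ℝ) {x : Chart d} (hx : x ∈ bulk d)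
    {Z : Ambient d} (htan : ∀ w, ambientForm d Z (fderiv ℝ (embedding ℓ t₀) x w) = 0)
    (hpos : ambientForm d Z (embedding ℓ t₀ x) = 0) : Z = 0 := by
  have hne := one_sub_normSq_pos hx
  have hA := redshift_pos hx
  have hsc := Real.sin_sq_add_cos_sq ((x.1 - t₀) / ℓ)
  have h1 := htan (1, 0)
  have h2 : ∀ b, ambientForm d Z (fderiv ℝ (embedding ℓ t₀) x (0, b)) = 0 := fun b => htan _
  simp only [fderiv_embedding_apply hℓ t₀ hx, ambientForm_apply, embedding] at h1 h2 hpos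
  set c := Real.cos ((x.1 - t₀) / ℓ)
  set s := Real.sin ((x.1 - t₀) / ℓ)
  simp only [inner_zero_right, mul_zero, zero_div, zero_mul, mul_one, zero_sub, zero_add,
    smul_zero, zero_smul, add_zero, sub_zero, inner_add_right, real_inner_smul_right] at h1 h2 hpos
  -- `α` is the component of `Z` along the radial direction of the timelike plane
  set α := Z.1 * c + Z.2.1 * s with hα
  set z := inner ℝ Z.2.2 x.2 with hz
  have hβ : Z.1 * s - Z.2.1 * c = 0 := by
    have : redshift x * (Z.1 * s - Z.2.1 * c) = 0 := by linarith
    simpa [hA.ne'] using this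
  have hαz : redshift x * α = 2 / (1 - ‖x.2‖ ^ 2) * z := by
    have : ℓ * (redshift x * α - 2 / (1 - ‖x.2‖ ^ 2) * z) = 0 := by
      rw [hα]; linear_combination (-1) * hpos
    have := (mul_eq_zero.1 this).resolve_left hℓ
    linarith
  have hb := h2 x.2
  rw [real_inner_self_eq_norm_sq] at hb
  have hz0 : z = 0 := by
    have e1 : 2 / (1 - ‖x.2‖ ^ 2) * z + 4 * ‖x.2‖ ^ 2 / (1 - ‖x.2‖ ^ 2) ^ 2 * z
        - 4 * ‖x.2‖ ^ 2 / (1 - ‖x.2‖ ^ 2) ^ 2 * α = 0 := by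
      have : ℓ * (2 / (1 - ‖x.2‖ ^ 2) * z + 4 * ‖x.2‖ ^ 2 / (1 - ‖x.2‖ ^ 2) ^ 2 * z
        - 4 * ‖x.2‖ ^ 2 / (1 - ‖x.2‖ ^ 2) ^ 2 * α) = 0 := by
        rw [hα]; linear_combination hb
      exact (mul_eq_zero.1 this).resolve_left hℓ
    have e2 : α = 2 / (1 + ‖x.2‖ ^ 2) * z := by
      rw [redshift] at hαz
      field_simp at hαz ⊢
      linarith
    rw [e2] at e1
    have e3 : 2 / (1 - ‖x.2‖ ^ 2) * z + 4 * ‖x.2‖ ^ 2 / (1 - ‖x.2‖ ^ 2) ^ 2 * z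
        - 4 * ‖x.2‖ ^ 2 / (1 - ‖x.2‖ ^ 2) ^ 2 * (2 / (1 + ‖x.2‖ ^ 2) * z)
        = 2 / (1 + ‖x.2‖ ^ 2) * z := by
      field_simp
      ring
    rw [e3] at e1
    have : 2 / (1 + ‖x.2‖ ^ 2) ≠ 0 := by positivity
    exact (mul_eq_zero.1 e1).resolve_left this
  have hα0 : α = 0 := by
    rw [hz0, mul_zero] at hαz
    exact (mul_eq_zero.1 hαz).resolve_left hA.ne'
  have hZ1 : Z.1 = 0 := by linear_combination (-Z.1) * hsc + c * hα0 + s * hβ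
  have hZ2 : Z.2.1 = 0 := by linear_combination (-Z.2.1) * hsc + s * hα0 - c * hβ
  refine Prod.ext hZ1 (Prod.ext hZ2 ?_)
  have hb := h2 Z.2.2
  rw [hZ1, hZ2, hz0, real_inner_self_eq_norm_sq] at hb
  have h3 : 2 * ℓ / (1 - ‖x.2‖ ^ 2) ≠ 0 := by positivity
  simpa [h3] using hb

/-! ### Geodesics and their deviation fields in the ambient space -/

theorem differentiableAt_embedding (ℓ t₀ : ℝ) {x : Chart d} (hx : x ∈ bulk d) :
    DifferentiableAt ℝ (embedding ℓ t₀) x :=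
  (contDiffAt_embedding (n := 1) ℓ t₀ hx).differentiableAt (by simp)

theorem contDiffAt_fderiv_embedding {n : ℕ} (ℓ t₀ : ℝ) {x : Chart d} (hx : x ∈ bulk d) :
    ContDiffAt ℝ n (fderiv ℝ (embedding ℓ t₀)) x :=
  (contDiffAt_embedding (n := (n : WithTop ℕ∞) + 1) ℓ t₀ hx).fderiv_right le_rfl

theorem contDiffAt_fderiv_fderiv_embedding {n : ℕ} (ℓ t₀ : ℝ) {x : Chart d} (hx : x ∈ bulk d) :
    ContDiffAt ℝ n (fderiv ℝ (fderiv ℝ (embedding ℓ t₀))) x :=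
  (contDiffAt_fderiv_embedding (n := n + 1) ℓ t₀ hx).fderiv_right (by simp)

theorem differentiableAt_fderiv_embedding (ℓ t₀ : ℝ) {x : Chart d} (hx : x ∈ bulk d) :
    DifferentiableAt ℝ (fderiv ℝ (embedding ℓ t₀)) x :=
  (contDiffAt_fderiv_embedding (n := 1) ℓ t₀ hx).differentiableAt (by simp)

theorem differentiableAt_fderiv_fderiv_embedding (ℓ t₀ : ℝ) {x : Chart d} (hx : x ∈ bulk d) :
    DifferentiableAt ℝ (fderiv ℝ (fderiv ℝ (embedding ℓ t₀))) x :=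
  (contDiffAt_fderiv_fderiv_embedding (n := 1) ℓ t₀ hx).differentiableAt (by simp)

theorem fderiv_fderiv_embedding_symm (ℓ t₀ : ℝ) {x : Chart d} (hx : x ∈ bulk d) (u v : Chart d) :
    fderiv ℝ (fderiv ℝ (embedding ℓ t₀)) x u v = fderiv ℝ (fderiv ℝ (embedding ℓ t₀)) x v u :=
  ((contDiffAt_embedding (n := 2) ℓ t₀ hx).isSymmSndFDerivAt (by simp)) u v

theorem fderiv_fderiv_fderiv_embedding_symm_left (ℓ t₀ : ℝ) {x : Chart d} (hx : x ∈ bulk d)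
    (u v w : Chart d) :
    fderiv ℝ (fderiv ℝ (fderiv ℝ (embedding ℓ t₀))) x u v w =
      fderiv ℝ (fderiv ℝ (fderiv ℝ (embedding ℓ t₀))) x v u w := by
  have := ((contDiffAt_fderiv_embedding (n := 2) ℓ t₀ hx).isSymmSndFDerivAt (by simp)) u v
  exact congrArg (fun L : Chart d →L[ℝ] Ambient d => L w) this

theorem fderiv_fderiv_fderiv_embedding_symm_right (ℓ t₀ : ℝ) {x : Chart d} (hx : x ∈ bulk d)
    (u v w : Chart d) :
    fderiv ℝ (fderiv ℝ (fderiv ℝ (embedding ℓ t₀))) x u v w =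
      fderiv ℝ (fderiv ℝ (fderiv ℝ (embedding ℓ t₀))) x u w v := by
  have hd := (differentiableAt_fderiv_fderiv_embedding ℓ t₀ hx).hasFDerivAt
  have h1 := (hd.clm_apply (hasFDerivAt_const v x)).clm_apply (hasFDerivAt_const w x)
  have h2 := (hd.clm_apply (hasFDerivAt_const w x)).clm_apply (hasFDerivAt_const v x)
  have h3 := h2.congr_of_eventuallyEq (f₁ := fun y =>
    fderiv ℝ (fderiv ℝ (embedding ℓ t₀)) y v w) (by
      filter_upwards [isOpen_bulk.mem_nhds hx] with y hy using
        fderiv_fderiv_embedding_symm ℓ t₀ hy v w)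
  have := congrArg (fun L : Chart d →L[ℝ] Ambient d => L u) (h1.unique h3)
  simpa using this

theorem fderiv_metric_apply {ℓ : ℝ} (hℓ : ℓ ≠ 0) (t₀ : ℝ) {x : Chart d} (hx : x ∈ bulk d)
    (u v w : Chart d) :
    fderiv ℝ (metric ℓ) x u v w =
      ambientForm d (fderiv ℝ (fderiv ℝ (embedding ℓ t₀)) x u v) (fderiv ℝ (embedding ℓ t₀) x w)
      + ambientForm d (fderiv ℝ (embedding ℓ t₀) x v)
        (fderiv ℝ (fderiv ℝ (embedding ℓ t₀)) x u w) := by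
  have hg : HasFDerivAt (metric ℓ) (fderiv ℝ (metric ℓ) x) x :=
    (((contDiffOn_metric (n := 1) ℓ).contDiffAt (isOpen_bulk.mem_nhds hx)).differentiableAt
      (by simp)).hasFDerivAt
  have h1 := (hg.clm_apply (hasFDerivAt_const v x)).clm_apply (hasFDerivAt_const w x)
  have hd := (differentiableAt_fderiv_embedding ℓ t₀ hx).hasFDerivAt
  have h2 := (ambientForm d).hasFDerivAt_of_bilinear (hd.clm_apply (hasFDerivAt_const v x))
    (hd.clm_apply (hasFDerivAt_const w x))
  have h3 := h2.congr_of_eventuallyEq (f₁ := fun y => metric ℓ y v w) (by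
      filter_upwards [isOpen_bulk.mem_nhds hx] with y hy using
        (ambientForm_fderiv_embedding hℓ t₀ hy v w).symm)
  have := congrArg (fun L : Chart d →L[ℝ] ℝ => L u) (h1.unique h3)
  simp at this
  rw [this, add_comm]

/-- The acceleration in anti-de Sitter space is the tangential part of the acceleration in the
ambient space. -/
theorem acceleration_metric {ℓ : ℝ} (hℓ : ℓ ≠ 0) (t₀ : ℝ) {x : Chart d} (hx : x ∈ bulk d)
    (v a w : Chart d) :
    acceleration (metric ℓ) x v a w =
      ambientForm d (fderiv ℝ (embedding ℓ t₀) x a + fderiv ℝ (fderiv ℝ (embedding ℓ t₀)) x v v)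
        (fderiv ℝ (embedding ℓ t₀) x w) := by
  rw [acceleration, christoffel, fderiv_metric_apply hℓ t₀ hx, fderiv_metric_apply hℓ t₀ hx,
    ← ambientForm_fderiv_embedding hℓ t₀ hx, fderiv_fderiv_embedding_symm ℓ t₀ hx w v,
    ambientForm_symm (fderiv ℝ (fderiv ℝ (embedding ℓ t₀)) x v w), map_add,
    add_apply]
  ring

theorem hasDerivAt_fderiv_embedding_apply (ℓ t₀ : ℝ) {γ ξ : ℝ → Chart d} {γ' ξ' : Chart d} {s : ℝ}
    (hx : γ s ∈ bulk d) (hγ : HasDerivAt γ γ' s) (hξ : HasDerivAt ξ ξ' s) :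
    HasDerivAt (fun s => fderiv ℝ (embedding ℓ t₀) (γ s) (ξ s))
      (fderiv ℝ (fderiv ℝ (embedding ℓ t₀)) (γ s) γ' (ξ s)
        + fderiv ℝ (embedding ℓ t₀) (γ s) ξ') s :=
  ((differentiableAt_fderiv_embedding ℓ t₀ hx).hasFDerivAt.comp_hasDerivAt s hγ).clm_apply hξ

theorem hasDerivAt_fderiv_fderiv_embedding_apply (ℓ t₀ : ℝ) {γ ξ χ : ℝ → Chart d}
    {γ' ξ' χ' : Chart d} {s : ℝ} (hx : γ s ∈ bulk d) (hγ : HasDerivAt γ γ' s)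
    (hξ : HasDerivAt ξ ξ' s) (hχ : HasDerivAt χ χ' s) :
    HasDerivAt (fun s => fderiv ℝ (fderiv ℝ (embedding ℓ t₀)) (γ s) (ξ s) (χ s))
      (fderiv ℝ (fderiv ℝ (fderiv ℝ (embedding ℓ t₀))) (γ s) γ' (ξ s) (χ s)
        + fderiv ℝ (fderiv ℝ (embedding ℓ t₀)) (γ s) ξ' (χ s)
        + fderiv ℝ (fderiv ℝ (embedding ℓ t₀)) (γ s) (ξ s) χ') s := by
  refine ((((differentiableAt_fderiv_fderiv_embedding ℓ t₀ hx).hasFDerivAt.comp_hasDerivAt s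
    hγ).clm_apply hξ).clm_apply hχ).congr_deriv ?_
  simp

theorem hasDerivAt_of_contDiff_two {E : Type*} [NormedAddCommGroup E] [NormedSpace ℝ E]
    {γ : ℝ → E} (hγ : ContDiff ℝ 2 γ) (s : ℝ) : HasDerivAt γ (deriv γ s) s :=
  (hγ.differentiable (by simp) s).hasDerivAt

theorem hasDerivAt_deriv_of_contDiff_two {E : Type*} [NormedAddCommGroup E] [NormedSpace ℝ E]
    {γ : ℝ → E} (hγ : ContDiff ℝ 2 γ) (s : ℝ) : HasDerivAt (deriv γ) (deriv (deriv γ) s) s :=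
  ((ContDiff.differentiable_deriv_two hγ) s).hasDerivAt

/-- The displacement in the ambient space of a vector field along a curve. -/
def displacement (ℓ t₀ : ℝ) (γ η : ℝ → Chart d) (s : ℝ) : Ambient d :=
  fderiv ℝ (embedding ℓ t₀) (γ s) (η s)

theorem deriv_displacement (ℓ t₀ : ℝ) {γ η : ℝ → Chart d} (hb : ∀ s, γ s ∈ bulk d)
    (hγ : ContDiff ℝ 2 γ) (hη : ContDiff ℝ 2 η) :
    deriv (displacement ℓ t₀ γ η) = fun s =>
      fderiv ℝ (fderiv ℝ (embedding ℓ t₀)) (γ s) (deriv γ s) (η s)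
        + fderiv ℝ (embedding ℓ t₀) (γ s) (deriv η s) :=
  funext fun s => (hasDerivAt_fderiv_embedding_apply ℓ t₀ (hb s)
    (hasDerivAt_of_contDiff_two hγ s) (hasDerivAt_of_contDiff_two hη s)).deriv

theorem hasDerivAt_deriv_displacement (ℓ t₀ : ℝ) {γ η : ℝ → Chart d} (hb : ∀ s, γ s ∈ bulk d)
    (hγ : ContDiff ℝ 2 γ) (hη : ContDiff ℝ 2 η) (s : ℝ) :
    HasDerivAt (deriv (displacement ℓ t₀ γ η))
      (fderiv ℝ (fderiv ℝ (fderiv ℝ (embedding ℓ t₀))) (γ s) (deriv γ s) (deriv γ s) (η s)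
        + fderiv ℝ (fderiv ℝ (embedding ℓ t₀)) (γ s) (deriv (deriv γ) s) (η s)
        + fderiv ℝ (fderiv ℝ (embedding ℓ t₀)) (γ s) (deriv γ s) (deriv η s)
        + (fderiv ℝ (fderiv ℝ (embedding ℓ t₀)) (γ s) (deriv γ s) (deriv η s)
        + fderiv ℝ (embedding ℓ t₀) (γ s) (deriv (deriv η) s))) s := by
  rw [deriv_displacement ℓ t₀ hb hγ hη]
  exact (hasDerivAt_fderiv_fderiv_embedding_apply ℓ t₀ (hb s) (hasDerivAt_of_contDiff_two hγ s)
    (hasDerivAt_deriv_of_contDiff_two hγ s) (hasDerivAt_of_contDiff_two hη s)).add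
    (hasDerivAt_fderiv_embedding_apply ℓ t₀ (hb s) (hasDerivAt_of_contDiff_two hγ s)
    (hasDerivAt_deriv_of_contDiff_two hη s))

theorem hasDerivAt_ambientForm {u v : ℝ → Ambient d} {u' v' : Ambient d} {s : ℝ}
    (hu : HasDerivAt u u' s) (hv : HasDerivAt v v' s) :
    HasDerivAt (fun s => ambientForm d (u s) (v s))
      (ambientForm d u' (v s) + ambientForm d (u s) v') s := by
  have h1 : HasDerivAt (fun s => ambientForm d (u s)) (ambientForm d u') s :=
    (ambientForm d).hasFDerivAt.comp_hasDerivAt s hu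
  exact h1.clm_apply hv

/-- Null geodesics of anti-de Sitter space are straight lines of the ambient space. -/
theorem IsCompleteNullGeodesic.ambient_acceleration {ℓ : ℝ} (hℓ : ℓ ≠ 0) (t₀ : ℝ)
    {γ : ℝ → Chart d} (hγ : IsCompleteNullGeodesic ℓ γ) (s : ℝ) :
    fderiv ℝ (embedding ℓ t₀) (γ s) (deriv (deriv γ) s)
      + fderiv ℝ (fderiv ℝ (embedding ℓ t₀)) (γ s) (deriv γ s) (deriv γ s) = 0 := by
  have hd := hasDerivAt_of_contDiff_two hγ.contDiff s
  refine eq_zero_of_orthogonal hℓ t₀ (hγ.mem_bulk s) (fun w => ?_) ?_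
  · rw [← acceleration_metric hℓ t₀ (hγ.mem_bulk s)]
    exact hγ.geodesic s w
  · have h1 := hasDerivAt_fderiv_embedding_apply ℓ t₀ (hγ.mem_bulk s) hd
      (hasDerivAt_deriv_of_contDiff_two hγ.contDiff s)
    have h2 := (differentiableAt_embedding ℓ t₀ (hγ.mem_bulk s)).hasFDerivAt.comp_hasDerivAt s hd
    have h3 := hasDerivAt_ambientForm h1 h2
    have h4 : HasDerivAt (fun s => ambientForm d (fderiv ℝ (embedding ℓ t₀) (γ s) (deriv γ s))
        ((embedding ℓ t₀ ∘ γ) s)) 0 s :=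
      (hasDerivAt_const s (0 : ℝ)).congr_of_eventuallyEq (Eventually.of_forall fun r =>
        ambientForm_fderiv_embedding_position t₀ (hγ.mem_bulk r) _)
    have h5 := h3.unique h4
    rw [ambientForm_fderiv_embedding hℓ t₀ (hγ.mem_bulk s), hγ.null s, add_zero, add_comm] at h5
    exact h5

theorem hasDerivAt_mul_of_continuousAt {c : ℝ → ℝ} (hc : ContinuousAt c 0) :
    HasDerivAt (fun ε => ε * c ε) (c 0) 0 := by
  rw [hasDerivAt_iff_tendsto_slope]
  refine (hc.tendsto.mono_left nhdsWithin_le_nhds).congr' ?_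
  filter_upwards [self_mem_nhdsWithin] with ε hε
  have : ε ≠ 0 := hε
  simp [slope, this]

theorem acceleration_perturbedMetric {ℓ : ℝ} {h : Chart d → Form d}
    (hh : ContDiffOn ℝ 2 h (bulk d)) (ε : ℝ) {x : Chart d} (hx : x ∈ bulk d) (v a w : Chart d) :
    acceleration (perturbedMetric ℓ h ε) x v a w =
      acceleration (metric ℓ) x v a w + ε * acceleration h x v a w := by
  have hg : HasFDerivAt (metric ℓ) (fderiv ℝ (metric ℓ) x) x :=
    (((contDiffOn_metric (n := 1) ℓ).contDiffAt (isOpen_bulk.mem_nhds hx)).differentiableAt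
      (by simp)).hasFDerivAt
  have hh' : HasFDerivAt h (fderiv ℝ h x) x :=
    ((hh.contDiffAt (isOpen_bulk.mem_nhds hx)).differentiableAt (by simp)).hasFDerivAt
  have : fderiv ℝ (perturbedMetric ℓ h ε) x = fderiv ℝ (metric ℓ) x + ε • fderiv ℝ h x :=
    (hg.add (hh'.const_smul ε)).fderiv
  simp only [acceleration, christoffel, this, perturbedMetric, add_apply,
    smul_apply, smul_eq_mul]
  ring

theorem continuousAt_acceleration {h : Chart d → Form d} (hh : ContDiffOn ℝ 2 h (bulk d))
    {T : Type*} [TopologicalSpace T] {x v a w : T → Chart d} {s : T} (hb : x s ∈ bulk d)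
    (hx : ContinuousAt x s) (hv : ContinuousAt v s) (ha : ContinuousAt a s)
    (hw : ContinuousAt w s) :
    ContinuousAt (fun r => acceleration h (x r) (v r) (a r) (w r)) s := by
  have h1 : ContinuousAt (fun r => h (x r)) s :=
    ContinuousAt.comp (g := h) (hh.contDiffAt (isOpen_bulk.mem_nhds hb)).continuousAt hx
  have h2 : ContinuousAt (fun r => fderiv ℝ h (x r)) s :=
    ContinuousAt.comp (g := fderiv ℝ h) ((hh.contDiffAt (isOpen_bulk.mem_nhds hb)).fderiv_right
      (m := 1) (by norm_num)).continuousAt hx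
  exact ((h1.clm_apply ha).clm_apply hw).add (continuousAt_const.mul
    ((((h2.clm_apply hv).clm_apply hv).clm_apply hw).add
      (((h2.clm_apply hv).clm_apply hv).clm_apply hw) |>.sub
      (((h2.clm_apply hw).clm_apply hv).clm_apply hv)))

/-- The linearized geodesic equation, along a null geodesic, is the equation of motion of the
displacement in the flat ambient space under a force exerted by the perturbation. -/
theorem hasDerivAt_acceleration_perturbedMetric {ℓ : ℝ} (hℓ : ℓ ≠ 0) (t₀ : ℝ)
    {h : Chart d → Form d} (hh : ContDiffOn ℝ 2 h (bulk d)) {γ η : ℝ → Chart d}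
    (hγ : IsCompleteNullGeodesic ℓ γ) (hη : ContDiff ℝ 2 η) (s : ℝ) (w : Chart d) :
    HasDerivAt (fun ε : ℝ =>
      acceleration (perturbedMetric ℓ h ε) (γ s + ε • η s) (deriv γ s + ε • deriv η s)
        (deriv (deriv γ) s + ε • deriv (deriv η) s) w)
      (ambientForm d (deriv (deriv (displacement ℓ t₀ γ η)) s)
          (fderiv ℝ (embedding ℓ t₀) (γ s) w)
        + acceleration h (γ s) (deriv γ s) (deriv (deriv γ) s) w) 0 := by
  have hb := hγ.mem_bulk s
  have hb0 : γ s + (0 : ℝ) • η s ∈ bulk d := by simpa using hb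
  have line : ∀ p v : Chart d, HasDerivAt (fun ε : ℝ => p + ε • v) v 0 := fun p v => by
    simpa using ((hasDerivAt_id (0 : ℝ)).smul_const v).const_add p
  have e1 := (hasDerivAt_fderiv_embedding_apply ℓ t₀ (γ := fun ε : ℝ => γ s + ε • η s)
    (ξ := fun ε : ℝ => deriv (deriv γ) s + ε • deriv (deriv η) s) hb0 (line (γ s) (η s))
    (line (deriv (deriv γ) s) (deriv (deriv η) s))).add
    (hasDerivAt_fderiv_fderiv_embedding_apply ℓ t₀ (γ := fun ε : ℝ => γ s + ε • η s)
      (ξ := fun ε : ℝ => deriv γ s + ε • deriv η s) (χ := fun ε : ℝ => deriv γ s + ε • deriv η s)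
      hb0 (line (γ s) (η s))
      (line (deriv γ s) (deriv η s)) (line (deriv γ s) (deriv η s)))
  have e2 := hasDerivAt_fderiv_embedding_apply ℓ t₀ (γ := fun ε : ℝ => γ s + ε • η s)
    (ξ := fun _ : ℝ => w) hb0 (line (γ s) (η s)) (hasDerivAt_const (0 : ℝ) w)
  have e3 := hasDerivAt_ambientForm e1 e2
  have cont : ContinuousAt (fun ε : ℝ => acceleration h (γ s + ε • η s) (deriv γ s + ε • deriv η s)
      (deriv (deriv γ) s + ε • deriv (deriv η) s) w) 0 :=
    continuousAt_acceleration hh hb0 (line _ _).continuousAt (line _ _).continuousAt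
      (line _ _).continuousAt continuousAt_const
  have e4 := e3.add (hasDerivAt_mul_of_continuousAt cont)
  have e5 := e4.congr_of_eventuallyEq (f₁ := fun ε : ℝ =>
      acceleration (perturbedMetric ℓ h ε) (γ s + ε • η s) (deriv γ s + ε • deriv η s)
        (deriv (deriv γ) s + ε • deriv (deriv η) s) w) (by
    filter_upwards [(line (γ s) (η s)).continuousAt.preimage_mem_nhds
      (isOpen_bulk.mem_nhds hb0)] with ε hε
    rw [acceleration_perturbedMetric hh ε hε, acceleration_metric hℓ t₀ hε]
    rfl)
  refine e5.congr_deriv ?_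
  have e6 := hγ.ambient_acceleration hℓ t₀ s
  rw [(hasDerivAt_deriv_displacement ℓ t₀ hγ.mem_bulk hγ.contDiff hη s).deriv]
  simp only [zero_smul, add_zero, Pi.add_apply, map_zero, e6, zero_apply]
  congr 3
  rw [fderiv_fderiv_embedding_symm ℓ t₀ hb (deriv (deriv γ) s) (η s),
    fderiv_fderiv_embedding_symm ℓ t₀ hb (deriv η s) (deriv γ s),
    fderiv_fderiv_fderiv_embedding_symm_right ℓ t₀ hb (deriv γ s) (deriv γ s) (η s),
    fderiv_fderiv_fderiv_embedding_symm_left ℓ t₀ hb (deriv γ s) (η s) (deriv γ s)]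
  abel

theorem hasDerivAt_perturbedMetric {ℓ : ℝ} (hℓ : ℓ ≠ 0) (t₀ : ℝ)
    {h : Chart d → Form d} (hh : ContDiffOn ℝ 2 h (bulk d)) {γ η : ℝ → Chart d}
    (hγ : IsCompleteNullGeodesic ℓ γ) (hη : ContDiff ℝ 2 η) (s : ℝ) :
    HasDerivAt (fun ε : ℝ =>
      perturbedMetric ℓ h ε (γ s + ε • η s) (deriv γ s + ε • deriv η s)
        (deriv γ s + ε • deriv η s))
      (2 * ambientForm d (deriv (displacement ℓ t₀ γ η) s)
          (fderiv ℝ (embedding ℓ t₀) (γ s) (deriv γ s))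
        + h (γ s) (deriv γ s) (deriv γ s)) 0 := by
  have hb := hγ.mem_bulk s
  have hb0 : γ s + (0 : ℝ) • η s ∈ bulk d := by simpa using hb
  have line : ∀ p v : Chart d, HasDerivAt (fun ε : ℝ => p + ε • v) v 0 := fun p v => by
    simpa using ((hasDerivAt_id (0 : ℝ)).smul_const v).const_add p
  have e1 := hasDerivAt_fderiv_embedding_apply ℓ t₀ (γ := fun ε : ℝ => γ s + ε • η s)
    (ξ := fun ε : ℝ => deriv γ s + ε • deriv η s) hb0 (line (γ s) (η s))
    (line (deriv γ s) (deriv η s))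
  have e3 := hasDerivAt_ambientForm e1 e1
  have c1 : ContinuousAt (fun ε : ℝ => h (γ s + ε • η s)) 0 :=
    ContinuousAt.comp (g := h) (hh.contDiffAt (isOpen_bulk.mem_nhds hb0)).continuousAt
      (line (γ s) (η s)).continuousAt
  have cont : ContinuousAt (fun ε : ℝ => h (γ s + ε • η s) (deriv γ s + ε • deriv η s)
      (deriv γ s + ε • deriv η s)) 0 :=
    (c1.clm_apply (line _ _).continuousAt).clm_apply (line _ _).continuousAt
  have e4 := e3.add (hasDerivAt_mul_of_continuousAt cont)
  have e5 := e4.congr_of_eventuallyEq (f₁ := fun ε : ℝ =>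
      perturbedMetric ℓ h ε (γ s + ε • η s) (deriv γ s + ε • deriv η s)
        (deriv γ s + ε • deriv η s)) (by
    filter_upwards [(line (γ s) (η s)).continuousAt.preimage_mem_nhds
      (isOpen_bulk.mem_nhds hb0)] with ε hε
    simp only [Pi.add_apply]
    rw [ambientForm_fderiv_embedding hℓ t₀ hε]
    rfl)
  refine e5.congr_deriv ?_
  rw [deriv_displacement ℓ t₀ hγ.mem_bulk hγ.contDiff hη]
  simp only [zero_smul, add_zero]
  rw [ambientForm_symm (fderiv ℝ (embedding ℓ t₀) (γ s) (deriv γ s)),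
    fderiv_fderiv_embedding_symm ℓ t₀ hb (η s) (deriv γ s)]
  ring

/-- A vector field along a null geodesic is a deviation field if and only if its displacement obeys
Newton's law in the flat space and its null constraint. -/
theorem isDeviationField_iff {ℓ : ℝ} (hℓ : ℓ ≠ 0) (t₀ : ℝ)
    {h : Chart d → Form d} (hh : ContDiffOn ℝ 2 h (bulk d)) {γ η : ℝ → Chart d}
    (hγ : IsCompleteNullGeodesic ℓ γ) (hη : ContDiff ℝ 2 η) :
    IsDeviationField ℓ h γ η ↔
      (∀ s w, ambientForm d (deriv (deriv (displacement ℓ t₀ γ η)) s)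
          (fderiv ℝ (embedding ℓ t₀) (γ s) w)
        = -acceleration h (γ s) (deriv γ s) (deriv (deriv γ) s) w) ∧
      ∀ s, 2 * ambientForm d (deriv (displacement ℓ t₀ γ η) s)
          (fderiv ℝ (embedding ℓ t₀) (γ s) (deriv γ s))
        = -tiltDensity h γ s := by
  constructor
  · intro H
    refine ⟨fun s w => ?_, fun s => ?_⟩
    · have := (hasDerivAt_acceleration_perturbedMetric hℓ t₀ hh hγ hη s w).unique (H.geodesic s w)
      linarith
    · have := (hasDerivAt_perturbedMetric hℓ t₀ hh hγ hη s).unique (H.null s)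
      rw [tiltDensity]
      linarith
  · rintro ⟨H1, H2⟩
    refine ⟨hη, fun s w => ?_, fun s => ?_⟩
    · refine (hasDerivAt_acceleration_perturbedMetric hℓ t₀ hh hγ hη s w).congr_deriv ?_
      rw [H1, neg_add_cancel]
    · refine (hasDerivAt_perturbedMetric hℓ t₀ hh hγ hη s).congr_deriv ?_
      rw [H2, tiltDensity, neg_add_cancel]

/-! ### Standard null geodesics -/

/-- The function `√(1 + s²)`, proportional to the redshift factor along standard null geodesics. -/
def japanese (s : ℝ) : ℝ := √(1 + s ^ 2)

theorem japanese_sq (s : ℝ) : japanese s ^ 2 = 1 + s ^ 2 := Real.sq_sqrt (by positivity)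

theorem japanese_pos (s : ℝ) : 0 < japanese s := Real.sqrt_pos.2 (by positivity)

theorem one_le_japanese (s : ℝ) : 1 ≤ japanese s := Real.one_le_sqrt.2 (by nlinarith [sq_nonneg s])

theorem abs_le_japanese (s : ℝ) : |s| ≤ japanese s :=
  Real.abs_le_sqrt (by linarith)

theorem hasDerivAt_japanese (s : ℝ) : HasDerivAt japanese (s / japanese s) s := by
  have h1 : HasDerivAt (fun s : ℝ => 1 + s ^ 2) (2 * s) s := by
    simpa using (hasDerivAt_pow 2 s).const_add 1
  refine (h1.sqrt (by positivity)).congr_deriv ?_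
  rw [← japanese]
  field_simp

theorem contDiff_japanese {n : WithTop ℕ∞} : ContDiff ℝ n japanese :=
  (contDiff_const.add (contDiff_id.pow 2)).sqrt fun s => by positivity

theorem continuous_japanese : Continuous japanese := (contDiff_japanese (n := 0)).continuous

/-- The inverse redshift factor `√(1 - ‖e‖²)` at the point of closest approach to the origin of
a standard null geodesic. -/
def lapse (e : EuclideanSpace ℝ (Fin d)) : ℝ := √(1 - ‖e‖ ^ 2)

theorem lapse_nonneg (e : EuclideanSpace ℝ (Fin d)) : 0 ≤ lapse e := Real.sqrt_nonneg _

theorem lapse_le_one (e : EuclideanSpace ℝ (Fin d)) : lapse e ≤ 1 :=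
  Real.sqrt_le_one.2 (by nlinarith [sq_nonneg ‖e‖])

theorem lapse_sq {e : EuclideanSpace ℝ (Fin d)} (he : ‖e‖ ≤ 1) : lapse e ^ 2 = 1 - ‖e‖ ^ 2 :=
  Real.sq_sqrt (by nlinarith [norm_nonneg e])

theorem lapse_pos {e : EuclideanSpace ℝ (Fin d)} (he : ‖e‖ < 1) : 0 < lapse e :=
  Real.sqrt_pos.2 (by nlinarith [norm_nonneg e])

theorem continuous_lapse : Continuous (lapse (d := d)) :=
  Real.continuous_sqrt.comp (by fun_prop)

theorem lapse_add_japanese_pos (e : EuclideanSpace ℝ (Fin d)) (s : ℝ) :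
    0 < lapse e + japanese s := add_pos_of_nonneg_of_pos (lapse_nonneg e) (japanese_pos s)

/-- The null geodesic from the boundary point `(t₀ - π ℓ / 2, -n)` to its antipode
`(t₀ + π ℓ / 2, n)`, for a unit vector `n`, which crosses the hyperplane orthogonal to `n` in the
direction of the vector `e` of that hyperplane. Any `e` with `‖e‖ < 1` occurs; for `‖e‖ = 1` the
formula still makes sense and gives a null geodesic of the boundary. -/
def stdGeodesic (ℓ t₀ : ℝ) (n e : EuclideanSpace ℝ (Fin d)) (s : ℝ) : Chart d :=
  (t₀ + ℓ * Real.arctan s, (lapse e + japanese s)⁻¹ • (e + s • n))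

/-- The velocity of a standard null geodesic. -/
def stdVelocity (ℓ : ℝ) (n e : EuclideanSpace ℝ (Fin d)) (s : ℝ) : Chart d :=
  (ℓ / (1 + s ^ 2), (japanese s * (lapse e + japanese s) ^ 2)⁻¹ •
    ((lapse e * japanese s + 1) • n - s • e))

theorem hasDerivAt_stdGeodesic (ℓ t₀ : ℝ) (n e : EuclideanSpace ℝ (Fin d)) (s : ℝ) :
    HasDerivAt (stdGeodesic ℓ t₀ n e) (stdVelocity ℓ n e s) s := by
  have hR := japanese_pos s
  have hq := lapse_add_japanese_pos e s
  have h1 := ((Real.hasDerivAt_arctan s).const_mul ℓ).const_add t₀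
  have h2 := ((hasDerivAt_japanese s).const_add (lapse e)).fun_inv hq.ne'
  have h3 : HasDerivAt (fun s : ℝ => e + s • n) n s := by
    simpa using ((hasDerivAt_id s).smul_const n).const_add e
  refine (h1.prodMk (h2.smul h3)).congr_deriv (Prod.ext ?_ ?_)
  · simp [stdVelocity, div_eq_mul_inv]
  · simp only [stdVelocity, smul_add, smul_sub, smul_smul]
    have e1 : (lapse e + japanese s)⁻¹ - s / japanese s / (lapse e + japanese s) ^ 2 * s
        = (japanese s * (lapse e + japanese s) ^ 2)⁻¹ * (lapse e * japanese s + 1) := by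
      have := japanese_sq s
      field_simp
      linear_combination this
    rw [← e1, sub_smul]
    have e2 : -(s / japanese s) / (lapse e + japanese s) ^ 2 =
      -((japanese s * (lapse e + japanese s) ^ 2)⁻¹ * s) := by
      field_simp
    rw [e2, ← sub_eq_zero]
    have e3 : (japanese s * (lapse e + japanese s) ^ 2)⁻¹ * s * s =
      s / japanese s / (lapse e + japanese s) ^ 2 * s := by
      field_simp
    rw [← e3]
    module

theorem deriv_stdGeodesic (ℓ t₀ : ℝ) (n e : EuclideanSpace ℝ (Fin d)) :
    deriv (stdGeodesic ℓ t₀ n e) = stdVelocity ℓ n e :=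
  funext fun s => (hasDerivAt_stdGeodesic ℓ t₀ n e s).deriv

theorem contDiff_stdGeodesic {k : WithTop ℕ∞} (ℓ t₀ : ℝ) (n e : EuclideanSpace ℝ (Fin d)) :
    ContDiff ℝ k (stdGeodesic ℓ t₀ n e) := by
  have h1 : ContDiff ℝ k fun s : ℝ => (lapse e + japanese s)⁻¹ :=
    (contDiff_const.add contDiff_japanese).inv fun s => (lapse_add_japanese_pos e s).ne'
  exact (contDiff_const.add (contDiff_const.mul Real.contDiff_arctan)).prodMk
    (h1.smul (contDiff_const.add (contDiff_id.smul contDiff_const)))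

section

variable {n e : EuclideanSpace ℝ (Fin d)}

theorem norm_stdPosition_sq (hn : ‖n‖ = 1) (hen : inner ℝ e n = 0) (he : ‖e‖ ≤ 1) (s : ℝ) :
    ‖e + s • n‖ ^ 2 = japanese s ^ 2 - lapse e ^ 2 := by
  rw [japanese_sq, lapse_sq he, norm_add_sq_real, norm_smul, real_inner_smul_right, hen, hn]
  simp
  ring

theorem norm_stdPosition_le (hn : ‖n‖ = 1) (hen : inner ℝ e n = 0) (he : ‖e‖ ≤ 1) (s : ℝ) :
    ‖e + s • n‖ ≤ japanese s := by
  refine abs_le_of_sq_le_sq' ?_ (japanese_pos s).le |>.2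
  rw [norm_stdPosition_sq hn hen he]
  nlinarith [sq_nonneg (lapse e)]

theorem norm_stdGeodesic_snd_sq (ℓ t₀ : ℝ) (hn : ‖n‖ = 1) (hen : inner ℝ e n = 0) (he : ‖e‖ ≤ 1)
    (s : ℝ) : ‖(stdGeodesic ℓ t₀ n e s).2‖ ^ 2 =
      (japanese s - lapse e) / (japanese s + lapse e) := by
  have hq := lapse_add_japanese_pos e s
  rw [stdGeodesic, norm_smul, mul_pow, norm_stdPosition_sq hn hen he, norm_inv, Real.norm_eq_abs,
    abs_of_pos hq, add_comm (japanese s)]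
  field_simp
  ring

theorem stdGeodesic_mem_compactification (ℓ t₀ : ℝ) (hn : ‖n‖ = 1) (hen : inner ℝ e n = 0)
    (he : ‖e‖ ≤ 1) (s : ℝ) : stdGeodesic ℓ t₀ n e s ∈ compactification d := by
  have hq := lapse_add_japanese_pos e s
  have h := norm_stdGeodesic_snd_sq ℓ t₀ hn hen he s
  have : (japanese s - lapse e) / (japanese s + lapse e) ≤ 1 :=
    div_le_one_of_le₀ (by linarith [lapse_nonneg e]) (by linarith)
  exact (sq_le_one_iff₀ (norm_nonneg _)).1 (h.trans_le this)

theorem stdGeodesic_mem_bulk (ℓ t₀ : ℝ) (hn : ‖n‖ = 1) (hen : inner ℝ e n = 0)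
    (he : ‖e‖ < 1) (s : ℝ) : stdGeodesic ℓ t₀ n e s ∈ bulk d := by
  have hq := lapse_add_japanese_pos e s
  have h := norm_stdGeodesic_snd_sq ℓ t₀ hn hen he.le s
  have : (japanese s - lapse e) / (japanese s + lapse e) < 1 :=
    (div_lt_one (by linarith)).2 (by linarith [lapse_pos he])
  exact (sq_lt_one_iff₀ (norm_nonneg _)).1 (h.trans_lt this)

theorem one_sub_norm_stdGeodesic_sq (ℓ t₀ : ℝ) (hn : ‖n‖ = 1) (hen : inner ℝ e n = 0)
    (he : ‖e‖ ≤ 1) (s : ℝ) : 1 - ‖(stdGeodesic ℓ t₀ n e s).2‖ ^ 2 =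
      2 * lapse e / (lapse e + japanese s) := by
  have hq := lapse_add_japanese_pos e s
  rw [norm_stdGeodesic_snd_sq ℓ t₀ hn hen he, add_comm (japanese s)]
  field_simp
  ring

theorem redshift_stdGeodesic (ℓ t₀ : ℝ) (hn : ‖n‖ = 1) (hen : inner ℝ e n = 0)
    (he : ‖e‖ < 1) (s : ℝ) : redshift (stdGeodesic ℓ t₀ n e s) = japanese s / lapse e := by
  have hq := lapse_add_japanese_pos e s
  have hq0 := lapse_pos he
  rw [redshift, one_sub_norm_stdGeodesic_sq ℓ t₀ hn hen he.le,
    norm_stdGeodesic_snd_sq ℓ t₀ hn hen he.le, add_comm (japanese s)]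
  field_simp
  ring

/-- In the ambient space the standard null geodesics are straight lines. -/
theorem embedding_stdGeodesic {ℓ : ℝ} (hℓ : ℓ ≠ 0) (t₀ : ℝ) (hn : ‖n‖ = 1)
    (hen : inner ℝ e n = 0) (he : ‖e‖ < 1) (s : ℝ) :
    embedding ℓ t₀ (stdGeodesic ℓ t₀ n e s) = (ℓ / lapse e) • (1, s, e + s • n) := by
  have hR := japanese_pos s
  have hq := lapse_add_japanese_pos e s
  have hq0 := lapse_pos he
  rw [embedding, redshift_stdGeodesic ℓ t₀ hn hen he, one_sub_norm_stdGeodesic_sq ℓ t₀ hn hen he.le]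
  have ht : ((stdGeodesic ℓ t₀ n e s).1 - t₀) / ℓ = Real.arctan s := by
    simp only [stdGeodesic]
    field_simp
    ring
  rw [ht, Real.cos_arctan, Real.sin_arctan, ← japanese]
  simp only [stdGeodesic, Prod.smul_mk, smul_smul, smul_eq_mul]
  refine Prod.ext ?_ (Prod.ext ?_ ?_)
  · simp only
    field_simp
  · simp only
    field_simp
  · simp only
    congr 1
    field_simp

theorem fderiv_embedding_stdGeodesic {ℓ : ℝ} (hℓ : ℓ ≠ 0) (t₀ : ℝ) (hn : ‖n‖ = 1)
    (hen : inner ℝ e n = 0) (he : ‖e‖ < 1) (s : ℝ) (w : Chart d) :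
    fderiv ℝ (embedding ℓ t₀) (stdGeodesic ℓ t₀ n e s) w =
      (ℓ * (lapse e + japanese s) / (lapse e ^ 2 * japanese s) * inner ℝ (e + s • n) w.2
          - s / lapse e * w.1,
        ℓ * (lapse e + japanese s) * s / (lapse e ^ 2 * japanese s) * inner ℝ (e + s • n) w.2
          + w.1 / lapse e,
        (ℓ * (lapse e + japanese s) / lapse e) • w.2
          + (ℓ / lapse e ^ 2 * inner ℝ (e + s • n) w.2) • (e + s • n)) := by
  have hR := japanese_pos s
  have hq := lapse_add_japanese_pos e s
  have hq0 := lapse_pos he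
  rw [fderiv_embedding_apply hℓ t₀ (stdGeodesic_mem_bulk ℓ t₀ hn hen he s),
    redshift_stdGeodesic ℓ t₀ hn hen he, one_sub_norm_stdGeodesic_sq ℓ t₀ hn hen he.le]
  have ht : ((stdGeodesic ℓ t₀ n e s).1 - t₀) / ℓ = Real.arctan s := by
    simp only [stdGeodesic]
    field_simp
    ring
  rw [ht, Real.cos_arctan, Real.sin_arctan, ← japanese]
  simp only [stdGeodesic, real_inner_smul_left, smul_smul]
  refine Prod.ext ?_ (Prod.ext ?_ ?_)
  · simp only
    field_simp
    ring
  · simp only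
    field_simp
    ring
  · simp only
    congr 2
    · field_simp
    · field_simp
      ring

/-- The constant velocity in the ambient space of a standard null geodesic. -/
theorem fderiv_embedding_stdVelocity {ℓ : ℝ} (hℓ : ℓ ≠ 0) (t₀ : ℝ) (hn : ‖n‖ = 1)
    (hen : inner ℝ e n = 0) (he : ‖e‖ < 1) (s : ℝ) :
    fderiv ℝ (embedding ℓ t₀) (stdGeodesic ℓ t₀ n e s) (stdVelocity ℓ n e s) =
      (ℓ / lapse e) • (0, 1, n) := by
  have h1 := (differentiableAt_embedding ℓ t₀
    (stdGeodesic_mem_bulk ℓ t₀ hn hen he s)).hasFDerivAt.comp_hasDerivAt s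
    (hasDerivAt_stdGeodesic ℓ t₀ n e s)
  have h3 : HasDerivAt (fun s : ℝ => e + s • n) n s := by
    simpa using ((hasDerivAt_id s).smul_const n).const_add e
  have h2 := ((hasDerivAt_const s (1 : ℝ)).prodMk ((hasDerivAt_id s).prodMk h3)).const_smul
    (ℓ / lapse e)
  refine h1.unique (h2.congr_of_eventuallyEq (Eventually.of_forall fun r => ?_))
  exact embedding_stdGeodesic hℓ t₀ hn hen he r

theorem isCompleteNullGeodesic_stdGeodesic {ℓ : ℝ} (hℓ : ℓ ≠ 0) (t₀ : ℝ) (hn : ‖n‖ = 1)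
    (hen : inner ℝ e n = 0) (he : ‖e‖ < 1) :
    IsCompleteNullGeodesic ℓ (stdGeodesic ℓ t₀ n e) where
  mem_bulk := stdGeodesic_mem_bulk ℓ t₀ hn hen he
  contDiff := contDiff_stdGeodesic ℓ t₀ n e
  velocity_ne_zero s h := by
    have := congrArg Prod.fst h
    rw [deriv_stdGeodesic] at this
    have h2 : ℓ / (1 + s ^ 2) ≠ 0 := by positivity
    exact h2 this
  geodesic s w := by
    rw [acceleration_metric hℓ t₀ (stdGeodesic_mem_bulk ℓ t₀ hn hen he s)]
    have hc := contDiff_stdGeodesic (k := 2) ℓ t₀ n e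
    have h1 := hasDerivAt_fderiv_embedding_apply ℓ t₀ (stdGeodesic_mem_bulk ℓ t₀ hn hen he s)
      (hasDerivAt_of_contDiff_two hc s) (hasDerivAt_deriv_of_contDiff_two hc s)
    have h2 := h1.unique ((hasDerivAt_const s ((ℓ / lapse e) • ((0, 1, n) : Ambient d))
      ).congr_of_eventuallyEq (Eventually.of_forall fun r => by
        rw [deriv_stdGeodesic]; exact fderiv_embedding_stdVelocity hℓ t₀ hn hen he r))
    rw [add_comm, h2]
    simp
  null s := by
    rw [← ambientForm_fderiv_embedding hℓ t₀ (stdGeodesic_mem_bulk ℓ t₀ hn hen he s),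
      deriv_stdGeodesic, fderiv_embedding_stdVelocity hℓ t₀ hn hen he, map_smul, map_smul,
      smul_apply, ambientForm_apply]
    simp [hn]

theorem isFutureDirected_stdGeodesic {ℓ : ℝ} (hℓ : 0 < ℓ) (t₀ : ℝ) :
    IsFutureDirected (stdGeodesic ℓ t₀ n e) := fun s => by
  rw [deriv_stdGeodesic]
  exact div_pos hℓ (by positivity)

/-- The inverse of the differential of the embedding along a standard null geodesic, defined on
the whole ambient space but meaningful for vectors tangent to the quadric. -/
def stdPullback (ℓ : ℝ) (n e : EuclideanSpace ℝ (Fin d)) (s : ℝ) (Z : Ambient d) : Chart d :=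
  (lapse e * (Z.2.1 - s * Z.1) / (1 + s ^ 2),
    (lapse e / ℓ) • ((lapse e + japanese s)⁻¹ • Z.2.2
      - (inner ℝ (e + s • n) Z.2.2 / (japanese s * (lapse e + japanese s) ^ 2)) • (e + s • n)))

theorem stdPullback_fderiv_embedding {ℓ : ℝ} (hℓ : ℓ ≠ 0) (t₀ : ℝ) (hn : ‖n‖ = 1)
    (hen : inner ℝ e n = 0) (he : ‖e‖ < 1) (s : ℝ) (w : Chart d) :
    stdPullback ℓ n e s (fderiv ℝ (embedding ℓ t₀) (stdGeodesic ℓ t₀ n e s) w) = w := by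
  have hR := japanese_pos s
  have hR2 := japanese_sq s
  have hq := lapse_add_japanese_pos e s
  have hq0 := lapse_pos he
  obtain ⟨u, hu⟩ : ∃ u, u = e + s • n := ⟨_, rfl⟩
  have huu : inner ℝ u u = japanese s ^ 2 - lapse e ^ 2 := by
    rw [hu, real_inner_self_eq_norm_sq, norm_stdPosition_sq hn hen he.le]
  rw [fderiv_embedding_stdGeodesic hℓ t₀ hn hen he, stdPullback, ← japanese_sq, ← hu]
  simp only [inner_add_right, real_inner_smul_right, huu]
  set m := inner ℝ u w.2
  refine Prod.ext ?_ ?_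
  · simp only
    field_simp
    linear_combination (-lapse e * japanese s * w.1) * hR2
  · simp only [smul_add, smul_sub, smul_smul]
    rw [add_sub_assoc, ← sub_smul]
    convert add_zero w.2 using 2
    · convert one_smul ℝ w.2 using 2
      field_simp
    · convert zero_smul ℝ u using 2
      field_simp
      ring

theorem fderiv_embedding_stdPullback {ℓ : ℝ} (hℓ : ℓ ≠ 0) (t₀ : ℝ) (hn : ‖n‖ = 1)
    (hen : inner ℝ e n = 0) (he : ‖e‖ < 1) (s : ℝ) {Z : Ambient d}
    (hZ : ambientForm d Z (embedding ℓ t₀ (stdGeodesic ℓ t₀ n e s)) = 0) :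
    fderiv ℝ (embedding ℓ t₀) (stdGeodesic ℓ t₀ n e s) (stdPullback ℓ n e s Z) = Z := by
  have hR := japanese_pos s
  have hR2 := japanese_sq s
  have hq := lapse_add_japanese_pos e s
  have hq0 := lapse_pos he
  have hm : inner ℝ (e + s • n) Z.2.2 = Z.1 + s * Z.2.1 := by
    rw [embedding_stdGeodesic hℓ t₀ hn hen he, map_smul, smul_eq_mul, ambientForm_apply,
      real_inner_comm] at hZ
    have := (mul_eq_zero.1 hZ).resolve_left (by positivity)
    linarith
  obtain ⟨u, hu⟩ : ∃ u, u = e + s • n := ⟨_, rfl⟩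
  have huu : inner ℝ u u = japanese s ^ 2 - lapse e ^ 2 := by
    rw [hu, real_inner_self_eq_norm_sq, norm_stdPosition_sq hn hen he.le]
  rw [← hu] at hm
  rw [fderiv_embedding_stdGeodesic hℓ t₀ hn hen he, stdPullback, ← japanese_sq, ← hu]
  simp only [inner_sub_right, real_inner_smul_right, huu, hm]
  refine Prod.ext ?_ (Prod.ext ?_ ?_)
  · simp only
    field_simp
    linear_combination (-Z.1 * lapse e * (lapse e + japanese s)) * hR2
  · simp only
    field_simp
    linear_combination (-Z.2.1 * lapse e * (lapse e + japanese s)) * hR2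
  · simp only [smul_sub, smul_smul]
    rw [sub_add, ← sub_smul]
    convert sub_zero Z.2.2 using 2
    · convert one_smul ℝ Z.2.2 using 2
      field_simp
    · convert zero_smul ℝ u using 2
      field_simp
      ring

/-- The velocity with which a standard null geodesic moves when its direction `e` moves with
velocity `b`. -/
def variationField (n e b : EuclideanSpace ℝ (Fin d)) (s : ℝ) : Chart d :=
  (0, (lapse e + japanese s)⁻¹ • b
    + (inner ℝ e b / (lapse e * (lapse e + japanese s) ^ 2)) • (e + s • n))

theorem fderiv_embedding_variationField {ℓ : ℝ} (hℓ : ℓ ≠ 0) (t₀ : ℝ) (hn : ‖n‖ = 1)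
    (hen : inner ℝ e n = 0) (he : ‖e‖ < 1) {b : EuclideanSpace ℝ (Fin d)} (hb : inner ℝ n b = 0)
    (s : ℝ) :
    fderiv ℝ (embedding ℓ t₀) (stdGeodesic ℓ t₀ n e s) (variationField n e b s) =
      (ℓ / lapse e) • (0, 0, b)
        + (inner ℝ e b / lapse e ^ 2) • embedding ℓ t₀ (stdGeodesic ℓ t₀ n e s) := by
  have hR := japanese_pos s
  have hq := lapse_add_japanese_pos e s
  have hq0 := lapse_pos he
  obtain ⟨u, hu⟩ : ∃ u, u = e + s • n := ⟨_, rfl⟩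
  have huu : inner ℝ u u = japanese s ^ 2 - lapse e ^ 2 := by
    rw [hu, real_inner_self_eq_norm_sq, norm_stdPosition_sq hn hen he.le]
  have hub : inner ℝ u b = inner ℝ e b := by
    rw [hu, inner_add_left, real_inner_smul_left, hb, mul_zero, add_zero]
  rw [fderiv_embedding_stdGeodesic hℓ t₀ hn hen he, variationField,
    embedding_stdGeodesic hℓ t₀ hn hen he, ← hu]
  simp only [inner_add_right, real_inner_smul_right, huu, hub]
  refine Prod.ext ?_ (Prod.ext ?_ ?_)
  · simp
    field_simp
    ring
  · simp
    field_simp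
    ring
  · simp only [Prod.smul_mk, Prod.mk_add_mk, smul_add (ℓ * (lapse e + japanese s) / lapse e),
      smul_smul]
    rw [add_assoc, ← add_smul]
    congr 2
    · field_simp
    · field_simp
      ring

end

/-! ### Growth of the perturbation near the boundary -/

theorem compactification_eq : compactification d =
    Set.univ ×ˢ Metric.closedBall (0 : EuclideanSpace ℝ (Fin d)) 1 := by
  ext x
  simp [compactification]

theorem uniqueDiffOn_compactification : UniqueDiffOn ℝ (compactification d) := by
  rw [compactification_eq]
  refine uniqueDiffOn_univ.prod (uniqueDiffOn_convex (convex_closedBall _ _) ?_)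
  rw [interior_closedBall _ one_ne_zero]
  exact Metric.nonempty_ball.2 one_pos

theorem bulk_subset_compactification : bulk d ⊆ compactification d := fun x hx =>
  le_of_lt (show ‖x.2‖ < 1 from hx)

theorem isCompact_slab (a b : ℝ) :
    IsCompact (Set.Icc a b ×ˢ Metric.closedBall (0 : EuclideanSpace ℝ (Fin d)) 1) :=
  isCompact_Icc.prod (isCompact_closedBall _ _)

theorem slab_subset_compactification (a b : ℝ) :
    Set.Icc a b ×ˢ Metric.closedBall (0 : EuclideanSpace ℝ (Fin d)) 1 ⊆ compactification d := by
  rw [compactification_eq]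
  exact Set.prod_mono_left (Set.subset_univ _)

theorem confFactor_mul_redshift {x : Chart d} (hx : x ∈ bulk d) :
    confFactor x * redshift x = 1 := by
  have := (one_sub_normSq_pos hx).ne'
  rw [confFactor, redshift]
  field_simp

theorem one_le_redshift {x : Chart d} (hx : x ∈ bulk d) : 1 ≤ redshift x := by
  have := one_sub_normSq_pos hx
  rw [redshift, one_le_div this]
  nlinarith [sq_nonneg ‖x.2‖]

theorem differentiableAt_redshift {x : Chart d} (hx : x ∈ bulk d) :
    DifferentiableAt ℝ redshift x :=
  ((contDiffOn_redshift (n := 1)).contDiffAt (isOpen_bulk.mem_nhds hx)).differentiableAt (by simp)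

theorem norm_fderiv_redshift_le {x : Chart d} (hx : x ∈ bulk d) :
    ‖fderiv ℝ redshift x‖ ≤ 4 * redshift x ^ 2 := by
  have hp := one_sub_normSq_pos hx
  refine ContinuousLinearMap.opNorm_le_bound _ (by positivity) fun w => ?_
  have hl : HasDerivAt (fun ε : ℝ => x + ε • w) w 0 := by
    simpa using ((hasDerivAt_id (0 : ℝ)).smul_const w).const_add x
  have h1 : HasFDerivAt redshift (fderiv ℝ redshift x) (x + (0 : ℝ) • w) := by
    simpa using (differentiableAt_redshift hx).hasFDerivAt
  have h0 : HasDerivAt (fun ε : ℝ => redshift (x + ε • w)) (fderiv ℝ redshift x w) 0 :=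
    HasFDerivAt.comp_hasDerivAt (f := fun ε : ℝ => x + ε • w) 0 h1 hl
  rw [h0.unique (hasDerivAt_redshift_line hx w), Real.norm_eq_abs,
    abs_div, abs_mul, abs_of_pos (by norm_num : (0 : ℝ) < 4),
    abs_of_pos (by positivity : 0 < (1 - ‖x.2‖ ^ 2) ^ 2)]
  have h2 : |inner ℝ x.2 w.2| ≤ ‖w‖ := by
    refine (abs_real_inner_le_norm _ _).trans ?_
    have h3 : ‖x.2‖ ≤ 1 := bulk_subset_compactification hx
    calc ‖x.2‖ * ‖w.2‖ ≤ 1 * ‖w‖ :=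
        mul_le_mul h3 (norm_snd_le w) (norm_nonneg _) zero_le_one
      _ = ‖w‖ := one_mul _
  have h4 : 1 / (1 - ‖x.2‖ ^ 2) ^ 2 ≤ redshift x ^ 2 := by
    rw [redshift, div_pow]
    gcongr
    nlinarith [sq_nonneg ‖x.2‖]
  calc 4 * |inner ℝ x.2 w.2| / (1 - ‖x.2‖ ^ 2) ^ 2
      = 4 * |inner ℝ x.2 w.2| * (1 / (1 - ‖x.2‖ ^ 2) ^ 2) := by ring
    _ ≤ 4 * ‖w‖ * redshift x ^ 2 := by gcongr
    _ = _ := by ring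

/-- Regularity at the boundary bounds the growth of the perturbation and of its derivative, in
terms of the redshift factor. -/
theorem IsAdmissiblePerturbation.exists_bounds {ℓ : ℝ} {h : Chart d → Form d}
    (hh : IsAdmissiblePerturbation ℓ h) (a b : ℝ) :
    ∃ M : ℝ, 0 ≤ M ∧ ∀ x ∈ bulk d, x.1 ∈ Set.Icc a b →
      ‖h x‖ ≤ M * redshift x ^ 2 ∧ ‖fderiv ℝ h x‖ ≤ M * redshift x ^ 3 := by
  obtain ⟨H, hH, hHh, -⟩ := hh.boundary_regular
  obtain ⟨M₁, hM₁⟩ := (isCompact_slab (d := d) a b).exists_bound_of_continuousOn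
    (hH.continuousOn.mono (slab_subset_compactification a b))
  obtain ⟨M₂, hM₂⟩ := (isCompact_slab (d := d) a b).exists_bound_of_continuousOn
    ((hH.continuousOn_fderivWithin uniqueDiffOn_compactification (by simp)).mono
      (slab_subset_compactification a b))
  refine ⟨8 * |M₁| + |M₂|, by positivity, fun x hx hxt => ?_⟩
  have hxS : x ∈ Set.Icc a b ×ˢ Metric.closedBall (0 : EuclideanSpace ℝ (Fin d)) 1 :=
    ⟨hxt, mem_closedBall_zero_iff.2 (bulk_subset_compactification hx)⟩
  have hA := one_le_redshift hx
  have hb1 : ‖H x‖ ≤ |M₁| := (hM₁ x hxS).trans (le_abs_self _)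
  have hmem : compactification d ∈ 𝓝 x :=
    mem_of_superset (isOpen_bulk.mem_nhds hx) bulk_subset_compactification
  have hb2 : ‖fderiv ℝ H x‖ ≤ |M₂| := by
    rw [← fderivWithin_of_mem_nhds hmem]
    exact (hM₂ x hxS).trans (le_abs_self _)
  have hform : ∀ y ∈ bulk d, h y = redshift y ^ 2 • H y := fun y hy => by
    rw [hHh y hy, smul_smul, ← mul_pow, mul_comm, confFactor_mul_redshift hy, one_pow, one_smul]
  have hHd : HasFDerivAt H (fderiv ℝ H x) x :=
    (((hH.contDiffAt hmem)).differentiableAt (by simp)).hasFDerivAt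
  have hd := ((differentiableAt_redshift hx).hasFDerivAt.pow 2).smul hHd
  have hd' := hd.congr_of_eventuallyEq (f₁ := h) (by
    filter_upwards [isOpen_bulk.mem_nhds hx] with y hy using hform y hy)
  constructor
  · rw [hform x hx, norm_smul, norm_pow, Real.norm_eq_abs, abs_of_pos (redshift_pos hx), mul_comm]
    gcongr
    linarith [abs_nonneg M₁, abs_nonneg M₂]
  · rw [hd'.fderiv]
    have h1 : ‖(redshift x ^ 2) • fderiv ℝ H x‖ ≤ |M₂| * redshift x ^ 3 := by
      rw [norm_smul, norm_pow, Real.norm_eq_abs, abs_of_pos (redshift_pos hx), mul_comm]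
      refine mul_le_mul hb2 ?_ (by positivity) (by positivity)
      exact pow_le_pow_right₀ hA (by norm_num)
    refine (norm_add_le _ _).trans ?_
    have h2 : ‖((2 • redshift x ^ (2 - 1)) • fderiv ℝ redshift x).smulRight (H x)‖
        ≤ 8 * |M₁| * redshift x ^ 3 := by
      rw [ContinuousLinearMap.norm_smulRight_apply, norm_smul, Real.norm_eq_abs]
      have e1 : |2 • redshift x ^ (2 - 1)| = 2 * redshift x := by
        simp [abs_of_pos (redshift_pos hx)]
      rw [e1]
      calc 2 * redshift x * ‖fderiv ℝ redshift x‖ * ‖H x‖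
          ≤ 2 * redshift x * (4 * redshift x ^ 2) * |M₁| := by
            have := norm_fderiv_redshift_le hx
            have := redshift_pos hx
            gcongr
        _ = _ := by ring
    linarith

/-! ### Decay along standard null geodesics -/

section

variable {n e b : EuclideanSpace ℝ (Fin d)}

theorem stdGeodesic_fst_mem {ℓ : ℝ} (hℓ : 0 < ℓ) (t₀ : ℝ) (n e : EuclideanSpace ℝ (Fin d)) (s : ℝ) :
    (stdGeodesic ℓ t₀ n e s).1 ∈ Set.Icc (t₀ - 2 * ℓ) (t₀ + 2 * ℓ) := by
  have h1 := Real.arctan_lt_pi_div_two s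
  have h2 := Real.neg_pi_div_two_lt_arctan s
  have h3 := Real.pi_lt_four
  simp only [stdGeodesic, Set.mem_Icc]
  constructor <;> nlinarith

theorem norm_stdVelocity_le {ℓ : ℝ} (hℓ : 0 < ℓ) (hn : ‖n‖ = 1) (he : ‖e‖ ≤ 1) (s : ℝ) :
    ‖stdVelocity ℓ n e s‖ ≤ (ℓ + 3) / japanese s ^ 2 := by
  have hR := japanese_pos s
  have hR1 := one_le_japanese s
  have hs := abs_le_japanese s
  have hq := lapse_nonneg e
  have hq1 := lapse_le_one e
  refine max_le ?_ ?_
  · simp only [stdVelocity]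
    rw [← japanese_sq, Real.norm_eq_abs, abs_of_pos (by positivity)]
    gcongr
    linarith
  · have h1 : ‖(lapse e * japanese s + 1) • n - s • e‖ ≤ 3 * japanese s := by
      refine (norm_sub_le _ _).trans ?_
      rw [norm_smul, norm_smul, hn, Real.norm_eq_abs, Real.norm_eq_abs,
        abs_of_pos (by positivity)]
      nlinarith [abs_nonneg s, norm_nonneg e]
    have h2 : (japanese s * (lapse e + japanese s) ^ 2)⁻¹ ≤ (japanese s * japanese s ^ 2)⁻¹ := by
      gcongr
      linarith
    rw [stdVelocity, norm_smul, norm_inv, Real.norm_eq_abs, abs_of_pos (by positivity)]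
    calc _ ≤ (japanese s * japanese s ^ 2)⁻¹ * (3 * japanese s) := by gcongr
      _ = 3 / japanese s ^ 2 := by field_simp
      _ ≤ _ := by gcongr; linarith

/-- The second derivative of a standard null geodesic. -/
def stdAcceleration (ℓ : ℝ) (n e : EuclideanSpace ℝ (Fin d)) (s : ℝ) : Chart d :=
  (-(2 * ℓ * s) / (1 + s ^ 2) ^ 2,
    (japanese s * (lapse e + japanese s) ^ 2)⁻¹ • ((lapse e * (s / japanese s)) • n - e)
      - ((s / japanese s * (lapse e + japanese s) ^ 2 + 2 * s * (lapse e + japanese s))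
        / (japanese s * (lapse e + japanese s) ^ 2) ^ 2) •
        ((lapse e * japanese s + 1) • n - s • e))

theorem hasDerivAt_stdVelocity (ℓ : ℝ) (n e : EuclideanSpace ℝ (Fin d)) (s : ℝ) :
    HasDerivAt (stdVelocity ℓ n e) (stdAcceleration ℓ n e s) s := by
  have hR := japanese_pos s
  have hq := lapse_add_japanese_pos e s
  have hJ := hasDerivAt_japanese s
  have h1 : HasDerivAt (fun s : ℝ => ℓ / (1 + s ^ 2)) (-(2 * ℓ * s) / (1 + s ^ 2) ^ 2) s := by
    have := (hasDerivAt_const s ℓ).fun_div ((hasDerivAt_pow 2 s).const_add 1)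
      (by positivity : (1 + s ^ 2) ≠ 0)
    refine this.congr_deriv ?_
    simp
    ring
  have h2 := (hJ.fun_mul ((hJ.const_add (lapse e)).fun_pow 2)).fun_inv (by positivity)
  have h3 : HasDerivAt (fun s : ℝ => (lapse e * japanese s + 1) • n - s • e)
      ((lapse e * (s / japanese s)) • n - e) s := by
    have := (((hJ.const_mul (lapse e)).add_const 1).smul_const n).fun_sub
      ((hasDerivAt_id s).smul_const e)
    simpa using this
  refine (h1.prodMk (h2.smul h3)).congr_deriv (Prod.ext rfl ?_)
  have e1 : -(s / japanese s * (lapse e + japanese s) ^ 2 +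
      japanese s * (((2 : ℕ) : ℝ) * (lapse e + japanese s) ^ (2 - 1) * (s / japanese s))) /
        (japanese s * (lapse e + japanese s) ^ 2) ^ 2 =
      -((s / japanese s * (lapse e + japanese s) ^ 2 + 2 * s * (lapse e + japanese s))
        / (japanese s * (lapse e + japanese s) ^ 2) ^ 2) := by
    simp
    field_simp
    ring
  simp only [stdAcceleration]
  rw [e1]
  module

theorem norm_stdAcceleration_le {ℓ : ℝ} (hℓ : 0 < ℓ) (hn : ‖n‖ = 1) (he : ‖e‖ ≤ 1) (s : ℝ) :
    ‖stdAcceleration ℓ n e s‖ ≤ (2 * ℓ + 26) / japanese s ^ 3 := by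
  have hR := japanese_pos s
  have hR1 := one_le_japanese s
  have hs := abs_le_japanese s
  have hq := lapse_nonneg e
  have hq1 := lapse_le_one e
  refine max_le ?_ ?_
  · rw [stdAcceleration, ← japanese_sq, Real.norm_eq_abs, abs_div, abs_neg, abs_mul,
      abs_of_pos (by positivity : 0 < 2 * ℓ), abs_of_pos (by positivity : 0 < (japanese s ^ 2) ^ 2)]
    calc 2 * ℓ * |s| / (japanese s ^ 2) ^ 2 ≤ 2 * ℓ * japanese s / (japanese s ^ 2) ^ 2 := by gcongr
      _ = 2 * ℓ / japanese s ^ 3 := by field_simp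
      _ ≤ _ := by gcongr; linarith
  · have hsR : |s / japanese s| ≤ 1 := by
      rw [abs_div, abs_of_pos hR]
      exact div_le_one_of_le₀ hs hR.le
    have h1 : ‖(lapse e * japanese s + 1) • n - s • e‖ ≤ 3 * japanese s := by
      refine (norm_sub_le _ _).trans ?_
      rw [norm_smul, norm_smul, hn, Real.norm_eq_abs, Real.norm_eq_abs,
        abs_of_pos (by positivity)]
      nlinarith [abs_nonneg s, norm_nonneg e]
    have h1' : ‖(lapse e * (s / japanese s)) • n - e‖ ≤ 2 := by
      refine (norm_sub_le _ _).trans ?_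
      rw [norm_smul, hn, Real.norm_eq_abs, abs_mul, abs_of_nonneg hq]
      nlinarith [abs_nonneg (s / japanese s)]
    have h2 : (japanese s * (lapse e + japanese s) ^ 2)⁻¹ ≤ (japanese s * japanese s ^ 2)⁻¹ := by
      gcongr
      linarith
    have h3 : |s / japanese s * (lapse e + japanese s) ^ 2 + 2 * s * (lapse e + japanese s)|
        ≤ 8 * japanese s ^ 2 := by
      have e1 : lapse e + japanese s ≤ 2 * japanese s := by linarith
      have e2 : (lapse e + japanese s) ^ 2 ≤ 4 * japanese s ^ 2 := by nlinarith
      refine (abs_add_le _ _).trans ?_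
      rw [abs_mul, abs_mul, abs_mul, abs_of_pos (by positivity : 0 < lapse e + japanese s),
        abs_of_nonneg (by positivity : 0 ≤ (lapse e + japanese s) ^ 2), abs_of_pos (by norm_num :
        (0 : ℝ) < 2)]
      have e3 : |s / japanese s| * (lapse e + japanese s) ^ 2 ≤ 1 * (4 * japanese s ^ 2) := by gcongr
      have e4 : 2 * |s| * (lapse e + japanese s) ≤ 2 * japanese s * (2 * japanese s) := by gcongr
      nlinarith
    have h4 : |(s / japanese s * (lapse e + japanese s) ^ 2 + 2 * s * (lapse e + japanese s))
        / (japanese s * (lapse e + japanese s) ^ 2) ^ 2|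
        ≤ 8 * japanese s ^ 2 / (japanese s * japanese s ^ 2) ^ 2 := by
      rw [abs_div, abs_of_nonneg (by positivity : 0 ≤ (japanese s * (lapse e + japanese s) ^ 2) ^ 2)]
      gcongr
      linarith
    refine (norm_sub_le _ _).trans ?_
    rw [norm_smul, norm_smul, norm_inv, Real.norm_eq_abs, Real.norm_eq_abs,
      abs_of_pos (by positivity : 0 < japanese s * (lapse e + japanese s) ^ 2)]
    calc _ ≤ (japanese s * japanese s ^ 2)⁻¹ * 2
          + 8 * japanese s ^ 2 / (japanese s * japanese s ^ 2) ^ 2 * (3 * japanese s) := by gcongr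
      _ = 26 / japanese s ^ 3 := by field_simp; norm_num
      _ ≤ _ := by gcongr; linarith

theorem norm_variationField_le (hn : ‖n‖ = 1) (hen : inner ℝ e n = 0) (he : ‖e‖ < 1)
    (b : EuclideanSpace ℝ (Fin d)) (s : ℝ) :
    ‖variationField n e b s‖ ≤ (1 + 1 / lapse e) * ‖b‖ / japanese s := by
  have hR := japanese_pos s
  have hq := lapse_pos he
  refine max_le ?_ ?_
  · simp only [variationField, norm_zero]
    positivity
  · have h1 : |inner ℝ e b| ≤ ‖b‖ := by
      refine (abs_real_inner_le_norm _ _).trans ?_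
      nlinarith [norm_nonneg b]
    have h2 := norm_stdPosition_le hn hen he.le s
    refine (norm_add_le _ _).trans ?_
    rw [norm_smul, norm_smul, norm_inv, Real.norm_eq_abs, Real.norm_eq_abs, abs_div,
      abs_of_pos (by positivity : 0 < lapse e + japanese s),
      abs_of_pos (by positivity : 0 < lapse e * (lapse e + japanese s) ^ 2)]
    calc _ ≤ (japanese s)⁻¹ * ‖b‖ + ‖b‖ / (lapse e * japanese s ^ 2) * japanese s := by
          gcongr <;> linarith
      _ = _ := by field_simp

/-- The derivative of the variation field along the geodesic. -/
def variationVelocity (n e b : EuclideanSpace ℝ (Fin d)) (s : ℝ) : Chart d :=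
  (0, (-(s / (japanese s * (lapse e + japanese s) ^ 2))) • b
    - (2 * (inner ℝ e b / lapse e) * s / (japanese s * (lapse e + japanese s) ^ 3)) • (e + s • n)
    + (inner ℝ e b / lapse e / (lapse e + japanese s) ^ 2) • n)

theorem hasDerivAt_variationField (he : ‖e‖ < 1) (s : ℝ) :
    HasDerivAt (variationField n e b) (variationVelocity n e b s) s := by
  have hR := japanese_pos s
  have hq := lapse_add_japanese_pos e s
  have hq0 := lapse_pos he
  have hJ := (hasDerivAt_japanese s).const_add (lapse e)
  have h1 := (hJ.fun_inv hq.ne').smul_const b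
  have h2 := (hasDerivAt_const s (inner ℝ e b)).fun_div ((hJ.fun_pow 2).const_mul (lapse e))
    (by positivity)
  have h3 : HasDerivAt (fun s : ℝ => e + s • n) n s := by
    simpa using ((hasDerivAt_id s).smul_const n).const_add e
  refine ((hasDerivAt_const s (0 : ℝ)).prodMk (h1.add (h2.smul h3))).congr_deriv
    (Prod.ext rfl ?_)
  have hb : -(s / (japanese s * (lapse e + japanese s) ^ 2)) =
      -(s / japanese s) / (lapse e + japanese s) ^ 2 := by
    field_simp
  have hu : 2 * (inner ℝ e b / lapse e) * s / (japanese s * (lapse e + japanese s) ^ 3) =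
      -((0 * (lapse e * (lapse e + japanese s) ^ 2) - inner ℝ e b * (lapse e *
        (((2 : ℕ) : ℝ) * (lapse e + japanese s) ^ (2 - 1) * (s / japanese s)))) /
      (lapse e * (lapse e + japanese s) ^ 2) ^ 2) := by
    simp
    field_simp
  have hn : inner ℝ e b / lapse e / (lapse e + japanese s) ^ 2 =
      inner ℝ e b / (lapse e * (lapse e + japanese s) ^ 2) := by
    field_simp
  simp only [variationVelocity]
  rw [hb, hu, hn]
  module

theorem norm_variationVelocity_le (hn : ‖n‖ = 1) (hen : inner ℝ e n = 0) (he : ‖e‖ < 1)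
    (b : EuclideanSpace ℝ (Fin d)) (s : ℝ) :
    ‖variationVelocity n e b s‖ ≤ (1 + 3 / lapse e) * ‖b‖ / japanese s ^ 2 := by
  have hR := japanese_pos s
  have hq := lapse_pos he
  have hs := abs_le_japanese s
  refine max_le ?_ ?_
  · simp only [variationVelocity, norm_zero]
    positivity
  · have h1 : |inner ℝ e b| ≤ ‖b‖ := by
      refine (abs_real_inner_le_norm _ _).trans ?_
      nlinarith [norm_nonneg b]
    have h2 := norm_stdPosition_le hn hen he.le s
    refine (norm_add_le _ _).trans ((add_le_add (norm_sub_le _ _) le_rfl).trans ?_)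
    rw [norm_smul, norm_smul, norm_smul, hn, norm_neg]
    simp only [Real.norm_eq_abs, abs_div, abs_mul, abs_pow, abs_of_pos hR, abs_of_pos hq,
      abs_of_pos (by positivity : 0 < lapse e + japanese s), abs_two]
    calc _ ≤ japanese s / (japanese s * japanese s ^ 2) * ‖b‖
          + 2 * (‖b‖ / lapse e) * japanese s / (japanese s * japanese s ^ 3) * japanese s
          + ‖b‖ / lapse e / japanese s ^ 2 * 1 := by
          gcongr <;> linarith
      _ = _ := by field_simp; ring

theorem hasDerivAt_lapse_line {ε : ℝ} (he : ‖e + ε • b‖ < 1) :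
    HasDerivAt (fun r : ℝ => lapse (e + r • b)) (-(inner ℝ (e + ε • b) b / lapse (e + ε • b))) ε := by
  have hl : HasDerivAt (fun r : ℝ => e + r • b) b ε := by
    simpa using ((hasDerivAt_id ε).smul_const b).const_add e
  have hp : 1 - ‖e + ε • b‖ ^ 2 ≠ 0 := by nlinarith [norm_nonneg (e + ε • b)]
  refine ((hl.norm_sq.const_sub 1).sqrt hp).congr_deriv ?_
  rw [← lapse]
  field_simp

theorem hasDerivAt_stdGeodesic_line (ℓ t₀ : ℝ) (s : ℝ) {ε : ℝ} (he : ‖e + ε • b‖ < 1) :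
    HasDerivAt (fun r : ℝ => stdGeodesic ℓ t₀ n (e + r • b) s)
      (variationField n (e + ε • b) b s) ε := by
  have hl : HasDerivAt (fun r : ℝ => e + r • b) b ε := by
    simpa using ((hasDerivAt_id ε).smul_const b).const_add e
  have hq := lapse_add_japanese_pos (e + ε • b) s
  have hq0 := lapse_pos he
  have h1 := ((hasDerivAt_lapse_line he).add_const (japanese s)).fun_inv hq.ne'
  have h2 := h1.smul (hl.add_const (s • n))
  refine ((hasDerivAt_const ε (t₀ + ℓ * Real.arctan s)).prodMk h2).congr_deriv (Prod.ext rfl ?_)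
  simp only [variationField]
  congr 2
  field_simp

theorem hasDerivAt_stdVelocity_line (ℓ : ℝ) (s : ℝ) {ε : ℝ} (he : ‖e + ε • b‖ < 1) :
    HasDerivAt (fun r : ℝ => stdVelocity ℓ n (e + r • b) s)
      (variationVelocity n (e + ε • b) b s) ε := by
  have hl : HasDerivAt (fun r : ℝ => e + r • b) b ε := by
    simpa using ((hasDerivAt_id ε).smul_const b).const_add e
  have hR := japanese_pos s
  have hR2 := japanese_sq s
  have hq := lapse_add_japanese_pos (e + ε • b) s
  have hq0 := lapse_pos he
  have hL := hasDerivAt_lapse_line he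
  have h1 := (((hL.add_const (japanese s)).fun_pow 2).const_mul (japanese s)).fun_inv
    (by positivity)
  have h2 := (((hL.mul_const (japanese s)).add_const 1).smul_const n).fun_sub (hl.fun_const_smul s)
  have h3 := h1.fun_smul h2
  have h4 : HasDerivAt (fun r : ℝ => stdVelocity ℓ n (e + r • b) s) _ ε :=
    (hasDerivAt_const ε (ℓ / (1 + s ^ 2))).prodMk h3
  refine h4.congr_deriv (Prod.ext rfl ?_)
  simp only [variationVelocity]
  set p := inner ℝ (e + ε • b) b
  set q := lapse (e + ε • b)
  set R := japanese s
  set f := e + ε • b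
  have hb : -(s / (R * (q + R) ^ 2)) = -((R * (q + R) ^ 2)⁻¹ * s) := by field_simp
  have hf : 2 * (p / q) * s / (R * (q + R) ^ 3) =
      -(R * (((2 : ℕ) : ℝ) * (q + R) ^ (2 - 1) * -(p / q))) / (R * (q + R) ^ 2) ^ 2 * s := by
    simp
    field_simp
  have hnn : p / q / (q + R) ^ 2 = 2 * (p / q) * s / (R * (q + R) ^ 3) * s +
      ((R * (q + R) ^ 2)⁻¹ * (-(p / q) * R)
        + -(R * (((2 : ℕ) : ℝ) * (q + R) ^ (2 - 1) * -(p / q))) / (R * (q + R) ^ 2) ^ 2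
          * (q * R + 1)) := by
    simp
    field_simp
    linear_combination (2 * p) * hR2
  rw [hb, hnn, hf]
  module

end

/-! ### Growth of primitives -/

section

variable {E : Type*} [NormedAddCommGroup E] [NormedSpace ℝ E] {f f' : ℝ → E}

theorem isLittleO_pow_succ_of_hasDerivAt_atTop (hf : ∀ s, HasDerivAt f (f' s) s) {k : ℕ}
    (h : f' =o[atTop] fun s : ℝ => s ^ k) : f =o[atTop] fun s : ℝ => s ^ (k + 1) := by
  rw [isLittleO_iff] at h ⊢
  intro c hc
  obtain ⟨M, hM⟩ := eventually_atTop.1 (h (half_pos hc))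
  set m := max M 1
  have hlim : Tendsto (fun s : ℝ => c / 2 * s ^ (k + 1)) atTop atTop :=
    (tendsto_pow_atTop (Nat.succ_ne_zero k)).const_mul_atTop (half_pos hc)
  filter_upwards [eventually_ge_atTop m, hlim.eventually_ge_atTop ‖f m‖] with s hs hs'
  have hm1 : 1 ≤ m := le_max_right _ _
  have h1 : ‖f s - f m‖ ≤ c / 2 * s ^ k * (s - m) := by
    refine norm_image_sub_le_of_norm_deriv_le_segment' (f := f) (f' := f') (a := m) (b := s)
      (fun x _ => (hf x).hasDerivWithinAt) (fun x hx => ?_) s (Set.right_mem_Icc.2 hs)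
    refine (hM x ((le_max_left _ _).trans hx.1)).trans ?_
    have hx0 : 0 ≤ x := by linarith [hx.1]
    rw [Real.norm_eq_abs, abs_of_nonneg (by positivity)]
    have : x ≤ s := hx.2.le
    gcongr
  have hs0 : 0 ≤ s := by linarith
  have h2 : c / 2 * s ^ k * (s - m) ≤ c / 2 * s ^ (k + 1) := by
    have : 0 ≤ c / 2 * s ^ k := by positivity
    rw [pow_succ]
    nlinarith
  rw [Real.norm_eq_abs, abs_of_nonneg (by positivity)]
  calc ‖f s‖ = ‖(f s - f m) + f m‖ := by rw [sub_add_cancel]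
    _ ≤ ‖f s - f m‖ + ‖f m‖ := norm_add_le _ _
    _ ≤ c * s ^ (k + 1) := by linarith

theorem isLittleO_pow_succ_of_hasDerivAt_atBot (hf : ∀ s, HasDerivAt f (f' s) s) {k : ℕ}
    (h : f' =o[atBot] fun s : ℝ => s ^ k) : f =o[atBot] fun s : ℝ => s ^ (k + 1) := by
  have h1 : ∀ s, HasDerivAt (fun s => f (-s)) (-f' (-s)) s := fun s => by
    simpa [Function.comp_def] using (hf (-s)).scomp s (hasDerivAt_neg s)
  have h2 : (fun s => -f' (-s)) =o[atTop] fun s : ℝ => s ^ k := by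
    refine ((h.comp_tendsto tendsto_neg_atTop_atBot).neg_left).trans_isBigO ?_
    refine IsBigO.of_bound 1 (Eventually.of_forall fun s => ?_)
    simp
  have h3 := (isLittleO_pow_succ_of_hasDerivAt_atTop h1 h2).comp_tendsto tendsto_neg_atBot_atTop
  have h4 : f =o[atBot] fun s : ℝ => (-s) ^ (k + 1) := by
    simpa [Function.comp_def] using h3
  refine h4.trans_isBigO (IsBigO.of_bound 1 (Eventually.of_forall fun s => ?_))
  simp

theorem tendsto_inv_smul_of_hasDerivAt_atTop {L : E} (hf : ∀ s, HasDerivAt f (f' s) s)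
    (h : Tendsto f' atTop (𝓝 L)) : Tendsto (fun s : ℝ => s⁻¹ • f s) atTop (𝓝 L) := by
  have h1 : ∀ s, HasDerivAt (fun s => f s - s • L) (f' s - L) s := fun s => by
    simpa using (hf s).fun_sub ((hasDerivAt_id s).smul_const L)
  have h2 : (fun s => f' s - L) =o[atTop] fun s : ℝ => s ^ 0 := by
    simpa using tendsto_sub_nhds_zero_iff.2 h
  have h3 := (isLittleO_pow_succ_of_hasDerivAt_atTop h1 h2)
  have h4 : Tendsto (fun s : ℝ => s⁻¹ • (f s - s • L)) atTop (𝓝 0) := by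
    rw [tendsto_zero_iff_norm_tendsto_zero]
    have := (h3.norm_norm).tendsto_div_nhds_zero
    refine this.congr fun s => ?_
    simp [norm_smul, div_eq_inv_mul]
  have h5 := h4.add_const L
  rw [zero_add] at h5
  refine h5.congr' ?_
  filter_upwards [eventually_ne_atTop 0] with s hs
  rw [smul_sub, smul_smul, inv_mul_cancel₀ hs, one_smul, sub_add_cancel]

theorem tendsto_inv_smul_of_hasDerivAt_atBot {L : E} (hf : ∀ s, HasDerivAt f (f' s) s)
    (h : Tendsto f' atBot (𝓝 L)) : Tendsto (fun s : ℝ => s⁻¹ • f s) atBot (𝓝 L) := by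
  have h1 : ∀ s, HasDerivAt (fun s => f s - s • L) (f' s - L) s := fun s => by
    simpa using (hf s).fun_sub ((hasDerivAt_id s).smul_const L)
  have h2 : (fun s => f' s - L) =o[atBot] fun s : ℝ => s ^ 0 := by
    simpa using tendsto_sub_nhds_zero_iff.2 h
  have h3 := (isLittleO_pow_succ_of_hasDerivAt_atBot h1 h2)
  have h4 : Tendsto (fun s : ℝ => s⁻¹ • (f s - s • L)) atBot (𝓝 0) := by
    rw [tendsto_zero_iff_norm_tendsto_zero]
    have := (h3.norm_norm).tendsto_div_nhds_zero
    refine this.congr fun s => ?_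
    simp [norm_smul, div_eq_inv_mul]
  have h5 := h4.add_const L
  rw [zero_add] at h5
  refine h5.congr' ?_
  filter_upwards [eventually_ne_atBot 0] with s hs
  rw [smul_sub, smul_smul, inv_mul_cancel₀ hs, one_smul, sub_add_cancel]

end

/-! ### The tilt density and the force exerted by the perturbation -/

/-- The covector `w ↦ acceleration h x v a w`. -/
def accelerationForm (h : Chart d → Form d) (x v a : Chart d) : Chart d →L[ℝ] ℝ :=
  h x a + fderiv ℝ h x v v - (1 / 2 : ℝ) • ((fderiv ℝ h x).flip v).flip v

theorem accelerationForm_apply (h : Chart d → Form d) (x v a w : Chart d) :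
    accelerationForm h x v a w = acceleration h x v a w := by
  simp [accelerationForm, acceleration, christoffel]
  ring

theorem norm_accelerationForm_le (h : Chart d → Form d) (x v a : Chart d) :
    ‖accelerationForm h x v a‖ ≤ ‖h x‖ * ‖a‖ + 2 * ‖fderiv ℝ h x‖ * ‖v‖ ^ 2 := by
  refine ContinuousLinearMap.opNorm_le_bound _ (by positivity) fun w => ?_
  rw [accelerationForm_apply, acceleration, christoffel]
  have h1 := (h x).le_opNorm₂ a w
  have h2 : ∀ p q r, ‖fderiv ℝ h x p q r‖ ≤ ‖fderiv ℝ h x‖ * ‖p‖ * ‖q‖ * ‖r‖ := fun p q r =>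
    ((fderiv ℝ h x p).le_opNorm₂ q r).trans (by gcongr; exact (fderiv ℝ h x).le_opNorm p)
  have h3 := h2 v v w
  have h4 := h2 w v v
  rw [Real.norm_eq_abs] at *
  have h5 := abs_le.1 h1
  have h6 := abs_le.1 h3
  have h7 := abs_le.1 h4
  have h8 : 0 ≤ ‖fderiv ℝ h x‖ * ‖v‖ ^ 2 * ‖w‖ := by positivity
  rw [abs_le]
  constructor <;> nlinarith

theorem hasDerivAt_form_apply {h : Chart d → Form d} (hh : ContDiffOn ℝ 2 h (bulk d))
    {γ ξ χ : ℝ → Chart d} {γ' ξ' χ' : Chart d} {s : ℝ} (hγ : HasDerivAt γ γ' s)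
    (hξ : HasDerivAt ξ ξ' s) (hχ : HasDerivAt χ χ' s) (hx : γ s ∈ bulk d) :
    HasDerivAt (fun s => h (γ s) (ξ s) (χ s))
      (fderiv ℝ h (γ s) γ' (ξ s) (χ s) + h (γ s) ξ' (χ s) + h (γ s) (ξ s) χ') s := by
  have h1 : HasFDerivAt h (fderiv ℝ h (γ s)) (γ s) :=
    ((hh.contDiffAt (isOpen_bulk.mem_nhds hx)).differentiableAt (by simp)).hasFDerivAt
  refine (((h1.comp_hasDerivAt s hγ).clm_apply hξ).clm_apply hχ).congr_deriv ?_
  simp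

section

variable {ℓ : ℝ} {h : Chart d → Form d} {n e : EuclideanSpace ℝ (Fin d)}

theorem tiltDensity_stdGeodesic (t₀ s : ℝ) :
    tiltDensity h (stdGeodesic ℓ t₀ n e) s =
      h (stdGeodesic ℓ t₀ n e s) (stdVelocity ℓ n e s) (stdVelocity ℓ n e s) := by
  rw [tiltDensity, deriv_stdGeodesic]

theorem hasDerivAt_tiltDensity (hh : IsAdmissiblePerturbation ℓ h) (t₀ : ℝ) (hn : ‖n‖ = 1)
    (hen : inner ℝ e n = 0) (he : ‖e‖ < 1) (s : ℝ) :
    HasDerivAt (tiltDensity h (stdGeodesic ℓ t₀ n e))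
      (2 * acceleration h (stdGeodesic ℓ t₀ n e s) (stdVelocity ℓ n e s) (stdAcceleration ℓ n e s)
        (stdVelocity ℓ n e s)) s := by
  have hb := stdGeodesic_mem_bulk ℓ t₀ hn hen he s
  have h1 := hasDerivAt_form_apply hh.contDiffOn (hasDerivAt_stdGeodesic ℓ t₀ n e s)
    (hasDerivAt_stdVelocity ℓ n e s) (hasDerivAt_stdVelocity ℓ n e s) hb
  refine (h1.congr_of_eventuallyEq
    (Eventually.of_forall fun r => tiltDensity_stdGeodesic t₀ r)).congr_deriv ?_
  rw [hh.symm _ hb (stdVelocity ℓ n e s), acceleration, christoffel]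
  ring

theorem exists_bounds_stdGeodesic (hℓ : 0 < ℓ) (hh : IsAdmissiblePerturbation ℓ h) (t₀ : ℝ) :
    ∃ M : ℝ, 0 ≤ M ∧ ∀ n e : EuclideanSpace ℝ (Fin d), ‖n‖ = 1 → inner ℝ e n = 0 → ‖e‖ < 1 →
      ∀ s, ‖h (stdGeodesic ℓ t₀ n e s)‖ ≤ M * (japanese s / lapse e) ^ 2 ∧
        ‖fderiv ℝ h (stdGeodesic ℓ t₀ n e s)‖ ≤ M * (japanese s / lapse e) ^ 3 := by
  obtain ⟨M, hM, H⟩ := hh.exists_bounds (t₀ - 2 * ℓ) (t₀ + 2 * ℓ)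
  refine ⟨M, hM, fun n e hn hen he s => ?_⟩
  rw [← redshift_stdGeodesic ℓ t₀ hn hen he]
  exact H _ (stdGeodesic_mem_bulk ℓ t₀ hn hen he s) (stdGeodesic_fst_mem hℓ t₀ n e s)

theorem exists_tiltDensity_bound (hℓ : 0 < ℓ) (hh : IsAdmissiblePerturbation ℓ h) (t₀ : ℝ)
    (hn : ‖n‖ = 1) (hen : inner ℝ e n = 0) (he : ‖e‖ < 1) :
    ∃ C : ℝ, 0 ≤ C ∧ ∀ s,
      |tiltDensity h (stdGeodesic ℓ t₀ n e) s| ≤ C / japanese s ^ 2 := by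
  obtain ⟨M, hM, H⟩ := exists_bounds_stdGeodesic hℓ hh t₀
  have hq := lapse_pos he
  refine ⟨M * (ℓ + 3) ^ 2 / lapse e ^ 2, by positivity, fun s => ?_⟩
  have hR := japanese_pos s
  rw [tiltDensity_stdGeodesic]
  have h1 := (h (stdGeodesic ℓ t₀ n e s)).le_opNorm₂ (stdVelocity ℓ n e s) (stdVelocity ℓ n e s)
  have h2 := norm_stdVelocity_le hℓ hn he.le s
  have h3 := (H n e hn hen he s).1
  refine h1.trans ?_
  calc _ ≤ M * (japanese s / lapse e) ^ 2 * ((ℓ + 3) / japanese s ^ 2)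
        * ((ℓ + 3) / japanese s ^ 2) := by gcongr
    _ = _ := by field_simp

theorem exists_accelerationForm_bound (hℓ : 0 < ℓ) (hh : IsAdmissiblePerturbation ℓ h) (t₀ : ℝ)
    (hn : ‖n‖ = 1) (hen : inner ℝ e n = 0) (he : ‖e‖ < 1) :
    ∃ C : ℝ, 0 ≤ C ∧ ∀ s, ‖accelerationForm h (stdGeodesic ℓ t₀ n e s) (stdVelocity ℓ n e s)
      (stdAcceleration ℓ n e s)‖ ≤ C / japanese s := by
  obtain ⟨M, hM, H⟩ := exists_bounds_stdGeodesic hℓ hh t₀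
  have hq := lapse_pos he
  refine ⟨M * (2 * ℓ + 26) / lapse e ^ 2 + 2 * M * (ℓ + 3) ^ 2 / lapse e ^ 3, by positivity,
    fun s => ?_⟩
  have hR := japanese_pos s
  refine (norm_accelerationForm_le _ _ _ _).trans ?_
  have h2 := norm_stdVelocity_le hℓ hn he.le s
  have h2' := norm_stdAcceleration_le hℓ hn he.le s
  obtain ⟨h3, h4⟩ := H n e hn hen he s
  calc _ ≤ M * (japanese s / lapse e) ^ 2 * ((2 * ℓ + 26) / japanese s ^ 3)
        + 2 * (M * (japanese s / lapse e) ^ 3) * ((ℓ + 3) / japanese s ^ 2) ^ 2 := by gcongr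
    _ = _ := by field_simp

theorem integrable_inv_japanese_sq (C : ℝ) : Integrable fun s : ℝ => C / japanese s ^ 2 := by
  have := integrable_inv_one_add_sq.const_mul C
  refine this.congr (Eventually.of_forall fun s => ?_)
  simp [japanese_sq, div_eq_mul_inv]

theorem continuous_tiltDensity (hh : IsAdmissiblePerturbation ℓ h) (t₀ : ℝ) (hn : ‖n‖ = 1)
    (hen : inner ℝ e n = 0) (he : ‖e‖ < 1) :
    Continuous (tiltDensity h (stdGeodesic ℓ t₀ n e)) :=
  continuous_iff_continuousAt.2 fun s => (hasDerivAt_tiltDensity hh t₀ hn hen he s).continuousAt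

theorem integrable_tiltDensity_stdGeodesic (hℓ : 0 < ℓ) (hh : IsAdmissiblePerturbation ℓ h)
    (t₀ : ℝ) (hn : ‖n‖ = 1) (hen : inner ℝ e n = 0) (he : ‖e‖ < 1) :
    Integrable (tiltDensity h (stdGeodesic ℓ t₀ n e)) := by
  obtain ⟨C, -, hC⟩ := exists_tiltDensity_bound hℓ hh t₀ hn hen he
  exact (integrable_inv_japanese_sq C).mono'
    (continuous_tiltDensity hh t₀ hn hen he).aestronglyMeasurable (Eventually.of_forall hC)

/-- The vector obtained from a covector by raising its index with the metric. -/
def raise (ℓ : ℝ) (x : Chart d) (L : Chart d →L[ℝ] ℝ) : Chart d :=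
  (-(L (1, 0)) / redshift x ^ 2, ((1 - ‖x.2‖ ^ 2) ^ 2 / (4 * ℓ ^ 2)) •
    (InnerProductSpace.toDual ℝ (EuclideanSpace ℝ (Fin d))).symm
      (L.comp (ContinuousLinearMap.inr ℝ ℝ (EuclideanSpace ℝ (Fin d)))))

theorem metric_raise (hℓ : ℓ ≠ 0) {x : Chart d} (hx : x ∈ bulk d) (L : Chart d →L[ℝ] ℝ)
    (w : Chart d) : metric ℓ x (raise ℓ x L) w = L w := by
  have hp := (one_sub_normSq_pos hx).ne'
  have hA : redshift x ≠ 0 := (redshift_pos hx).ne'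
  rw [metric_apply, ← redshift, raise]
  simp only [real_inner_smul_left, InnerProductSpace.toDual_symm_apply]
  have e1 : L w = w.1 * L (1, 0) + L (0, w.2) := by
    rw [← smul_eq_mul, ← map_smul, ← map_add]
    simp
  rw [e1]
  simp
  field_simp

theorem norm_raise_le (hℓ : ℓ ≠ 0) {x : Chart d} (hx : x ∈ bulk d) (L : Chart d →L[ℝ] ℝ) :
    ‖raise ℓ x L‖ ≤ (1 / redshift x ^ 2 + (1 - ‖x.2‖ ^ 2) ^ 2 / (4 * ℓ ^ 2)) * ‖L‖ := by
  have hp := (one_sub_normSq_pos hx)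
  have hA : 0 < redshift x ^ 2 := pow_pos (redshift_pos hx) 2
  refine max_le ?_ ?_
  · have h1 : ‖L (1, 0)‖ ≤ ‖L‖ := by
      have := L.le_opNorm (1, 0)
      simpa using this
    simp only [raise]
    rw [norm_div, norm_neg, Real.norm_eq_abs (redshift x ^ 2), abs_of_pos hA]
    calc ‖L (1, 0)‖ / redshift x ^ 2 ≤ ‖L‖ / redshift x ^ 2 := by gcongr
      _ = 1 / redshift x ^ 2 * ‖L‖ := by ring
      _ ≤ _ := by gcongr; exact le_add_of_nonneg_right (by positivity)
  · simp only [raise]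
    rw [norm_smul, LinearIsometryEquiv.norm_map, Real.norm_eq_abs, abs_of_nonneg (by positivity)]
    have h1 : ‖L.comp (ContinuousLinearMap.inr ℝ ℝ (EuclideanSpace ℝ (Fin d)))‖ ≤ ‖L‖ := by
      refine ContinuousLinearMap.opNorm_le_bound _ (norm_nonneg _) fun w => ?_
      have := L.le_opNorm (0, w)
      simpa using this
    calc _ ≤ (1 - ‖x.2‖ ^ 2) ^ 2 / (4 * ℓ ^ 2) * ‖L‖ := by gcongr
      _ ≤ _ := by gcongr; exact le_add_of_nonneg_left (by positivity)

theorem norm_fderiv_embedding_stdGeodesic_le (hℓ : 0 < ℓ) (t₀ : ℝ) (hn : ‖n‖ = 1)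
    (hen : inner ℝ e n = 0) (he : ‖e‖ < 1) (s : ℝ) (w : Chart d) :
    ‖fderiv ℝ (embedding ℓ t₀) (stdGeodesic ℓ t₀ n e s) w‖ ≤
      (3 * ℓ + 1) / lapse e ^ 2 * japanese s ^ 2 * ‖w‖ := by
  have hR := japanese_pos s
  have hR1 := one_le_japanese s
  have hs := abs_le_japanese s
  have hq := lapse_pos he
  have hq1 := lapse_le_one e
  have hw1 : |w.1| ≤ ‖w‖ := norm_fst_le w
  have hw2 : ‖w.2‖ ≤ ‖w‖ := norm_snd_le w
  have hu := norm_stdPosition_le hn hen he.le s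
  have hm : |inner ℝ (e + s • n) w.2| ≤ japanese s * ‖w‖ := by
    refine (abs_real_inner_le_norm _ _).trans ?_
    gcongr
  have hqR : lapse e + japanese s ≤ 2 * japanese s := by linarith
  have hR2 : japanese s ≤ japanese s ^ 2 := by nlinarith
  rw [fderiv_embedding_stdGeodesic hℓ.ne' t₀ hn hen he]
  have hinv : 1 / lapse e ≤ 1 / lapse e ^ 2 := by
    gcongr
    nlinarith
  have key : ∀ c : ℝ, |c| ≤ 1 → ∀ c', |c'| ≤ japanese s →
      |c * (ℓ * (lapse e + japanese s) / lapse e ^ 2 * inner ℝ (e + s • n) w.2)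
        + c' * (w.1 * (1 / lapse e))| ≤
      (3 * ℓ + 1) / lapse e ^ 2 * japanese s ^ 2 * ‖w‖ := by
    intro c hc c' hc'
    refine (abs_add_le _ _).trans ?_
    rw [abs_mul, abs_mul, abs_mul, abs_mul, abs_of_pos (by positivity : 0 < 1 / lapse e),
      abs_of_pos (by positivity : 0 < ℓ * (lapse e + japanese s) / lapse e ^ 2)]
    calc _ ≤ 1 * (ℓ * (2 * japanese s) / lapse e ^ 2 * (japanese s * ‖w‖))
          + japanese s ^ 2 * (‖w‖ * (1 / lapse e ^ 2)) := by
          gcongr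
          exact hc'.trans hR2
      _ = (2 * ℓ + 1) / lapse e ^ 2 * japanese s ^ 2 * ‖w‖ := by field_simp
      _ ≤ _ := by gcongr; norm_num
  have hsR : |s / japanese s| ≤ 1 := by
    rw [abs_div, abs_of_pos hR]
    exact div_le_one_of_le₀ hs hR.le
  refine max_le ?_ (max_le ?_ ?_)
  · refine le_trans (le_of_eq ?_) (key (1 / japanese s) ?_ (-s) (by rwa [abs_neg]))
    · rw [Real.norm_eq_abs]
      congr 1
      field_simp
      ring
    · rw [abs_of_pos (by positivity)]
      exact div_le_one_of_le₀ hR1 hR.le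
  · refine le_trans (le_of_eq ?_) (key (s / japanese s) hsR 1 (by rwa [abs_one]))
    rw [Real.norm_eq_abs]
    congr 1
    field_simp
  · refine (norm_add_le _ _).trans ?_
    rw [norm_smul, norm_smul, norm_mul]
    simp only [Real.norm_eq_abs]
    rw [abs_of_pos (by positivity : 0 < ℓ * (lapse e + japanese s) / lapse e),
      abs_of_pos (by positivity : 0 < ℓ / lapse e ^ 2)]
    calc _ ≤ ℓ * (2 * japanese s ^ 2) * (1 / lapse e ^ 2) * ‖w‖
          + ℓ / lapse e ^ 2 * (japanese s * ‖w‖) * japanese s := by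
          have : ℓ * (lapse e + japanese s) / lapse e ≤
              ℓ * (2 * japanese s ^ 2) * (1 / lapse e ^ 2) := by
            rw [div_eq_mul_one_div]
            gcongr
            linarith
          gcongr
      _ = (3 * ℓ) / lapse e ^ 2 * japanese s ^ 2 * ‖w‖ := by field_simp; ring
      _ ≤ _ := by gcongr; linarith

theorem continuous_stdVelocity (ℓ : ℝ) (n e : EuclideanSpace ℝ (Fin d)) :
    Continuous (stdVelocity ℓ n e) :=
  continuous_iff_continuousAt.2 fun s => (hasDerivAt_stdVelocity ℓ n e s).continuousAt

theorem continuous_stdAcceleration (ℓ : ℝ) (n e : EuclideanSpace ℝ (Fin d)) :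
    Continuous (stdAcceleration ℓ n e) := by
  have c3 : Continuous fun s : ℝ => s / japanese s :=
    continuous_id.div continuous_japanese fun s => (japanese_pos s).ne'
  have c4 : Continuous fun s : ℝ => lapse e + japanese s :=
    continuous_const.add continuous_japanese
  have c5 : Continuous fun s : ℝ => japanese s * (lapse e + japanese s) ^ 2 :=
    continuous_japanese.mul (c4.pow 2)
  have c6 : ∀ s : ℝ, japanese s * (lapse e + japanese s) ^ 2 ≠ 0 := fun s => by
    have := japanese_pos s
    have := lapse_add_japanese_pos e s
    positivity
  refine Continuous.prodMk ?_ (Continuous.sub ?_ ?_)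
  · exact Continuous.div (by fun_prop) (by fun_prop) fun s => by positivity
  · exact (c5.inv₀ c6).smul (((continuous_const.mul c3).smul continuous_const).sub
      continuous_const)
  · refine Continuous.smul (Continuous.div ?_ (c5.pow 2) fun s => pow_ne_zero 2 (c6 s)) ?_
    · exact (c3.mul (c4.pow 2)).add ((continuous_const.mul continuous_id).mul c4)
    · exact (((continuous_const.mul continuous_japanese).add continuous_const).smul
        continuous_const).sub (continuous_id.smul continuous_const)

theorem continuous_form_stdGeodesic (hh : IsAdmissiblePerturbation ℓ h) (t₀ : ℝ) (hn : ‖n‖ = 1)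
    (hen : inner ℝ e n = 0) (he : ‖e‖ < 1) :
    Continuous fun s => h (stdGeodesic ℓ t₀ n e s) := continuous_iff_continuousAt.2 fun s =>
  ContinuousAt.comp (g := h) (hh.contDiffOn.contDiffAt
    (isOpen_bulk.mem_nhds (stdGeodesic_mem_bulk ℓ t₀ hn hen he s))).continuousAt
    (contDiff_stdGeodesic (k := 0) ℓ t₀ n e).continuous.continuousAt

theorem continuous_fderiv_form_stdGeodesic (hh : IsAdmissiblePerturbation ℓ h) (t₀ : ℝ)
    (hn : ‖n‖ = 1) (hen : inner ℝ e n = 0) (he : ‖e‖ < 1) :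
    Continuous fun s => fderiv ℝ h (stdGeodesic ℓ t₀ n e s) :=
  continuous_iff_continuousAt.2 fun s => ContinuousAt.comp (g := fderiv ℝ h)
    ((hh.contDiffOn.contDiffAt
      (isOpen_bulk.mem_nhds (stdGeodesic_mem_bulk ℓ t₀ hn hen he s))).fderiv_right (m := 1)
      (by norm_num)).continuousAt
    (contDiff_stdGeodesic (k := 0) ℓ t₀ n e).continuous.continuousAt

theorem continuous_accelerationForm_stdGeodesic (hh : IsAdmissiblePerturbation ℓ h) (t₀ : ℝ)
    (hn : ‖n‖ = 1) (hen : inner ℝ e n = 0) (he : ‖e‖ < 1) :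
    Continuous fun s => accelerationForm h (stdGeodesic ℓ t₀ n e s) (stdVelocity ℓ n e s)
      (stdAcceleration ℓ n e s) := by
  have c1 := continuous_stdVelocity ℓ n e
  have d0 := continuous_form_stdGeodesic hh t₀ hn hen he
  have d1 := continuous_fderiv_form_stdGeodesic hh t₀ hn hen he
  have flipc : Continuous fun T : Chart d →L[ℝ] Form d => T.flip :=
    (ContinuousLinearMap.flipₗᵢ ℝ (Chart d) (Chart d) (Chart d →L[ℝ] ℝ)).continuous
  have flipc' : Continuous fun T : Form d => T.flip :=
    (ContinuousLinearMap.flipₗᵢ ℝ (Chart d) (Chart d) ℝ).continuous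
  exact ((d0.clm_apply (continuous_stdAcceleration ℓ n e)).add
    ((d1.clm_apply c1).clm_apply c1)).sub
    ((flipc'.comp ((flipc.comp d1).clm_apply c1)).clm_apply c1 |>.const_smul (1 / 2 : ℝ))

/-- The force driving the displacement of a deviation field. Its component tangent to the quadric is
minus the Euler-Lagrange covector of the perturbation, with its index raised; its normal component
keeps the displacement tangent to the quadric. -/
theorem exists_force (hℓ : 0 < ℓ) (hh : IsAdmissiblePerturbation ℓ h) (t₀ : ℝ)
    (hn : ‖n‖ = 1) (hen : inner ℝ e n = 0) (he : ‖e‖ < 1) :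
    ∃ F : ℝ → Ambient d, Continuous F ∧
      (∀ s w, ambientForm d (F s) (fderiv ℝ (embedding ℓ t₀) (stdGeodesic ℓ t₀ n e s) w) =
        -acceleration h (stdGeodesic ℓ t₀ n e s) (stdVelocity ℓ n e s)
          (stdAcceleration ℓ n e s) w) ∧
      (∀ s, ambientForm d (F s) (embedding ℓ t₀ (stdGeodesic ℓ t₀ n e s)) =
        tiltDensity h (stdGeodesic ℓ t₀ n e) s) ∧
      ∃ C : ℝ, ∀ s, ‖F s‖ ≤ C / japanese s := by
  have hb := stdGeodesic_mem_bulk ℓ t₀ hn hen he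
  set γ := stdGeodesic ℓ t₀ n e with hγ
  set L : ℝ → Chart d →L[ℝ] ℝ := fun s =>
    accelerationForm h (γ s) (stdVelocity ℓ n e s) (stdAcceleration ℓ n e s) with hL
  refine ⟨fun s => -fderiv ℝ (embedding ℓ t₀) (γ s) (raise ℓ (γ s) (L s))
    - (tiltDensity h γ s / ℓ ^ 2) • embedding ℓ t₀ (γ s), ?_, ?_, ?_, ?_⟩
  · have c0 : Continuous γ := (contDiff_stdGeodesic (k := 0) ℓ t₀ n e).continuous
    have cL : Continuous L := continuous_accelerationForm_stdGeodesic hh t₀ hn hen he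
    have cA : Continuous fun s => redshift (γ s) := continuous_iff_continuousAt.2 fun s =>
      ContinuousAt.comp (g := redshift) ((contDiffOn_redshift (n := 0)).contDiffAt
        (isOpen_bulk.mem_nhds (hb s))).continuousAt c0.continuousAt
    have cX : Continuous fun s => embedding ℓ t₀ (γ s) := continuous_iff_continuousAt.2 fun s =>
      ContinuousAt.comp (g := embedding ℓ t₀) (contDiffAt_embedding (n := 0) ℓ t₀
        (hb s)).continuousAt c0.continuousAt
    have cD : Continuous fun s => fderiv ℝ (embedding ℓ t₀) (γ s) :=
      continuous_iff_continuousAt.2 fun s => ContinuousAt.comp (g := fderiv ℝ (embedding ℓ t₀))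
        (contDiffAt_fderiv_embedding (n := 0) ℓ t₀ (hb s)).continuousAt c0.continuousAt
    have cr : Continuous fun s => raise ℓ (γ s) (L s) := by
      have r1 : Continuous fun s => -(L s (1, 0)) / redshift (γ s) ^ 2 :=
        ((cL.clm_apply continuous_const).neg).div (cA.pow 2) fun s =>
          (pow_pos (redshift_pos (hb s)) 2).ne'
      have r2 : Continuous fun s => (1 - ‖(γ s).2‖ ^ 2) ^ 2 / (4 * ℓ ^ 2) :=
        ((continuous_const.sub ((continuous_norm.comp (continuous_snd.comp c0)).pow 2)).pow
          2).div_const _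
      have r3 : Continuous fun s => (InnerProductSpace.toDual ℝ (EuclideanSpace ℝ (Fin d))).symm
          ((L s).comp (ContinuousLinearMap.inr ℝ ℝ (EuclideanSpace ℝ (Fin d)))) :=
        (LinearIsometryEquiv.continuous _).comp (cL.clm_comp continuous_const)
      exact r1.prodMk (r2.smul r3)
    exact (cD.clm_apply cr).neg.sub
      (((continuous_tiltDensity hh t₀ hn hen he).div_const _).smul cX)
  · intro s w
    simp only [map_sub, map_neg, map_smul, sub_apply, neg_apply, smul_apply]
    rw [ambientForm_fderiv_embedding hℓ.ne' t₀ (hb s), metric_raise hℓ.ne' (hb s),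
      ambientForm_symm (embedding ℓ t₀ (γ s)), ambientForm_fderiv_embedding_position t₀ (hb s),
      hL, accelerationForm_apply]
    simp
  · intro s
    simp only [map_sub, map_neg, map_smul, sub_apply, neg_apply, smul_apply]
    rw [ambientForm_fderiv_embedding_position t₀ (hb s), ambientForm_embedding_self ℓ t₀ (hb s),
      smul_eq_mul]
    field_simp
    ring
  · obtain ⟨C₁, hC₁, h₁⟩ := exists_tiltDensity_bound hℓ hh t₀ hn hen he
    obtain ⟨C₂, hC₂, h₂⟩ := exists_accelerationForm_bound hℓ hh t₀ hn hen he
    have hq := lapse_pos he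
    have hq1 := lapse_le_one e
    refine ⟨(3 * ℓ + 1) / lapse e ^ 2 * ((1 + 1 / ℓ ^ 2) * C₂)
      + C₁ / ℓ ^ 2 * (ℓ / lapse e), fun s => ?_⟩
    have hR := japanese_pos s
    have hR1 := one_le_japanese s
    have hr : ‖raise ℓ (γ s) (L s)‖ ≤ (1 + 1 / ℓ ^ 2) / japanese s ^ 2 * (C₂ / japanese s) := by
      refine (norm_raise_le hℓ.ne' (hb s) _).trans ?_
      rw [hγ, redshift_stdGeodesic ℓ t₀ hn hen he, one_sub_norm_stdGeodesic_sq ℓ t₀ hn hen he.le]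
      refine mul_le_mul ?_ (h₂ s) (norm_nonneg _) (by positivity)
      rw [add_div]
      refine add_le_add ?_ ?_
      · rw [div_pow, one_div_div]
        gcongr
        nlinarith
      · have : (2 * lapse e / (lapse e + japanese s)) ^ 2 / (4 * ℓ ^ 2) =
            lapse e ^ 2 / (ℓ ^ 2 * (lapse e + japanese s) ^ 2) := by
          field_simp
          norm_num
        rw [this, div_div]
        gcongr <;> nlinarith
    have hX : ‖embedding ℓ t₀ (γ s)‖ ≤ ℓ / lapse e * japanese s := by
      rw [hγ, embedding_stdGeodesic hℓ.ne' t₀ hn hen he, norm_smul, Real.norm_eq_abs,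
        abs_of_pos (by positivity)]
      gcongr
      exact max_le (by simpa using hR1) (max_le (abs_le_japanese s)
        (norm_stdPosition_le hn hen he.le s))
    refine (norm_sub_le _ _).trans ?_
    rw [norm_neg, norm_smul, Real.norm_eq_abs, abs_div, abs_of_pos (by positivity : 0 < ℓ ^ 2)]
    have hD := norm_fderiv_embedding_stdGeodesic_le hℓ t₀ hn hen he s (raise ℓ (γ s) (L s))
    have h1 := h₁ s
    calc _ ≤ (3 * ℓ + 1) / lapse e ^ 2 * japanese s ^ 2 *
            ((1 + 1 / ℓ ^ 2) / japanese s ^ 2 * (C₂ / japanese s))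
          + C₁ / japanese s ^ 2 / ℓ ^ 2 * (ℓ / lapse e * japanese s) := by
          refine add_le_add (hD.trans (by gcongr)) (by gcongr)
      _ = _ := by field_simp

end

/-! ### Integrability of the force -/

section

variable {ℓ : ℝ} {h : Chart d → Form d} {n e : EuclideanSpace ℝ (Fin d)}

theorem abs_acceleration_le (x v a w : Chart d) :
    |acceleration h x v a w| ≤ ‖accelerationForm h x v a‖ * ‖w‖ := by
  rw [← accelerationForm_apply]
  exact (accelerationForm h x v a).le_opNorm w

theorem ambientForm_velocity (t₀ : ℝ) (hℓ : ℓ ≠ 0) (hn : ‖n‖ = 1) (hen : inner ℝ e n = 0)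
    (he : ‖e‖ < 1) (Z : Ambient d) (s : ℝ) :
    ambientForm d Z (fderiv ℝ (embedding ℓ t₀) (stdGeodesic ℓ t₀ n e s) (stdVelocity ℓ n e s)) =
      ℓ / lapse e * (inner ℝ Z.2.2 n - Z.2.1) := by
  rw [fderiv_embedding_stdVelocity hℓ t₀ hn hen he, map_smul, smul_eq_mul, ambientForm_apply]
  ring

theorem ambientForm_position (t₀ : ℝ) (hℓ : ℓ ≠ 0) (hn : ‖n‖ = 1) (hen : inner ℝ e n = 0)
    (he : ‖e‖ < 1) (Z : Ambient d) (s : ℝ) :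
    ambientForm d Z (embedding ℓ t₀ (stdGeodesic ℓ t₀ n e s)) =
      ℓ / lapse e * (-Z.1 + inner ℝ Z.2.2 e + s * (inner ℝ Z.2.2 n - Z.2.1)) := by
  rw [embedding_stdGeodesic hℓ t₀ hn hen he, map_smul, smul_eq_mul, ambientForm_apply,
    inner_add_right, real_inner_smul_right]
  ring

theorem ambientForm_variation (t₀ : ℝ) (hℓ : ℓ ≠ 0) (hn : ‖n‖ = 1) (hen : inner ℝ e n = 0)
    (he : ‖e‖ < 1) {b : EuclideanSpace ℝ (Fin d)} (hb : inner ℝ n b = 0) (Z : Ambient d) (s : ℝ) :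
    ambientForm d Z (fderiv ℝ (embedding ℓ t₀) (stdGeodesic ℓ t₀ n e s) (variationField n e b s)) =
      ℓ / lapse e * inner ℝ Z.2.2 b +
        inner ℝ e b / lapse e ^ 2 *
          ambientForm d Z (embedding ℓ t₀ (stdGeodesic ℓ t₀ n e s)) := by
  rw [fderiv_embedding_variationField hℓ t₀ hn hen he hb, map_add, map_smul, map_smul,
    smul_eq_mul, smul_eq_mul, ambientForm_apply]
  simp

/-- Modulo the direction of the geodesic, the force driving the displacement is integrable; the
remaining component, which does not affect the arrival point, tends to zero. -/
theorem exists_integrable_force (hℓ : 0 < ℓ) (hh : IsAdmissiblePerturbation ℓ h) (t₀ : ℝ)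
    (hn : ‖n‖ = 1) (hen : inner ℝ e n = 0) (he : ‖e‖ < 1) :
    ∃ (G : ℝ → Ambient d) (a : ℝ → ℝ), Continuous G ∧ Continuous a ∧ Integrable G ∧
      Tendsto a atTop (𝓝 0) ∧ Tendsto a atBot (𝓝 0) ∧
      (∀ s w, ambientForm d (G s + a s • (0, 1, n))
          (fderiv ℝ (embedding ℓ t₀) (stdGeodesic ℓ t₀ n e s) w) =
        -acceleration h (stdGeodesic ℓ t₀ n e s) (stdVelocity ℓ n e s)
          (stdAcceleration ℓ n e s) w) ∧
      (∀ s, ambientForm d (G s + a s • (0, 1, n)) (embedding ℓ t₀ (stdGeodesic ℓ t₀ n e s)) =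
        tiltDensity h (stdGeodesic ℓ t₀ n e) s) := by
  obtain ⟨F, hFc, hF1, hF2, C₀, hF3⟩ := exists_force hℓ hh t₀ hn hen he
  obtain ⟨C₁, hC₁, h₁⟩ := exists_tiltDensity_bound hℓ hh t₀ hn hen he
  obtain ⟨C₂, hC₂, h₂⟩ := exists_accelerationForm_bound hℓ hh t₀ hn hen he
  have hq := lapse_pos he
  have hc : 0 < ℓ / lapse e := by positivity
  -- the component of the force along the lightlike vector `(0, 1, n)`, with respect to the
  -- complementary lightlike vector `(0, -1, n)`
  set a : ℝ → ℝ := fun s => (1 / 2) * ((F s).2.1 + inner ℝ (F s).2.2 n) with ha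
  set G : ℝ → Ambient d := fun s => F s - a s • (0, 1, n) with hG
  have hac : Continuous a := by
    refine continuous_const.mul ((continuous_fst.comp (continuous_snd.comp hFc)).add ?_)
    exact (continuous_snd.comp (continuous_snd.comp hFc)).inner continuous_const
  have hGc : Continuous G := hFc.sub (hac.smul continuous_const)
  have hsum : ∀ s, G s + a s • ((0, 1, n) : Ambient d) = F s := fun s => sub_add_cancel _ _
  have ha_le : ∀ s, ‖a s‖ ≤ C₀ / japanese s := fun s => by
    have e1 : ‖(F s).2.1‖ ≤ ‖F s‖ := (norm_fst_le _).trans (norm_snd_le _)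
    have e2 : ‖(F s).2.2‖ ≤ ‖F s‖ := (norm_snd_le _).trans (norm_snd_le _)
    have e3 : |inner ℝ (F s).2.2 n| ≤ ‖F s‖ := by
      refine (abs_real_inner_le_norm _ _).trans ?_
      rw [hn, mul_one]
      exact e2
    rw [Real.norm_eq_abs] at e1
    refine le_trans ?_ (hF3 s)
    rw [ha, Real.norm_eq_abs, abs_mul, abs_of_pos (by norm_num : (0 : ℝ) < 1 / 2)]
    have := abs_add_le (F s).2.1 (inner ℝ (F s).2.2 n)
    linarith
  have htop : Tendsto japanese atTop atTop :=
    tendsto_atTop_mono (fun s => (le_abs_self s).trans (abs_le_japanese s)) tendsto_id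
  have hbot : Tendsto japanese atBot atTop :=
    tendsto_atTop_mono (fun s => (neg_le_abs s).trans (abs_le_japanese s)) tendsto_neg_atBot_atTop
  have e_acc : ∀ s w, |acceleration h (stdGeodesic ℓ t₀ n e s) (stdVelocity ℓ n e s)
      (stdAcceleration ℓ n e s) w| ≤ C₂ / japanese s * ‖w‖ := fun s w =>
    (abs_acceleration_le _ _ _ _).trans (by gcongr; exact h₂ s)
  -- the component of the force along the geodesic direction
  set C₃ := C₂ * (ℓ + 3) / (ℓ / lapse e) with hC₃
  have hC₃0 : 0 ≤ C₃ := by positivity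
  have b1 : ∀ s, |inner ℝ (F s).2.2 n - (F s).2.1| ≤ C₃ / japanese s ^ 3 := fun s => by
    have hR := japanese_pos s
    have e1 := hF1 s (stdVelocity ℓ n e s)
    rw [ambientForm_velocity t₀ hℓ.ne' hn hen he] at e1
    have e2 : |ℓ / lapse e * (inner ℝ (F s).2.2 n - (F s).2.1)| ≤
        C₂ / japanese s * ((ℓ + 3) / japanese s ^ 2) := by
      rw [e1, abs_neg]
      exact (e_acc s _).trans (by gcongr; exact norm_stdVelocity_le hℓ hn he.le s)
    rw [abs_mul, abs_of_pos hc] at e2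
    rw [hC₃, div_div, le_div_iff₀ (by positivity)]
    calc _ = ℓ / lapse e * |inner ℝ (F s).2.2 n - (F s).2.1| * japanese s ^ 3 := by ring
      _ ≤ C₂ / japanese s * ((ℓ + 3) / japanese s ^ 2) * japanese s ^ 3 := by gcongr
      _ = _ := by field_simp
  -- the components transverse to the plane of the geodesic
  set C₄ := (C₂ * (1 + 1 / lapse e) + C₁ / lapse e ^ 2) / (ℓ / lapse e) with hC₄
  have hC₄0 : 0 ≤ C₄ := by positivity
  have b2 : ∀ s (b : EuclideanSpace ℝ (Fin d)), inner ℝ n b = 0 →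
      |inner ℝ (F s).2.2 b| ≤ C₄ * ‖b‖ / japanese s ^ 2 := fun s b hb => by
    have hR := japanese_pos s
    have e1 := hF1 s (variationField n e b s)
    rw [ambientForm_variation t₀ hℓ.ne' hn hen he hb, hF2] at e1
    have e2 : |ℓ / lapse e * inner ℝ (F s).2.2 b| ≤
        C₂ / japanese s * ((1 + 1 / lapse e) * ‖b‖ / japanese s)
          + ‖b‖ / lapse e ^ 2 * (C₁ / japanese s ^ 2) := by
      rw [eq_sub_of_add_eq e1]
      refine (abs_sub _ _).trans (add_le_add ?_ ?_)
      · rw [abs_neg]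
        exact (e_acc s _).trans (by gcongr; exact norm_variationField_le hn hen he b s)
      · rw [abs_mul, abs_div, abs_of_pos (by positivity : 0 < lapse e ^ 2)]
        have e3 : |inner ℝ e b| ≤ ‖b‖ := by
          refine (abs_real_inner_le_norm _ _).trans ?_
          nlinarith [norm_nonneg b]
        have := h₁ s
        gcongr
    rw [abs_mul, abs_of_pos hc] at e2
    rw [hC₄, div_mul_eq_mul_div, div_div, le_div_iff₀ (by positivity)]
    calc _ = ℓ / lapse e * |inner ℝ (F s).2.2 b| * japanese s ^ 2 := by ring
      _ ≤ (C₂ / japanese s * ((1 + 1 / lapse e) * ‖b‖ / japanese s)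
          + ‖b‖ / lapse e ^ 2 * (C₁ / japanese s ^ 2)) * japanese s ^ 2 := by gcongr
      _ = _ := by field_simp
  have b3 : ∀ s, |(F s).1| ≤ (C₄ + C₁ / (ℓ / lapse e) + C₃) / japanese s ^ 2 := fun s => by
    have hR := japanese_pos s
    have e1 := hF2 s
    rw [ambientForm_position t₀ hℓ.ne' hn hen he] at e1
    have e2 : (F s).1 = inner ℝ (F s).2.2 e + s * (inner ℝ (F s).2.2 n - (F s).2.1)
        - tiltDensity h (stdGeodesic ℓ t₀ n e) s / (ℓ / lapse e) := by
      rw [← e1]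
      field_simp
      ring
    have e3 := b2 s e (by rw [real_inner_comm]; exact hen)
    have e4 : |s * (inner ℝ (F s).2.2 n - (F s).2.1)| ≤ japanese s * (C₃ / japanese s ^ 3) := by
      rw [abs_mul]
      exact mul_le_mul (abs_le_japanese s) (b1 s) (abs_nonneg _) hR.le
    have e5 : |tiltDensity h (stdGeodesic ℓ t₀ n e) s / (ℓ / lapse e)| ≤
        C₁ / japanese s ^ 2 / (ℓ / lapse e) := by
      rw [abs_div, abs_of_pos hc]
      gcongr
      exact h₁ s
    have e6 : C₄ * ‖e‖ / japanese s ^ 2 ≤ C₄ / japanese s ^ 2 := by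
      gcongr
      nlinarith
    have e7 : japanese s * (C₃ / japanese s ^ 3) = C₃ / japanese s ^ 2 := by field_simp
    rw [e2]
    refine (abs_sub _ _).trans ((add_le_add (abs_add_le _ _) le_rfl).trans ?_)
    have e8 : (C₄ + C₁ / (ℓ / lapse e) + C₃) / japanese s ^ 2 =
        C₄ / japanese s ^ 2 + C₃ / japanese s ^ 2 + C₁ / japanese s ^ 2 / (ℓ / lapse e) := by
      ring
    linarith
  have b4 : ∀ s, ‖(F s).2.2 - (inner ℝ (F s).2.2 n) • n‖ ≤ C₄ / japanese s ^ 2 := fun s => by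
    have hR := japanese_pos s
    set b := (F s).2.2 - (inner ℝ (F s).2.2 n) • n with hb
    have e1 : inner ℝ n b = 0 := by
      rw [hb, inner_sub_right, real_inner_smul_right, real_inner_self_eq_norm_sq, hn,
        real_inner_comm]
      ring
    have e2 : inner ℝ (F s).2.2 b = ‖b‖ ^ 2 := by
      have : (F s).2.2 = b + (inner ℝ (F s).2.2 n) • n := by rw [hb, sub_add_cancel]
      rw [this, inner_add_left, real_inner_smul_left, e1, real_inner_self_eq_norm_sq]
      ring
    have e3 := b2 s b e1
    rw [e2, abs_of_nonneg (sq_nonneg _)] at e3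
    by_contra hcon
    push Not at hcon
    have e4 : 0 ≤ C₄ / japanese s ^ 2 := by positivity
    have e5 : C₄ * ‖b‖ / japanese s ^ 2 = C₄ / japanese s ^ 2 * ‖b‖ := by ring
    nlinarith
  refine ⟨G, a, hGc, hac, ?_, ?_, ?_, ?_, ?_⟩
  · refine (integrable_inv_japanese_sq (C₄ + C₁ / (ℓ / lapse e) + C₃)).mono'
      hGc.aestronglyMeasurable (Eventually.of_forall fun s => ?_)
    have hR := japanese_pos s
    have hR1 := one_le_japanese s
    have e1 : C₃ / japanese s ^ 3 ≤ C₃ / japanese s ^ 2 := by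
      gcongr
      norm_num
    have e2 : 0 ≤ C₁ / (ℓ / lapse e) / japanese s ^ 2 := by positivity
    have e3 : 0 ≤ C₄ / japanese s ^ 2 := by positivity
    have e4 : 0 ≤ C₃ / japanese s ^ 2 := by positivity
    have b1s := b1 s
    refine max_le ?_ (max_le ?_ ?_)
    · simpa [hG] using b3 s
    · have : (G s).2.1 = -(1 / 2) * (inner ℝ (F s).2.2 n - (F s).2.1) := by
        simp [hG, ha]
        ring
      rw [this, Real.norm_eq_abs, abs_mul, abs_neg, abs_of_pos (by norm_num : (0 : ℝ) < 1 / 2),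
        add_div, add_div]
      linarith [abs_nonneg (inner ℝ (F s).2.2 n - (F s).2.1)]
    · have : (G s).2.2 = ((F s).2.2 - (inner ℝ (F s).2.2 n) • n)
          + ((1 / 2) * (inner ℝ (F s).2.2 n - (F s).2.1)) • n := by
        simp [hG, ha]
        module
      rw [this, add_div, add_div]
      refine (norm_add_le _ _).trans ?_
      rw [norm_smul, hn, Real.norm_eq_abs, abs_mul, abs_of_pos (by norm_num : (0 : ℝ) < 1 / 2)]
      linarith [abs_nonneg (inner ℝ (F s).2.2 n - (F s).2.1), b4 s]
  · exact squeeze_zero_norm ha_le (tendsto_const_nhds.div_atTop htop)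
  · exact squeeze_zero_norm ha_le (tendsto_const_nhds.div_atTop hbot)
  · intro s w
    rw [hsum]
    exact hF1 s w
  · intro s
    rw [hsum]
    exact hF2 s

/-! ### Limits of deviation fields -/

theorem tendsto_inv_japanese_atTop : Tendsto (fun s => (japanese s)⁻¹) atTop (𝓝 0) :=
  (tendsto_atTop_mono (fun s => (le_abs_self s).trans (abs_le_japanese s))
    tendsto_id).inv_tendsto_atTop

theorem tendsto_inv_japanese_atBot : Tendsto (fun s => (japanese s)⁻¹) atBot (𝓝 0) :=
  (tendsto_atTop_mono (fun s => (neg_le_abs s).trans (abs_le_japanese s))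
    tendsto_neg_atBot_atTop).inv_tendsto_atTop

theorem div_japanese_sq (s : ℝ) : (s / japanese s) ^ 2 = 1 - ((japanese s)⁻¹) ^ 2 := by
  have hR := japanese_pos s
  have := japanese_sq s
  field_simp
  linarith

theorem tendsto_div_japanese_atTop : Tendsto (fun s => s / japanese s) atTop (𝓝 1) := by
  have h1 : Tendsto (fun s => √(1 - ((japanese s)⁻¹) ^ 2)) atTop (𝓝 (√(1 - 0 ^ 2))) :=
    (Real.continuous_sqrt.tendsto _).comp ((tendsto_inv_japanese_atTop.pow 2).const_sub 1)
  norm_num at h1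
  refine h1.congr' ?_
  filter_upwards [eventually_ge_atTop 0] with s hs
  have := div_japanese_sq s
  rw [inv_pow] at this
  rw [← this, Real.sqrt_sq (div_nonneg hs (japanese_pos s).le)]

theorem tendsto_div_japanese_atBot : Tendsto (fun s => s / japanese s) atBot (𝓝 (-1)) := by
  have h1 := (tendsto_div_japanese_atTop.comp tendsto_neg_atBot_atTop).neg
  refine h1.congr fun s => ?_
  simp [japanese, neg_div]

/-- The limit of a vector field along a standard null geodesic, at the end of the geodesic
selected by the sign `σ`, in terms of the asymptotics of its displacement. -/
theorem tendsto_stdPullback {l : Filter ℝ} {σ : ℝ} (hne : ∀ᶠ s in l, s ≠ 0)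
    (h0 : Tendsto (fun s => (japanese s)⁻¹) l (𝓝 0))
    (h1 : Tendsto (fun s => s / japanese s) l (𝓝 σ))
    (hen : inner ℝ e n = 0) {Z : ℝ → Ambient d} {p : ℝ}
    {z : EuclideanSpace ℝ (Fin d)} (hZ1 : Tendsto (fun s => s⁻¹ * (Z s).1) l (𝓝 p))
    (hZ2 : Tendsto (fun s => s⁻¹ • ((Z s).2.2 - (inner ℝ (Z s).2.2 n) • n)) l (𝓝 z))
    (hZ : Tendsto (fun s => (s ^ 2)⁻¹ • Z s) l (𝓝 0)) :
    Tendsto (fun s => stdPullback ℓ n e s (Z s)) l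
      (𝓝 (-(lapse e * σ ^ 2 * p), (lapse e / ℓ * σ) • z)) := by
  have hq0 := lapse_nonneg e
  -- the factor `s / (q + √(1 + s²))` has the same limit as `s / √(1 + s²)`
  have h2 : Tendsto (fun s => s / (lapse e + japanese s)) l (𝓝 σ) := by
    have := h1.div ((h0.const_mul (lapse e)).add_const 1) (by norm_num)
    rw [mul_zero, zero_add, div_one] at this
    refine this.congr fun s => ?_
    have hR := japanese_pos s
    have hq := lapse_add_japanese_pos e s
    simp only [Pi.div_apply]
    field_simp
  have h3 : Tendsto (fun s => (lapse e + japanese s)⁻¹) l (𝓝 0) :=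
    squeeze_zero (fun s => (inv_pos.2 (lapse_add_japanese_pos e s)).le)
      (fun s => inv_anti₀ (japanese_pos s) (by linarith)) h0
  have hZr : Tendsto (fun s => (s ^ 2)⁻¹ * (Z s).2.1) l (𝓝 0) :=
    ((continuous_fst.comp continuous_snd).tendsto (0 : Ambient d)).comp hZ
  have hZ3 : Tendsto (fun s => (s ^ 2)⁻¹ • (Z s).2.2) l (𝓝 0) :=
    ((continuous_snd.comp continuous_snd).tendsto (0 : Ambient d)).comp hZ
  have hν : Tendsto (fun s => (s ^ 2)⁻¹ * inner ℝ (Z s).2.2 n) l (𝓝 0) := by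
    have := Tendsto.inner (𝕜 := ℝ) hZ3 (tendsto_const_nhds (x := n))
    simpa [real_inner_smul_left] using this
  refine Tendsto.prodMk_nhds ?_ ?_
  · have h4 := (((h1.pow 2).mul (hZr.sub hZ1))).const_mul (lapse e)
    rw [show lapse e * (σ ^ 2 * (0 - p)) = -(lapse e * σ ^ 2 * p) by ring] at h4
    refine h4.congr' ?_
    filter_upwards [hne] with s hs
    have hR := japanese_pos s
    rw [← japanese_sq]
    field_simp
  · set ζ : ℝ → EuclideanSpace ℝ (Fin d) := fun s => (Z s).2.2 - (inner ℝ (Z s).2.2 n) • n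
    have hζe : Tendsto (fun s => s⁻¹ * inner ℝ e (ζ s)) l (𝓝 (inner ℝ e z)) := by
      have := Tendsto.inner (𝕜 := ℝ) (tendsto_const_nhds (x := e)) hZ2
      simpa [real_inner_smul_right] using this
    -- coefficients of the expansion in the transverse part of `Z`, `n` and `e`
    have c1 := (h2.smul hZ2).const_smul (lapse e / ℓ)
    have c2 : Tendsto (fun s => (((s ^ 2)⁻¹ * inner ℝ (Z s).2.2 n) *
        ((s / (lapse e + japanese s)) ^ 2 * (lapse e + (japanese s)⁻¹))
        - (s⁻¹ * inner ℝ e (ζ s)) * ((s / (lapse e + japanese s)) ^ 2 * (japanese s)⁻¹)) • n) l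
        (𝓝 ((0 * (σ ^ 2 * (lapse e + 0)) - inner ℝ e z * (σ ^ 2 * 0)) • n)) :=
      ((hν.mul ((h2.pow 2).mul (h0.const_add _))).sub (hζe.mul ((h2.pow 2).mul h0))).smul_const n
    have c3 : Tendsto (fun s => ((s⁻¹ * inner ℝ e (ζ s)) *
        ((japanese s)⁻¹ * (s / (lapse e + japanese s)) * (lapse e + japanese s)⁻¹)
        + ((s ^ 2)⁻¹ * inner ℝ (Z s).2.2 n) *
          (s / japanese s * (s / (lapse e + japanese s)) ^ 2)) • e) l
        (𝓝 ((inner ℝ e z * (0 * σ * 0) + 0 * (σ * σ ^ 2)) • e)) :=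
      ((hζe.mul ((h0.mul h2).mul h3)).add (hν.mul (h1.mul (h2.pow 2)))).smul_const e
    have c4 := (c1.add (c2.const_smul (lapse e / ℓ))).sub (c3.const_smul (lapse e / ℓ))
    have c5 : (lapse e / ℓ) • σ • z
        + (lapse e / ℓ) • ((0 * (σ ^ 2 * (lapse e + 0)) - inner ℝ e z * (σ ^ 2 * 0)) • n)
        - (lapse e / ℓ) • ((inner ℝ e z * (0 * σ * 0) + 0 * (σ * σ ^ 2)) • e) =
        (lapse e / ℓ * σ) • z := by
      simp [smul_smul]
    rw [c5] at c4
    refine c4.congr' ?_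
    filter_upwards [hne] with s hs
    have hR := japanese_pos s
    have hR2 := japanese_sq s
    have hq := lapse_add_japanese_pos e s
    have hZs : (Z s).2.2 = ζ s + (inner ℝ (Z s).2.2 n) • n := (sub_add_cancel _ _).symm
    set ν := inner ℝ (Z s).2.2 n
    have hm : inner ℝ (e + s • n) (Z s).2.2 = inner ℝ e (ζ s) + s * ν := by
      have e1 : inner ℝ e (Z s).2.2 = inner ℝ e (ζ s) := by
        rw [hZs, inner_add_right, real_inner_smul_right, hen, mul_zero, add_zero]
      rw [inner_add_left, real_inner_smul_left, e1, real_inner_comm (Z s).2.2 n]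
    change _ = (lapse e / ℓ) • ((lapse e + japanese s)⁻¹ • (Z s).2.2
      - (inner ℝ (e + s • n) (Z s).2.2 / (japanese s * (lapse e + japanese s) ^ 2)) • (e + s • n))
    rw [hm]
    change (lapse e / ℓ) • (s / (lapse e + japanese s)) • s⁻¹ • ζ s + _ - _ = _
    set m := inner ℝ e (ζ s)
    have k1 : s / (lapse e + japanese s) * s⁻¹ = (lapse e + japanese s)⁻¹ := by field_simp
    have k2 : (s ^ 2)⁻¹ * ν * ((s / (lapse e + japanese s)) ^ 2 * (lapse e + (japanese s)⁻¹))
        - s⁻¹ * m * ((s / (lapse e + japanese s)) ^ 2 * (japanese s)⁻¹) =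
        (lapse e + japanese s)⁻¹ * ν
          - (m + s * ν) / (japanese s * (lapse e + japanese s) ^ 2) * s := by
      field_simp
      linear_combination (-ν) * hR2
    have k3 : s⁻¹ * m * ((japanese s)⁻¹ * (s / (lapse e + japanese s)) * (lapse e + japanese s)⁻¹)
        + (s ^ 2)⁻¹ * ν * (s / japanese s * (s / (lapse e + japanese s)) ^ 2) =
        (m + s * ν) / (japanese s * (lapse e + japanese s) ^ 2) := by
      field_simp
    rw [k2, k3, smul_smul (s / (lapse e + japanese s)), k1, hZs]
    module

end

/-! ### Existence of the arrival deviation -/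

section

variable {ℓ : ℝ} {h : Chart d → Form d} {n e : EuclideanSpace ℝ (Fin d)}

theorem deriv_deriv_stdGeodesic (ℓ t₀ : ℝ) (n e : EuclideanSpace ℝ (Fin d)) :
    deriv (deriv (stdGeodesic ℓ t₀ n e)) = stdAcceleration ℓ n e := by
  rw [deriv_stdGeodesic]
  exact funext fun s => (hasDerivAt_stdVelocity ℓ n e s).deriv

theorem contDiff_two_of_hasDerivAt {E : Type*} [NormedAddCommGroup E] [NormedSpace ℝ E]
    {f f' f'' : ℝ → E} (h1 : ∀ s, HasDerivAt f (f' s) s) (h2 : ∀ s, HasDerivAt f' (f'' s) s)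
    (hc : Continuous f'') : ContDiff ℝ 2 f := by
  have e1 : deriv f = f' := funext fun s => (h1 s).deriv
  have e2 : deriv f' = f'' := funext fun s => (h2 s).deriv
  have : ContDiff ℝ (1 + 1) f := by
    rw [contDiff_succ_iff_deriv]
    refine ⟨fun s => (h1 s).differentiableAt, by simp, ?_⟩
    rw [e1, contDiff_one_iff_deriv]
    exact ⟨fun s => (h2 s).differentiableAt, by rwa [e2]⟩
  simpa [one_add_one_eq_two] using this

theorem contDiff_stdPullback {k : WithTop ℕ∞} {Z : ℝ → Ambient d} (hZ : ContDiff ℝ k Z) :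
    ContDiff ℝ k fun s => stdPullback ℓ n e s (Z s) := by
  have hr : ContDiff ℝ k fun s => (Z s).2.1 := hZ.snd.fst
  have hz : ContDiff ℝ k fun s => (Z s).2.2 := hZ.snd.snd
  have hu : ContDiff ℝ k fun s : ℝ => e + s • n :=
    contDiff_const.add (contDiff_id.smul contDiff_const)
  have hJ : ContDiff ℝ k fun s : ℝ => lapse e + japanese s := contDiff_const.add contDiff_japanese
  have h1 : ContDiff ℝ k fun s => (lapse e + japanese s)⁻¹ • (Z s).2.2 :=
    (hJ.inv fun s => (lapse_add_japanese_pos e s).ne').smul hz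
  have h2 : ContDiff ℝ k fun s => inner ℝ (e + s • n) (Z s).2.2 /
      (japanese s * (lapse e + japanese s) ^ 2) :=
    (hu.inner ℝ hz).div (contDiff_japanese.mul (hJ.pow 2)) fun s => by
      have := japanese_pos s
      have := lapse_add_japanese_pos e s
      positivity
  exact ContDiff.prodMk ((contDiff_const.mul (hr.sub (contDiff_id.mul hZ.fst))).div
    (contDiff_const.add (contDiff_id.pow 2)) fun s => by positivity)
    ((h1.sub (h2.smul hu)).const_smul _)

/-- The linear system satisfied by a deviation field of a standard null geodesic. -/
theorem isDeviationField_stdGeodesic_iff (hℓ : ℓ ≠ 0) (t₀ : ℝ)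
    (hh : IsAdmissiblePerturbation ℓ h) (hn : ‖n‖ = 1) (hen : inner ℝ e n = 0) (he : ‖e‖ < 1)
    {η : ℝ → Chart d} (hη : ContDiff ℝ 2 η) :
    IsDeviationField ℓ h (stdGeodesic ℓ t₀ n e) η ↔
      (∀ s w, ambientForm d (deriv (deriv (displacement ℓ t₀ (stdGeodesic ℓ t₀ n e) η)) s)
          (fderiv ℝ (embedding ℓ t₀) (stdGeodesic ℓ t₀ n e s) w)
        = -acceleration h (stdGeodesic ℓ t₀ n e s) (stdVelocity ℓ n e s)
          (stdAcceleration ℓ n e s) w) ∧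
      ∀ s, 2 * ambientForm d (deriv (displacement ℓ t₀ (stdGeodesic ℓ t₀ n e) η) s)
          ((ℓ / lapse e) • (0, 1, n)) = -tiltDensity h (stdGeodesic ℓ t₀ n e) s := by
  rw [isDeviationField_iff hℓ t₀ hh.contDiffOn
    (isCompleteNullGeodesic_stdGeodesic hℓ t₀ hn hen he) hη, deriv_deriv_stdGeodesic,
    deriv_stdGeodesic]
  simp only [fderiv_embedding_stdVelocity hℓ t₀ hn hen he]

theorem tendsto_tiltDensity (hℓ : 0 < ℓ) (hh : IsAdmissiblePerturbation ℓ h) (t₀ : ℝ)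
    (hn : ‖n‖ = 1) (hen : inner ℝ e n = 0) (he : ‖e‖ < 1) {l : Filter ℝ}
    (hl : Tendsto (fun s => (japanese s)⁻¹) l (𝓝 0)) :
    Tendsto (tiltDensity h (stdGeodesic ℓ t₀ n e)) l (𝓝 0) ∧
      Tendsto (fun s => s * tiltDensity h (stdGeodesic ℓ t₀ n e) s) l (𝓝 0) := by
  obtain ⟨C, hC0, hC⟩ := exists_tiltDensity_bound hℓ hh t₀ hn hen he
  have h1 := hl.const_mul C
  have h2 := (hl.pow 2).const_mul C
  rw [mul_zero] at h1
  rw [zero_pow two_ne_zero, mul_zero] at h2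
  refine ⟨squeeze_zero_norm (fun s => ?_) h2, squeeze_zero_norm (fun s => ?_) h1⟩
  · rw [inv_pow, ← div_eq_mul_inv]
    exact hC s
  · have hR := japanese_pos s
    rw [Real.norm_eq_abs, abs_mul]
    calc |s| * |tiltDensity h (stdGeodesic ℓ t₀ n e) s| ≤ japanese s * (C / japanese s ^ 2) :=
          mul_le_mul (abs_le_japanese s) (hC s) (abs_nonneg _) hR.le
      _ = C * (japanese s)⁻¹ := by field_simp

/-- Every standard null geodesic has an arrival deviation. The averaged tilt combines the time
delay and the component of the deviation along `e`; the components orthogonal to `n` are given by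
the integral that occurs in the first variation of the averaged tilt, see
`hasDerivAt_averagedTilt_line`. -/
theorem exists_isArrivalDeviation (hℓ : 0 < ℓ) (hh : IsAdmissiblePerturbation ℓ h) (t₀ : ℝ)
    (hn : ‖n‖ = 1) (hen : inner ℝ e n = 0) (he : ‖e‖ < 1) :
    ∃ v : Chart d, IsArrivalDeviation ℓ h (stdGeodesic ℓ t₀ n e) v ∧ inner ℝ v.2 n = 0 ∧
      lapse e ^ 2 * averagedTilt h (stdGeodesic ℓ t₀ n e) =
        2 * ℓ * (v.1 + ℓ * inner ℝ v.2 e) ∧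
      ∀ b : EuclideanSpace ℝ (Fin d), inner ℝ n b = 0 →
        lapse e ^ 2 * ∫ s, acceleration h (stdGeodesic ℓ t₀ n e s) (stdVelocity ℓ n e s)
          (stdAcceleration ℓ n e s) (variationField n e b s) =
          -(ℓ ^ 2 * inner ℝ v.2 b + inner ℝ e b * averagedTilt h (stdGeodesic ℓ t₀ n e)) := by
  obtain ⟨G, a, hGc, hac, hGi, ha1, ha2, hF1, hF2⟩ := exists_integrable_force hℓ hh t₀ hn hen he
  have hq := lapse_pos he
  have hc : 0 < ℓ / lapse e := by positivity
  set γ := stdGeodesic ℓ t₀ n e with hγ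
  set T := tiltDensity h γ with hT
  set κ : Ambient d := (0, 1, n) with hκ
  have hTi : Integrable T := integrable_tiltDensity_stdGeodesic hℓ hh t₀ hn hen he
  have hTd := hasDerivAt_tiltDensity hh t₀ hn hen he
  obtain ⟨hTtop, hsTtop⟩ := tendsto_tiltDensity hℓ hh t₀ hn hen he tendsto_inv_japanese_atTop
  obtain ⟨hTbot, hsTbot⟩ := tendsto_tiltDensity hℓ hh t₀ hn hen he tendsto_inv_japanese_atBot
  have hnn : inner ℝ n n = (1 : ℝ) := by rw [real_inner_self_eq_norm_sq, hn, one_pow]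
  -- the velocity of the displacement
  set Z : ℝ → Ambient d := fun s => (∫ x in Set.Iic 0, G x) + ∫ x in (0 : ℝ)..s, G x with hZ
  set A : ℝ → ℝ := fun s => ∫ x in (0 : ℝ)..s, a x with hA
  have hZd : ∀ s, HasDerivAt Z (G s) s := fun s =>
    ((hGc.integral_hasStrictDerivAt 0 s).hasDerivAt).const_add _
  have hAd : ∀ s, HasDerivAt A (a s) s := fun s => (hac.integral_hasStrictDerivAt 0 s).hasDerivAt
  have hZtop : Tendsto Z atTop (𝓝 (∫ x, G x)) := by
    rw [← intervalIntegral.integral_Iic_add_Ioi (b := 0) hGi.integrableOn hGi.integrableOn]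
    exact (intervalIntegral_tendsto_integral_Ioi 0 hGi.integrableOn tendsto_id).const_add _
  have hZbot : Tendsto Z atBot (𝓝 0) := by
    have h1 := (intervalIntegral_tendsto_integral_Iic 0 hGi.integrableOn tendsto_id).neg.const_add
      (∫ x in Set.Iic 0, G x)
    rw [add_neg_cancel] at h1
    refine h1.congr fun s => ?_
    rw [hZ, intervalIntegral.integral_symm]
    simp
  set D : ℝ → Ambient d := fun s => Z s + A s • κ with hD
  have hDd : ∀ s, HasDerivAt D (G s + a s • κ) s := fun s => (hZd s).add ((hAd s).smul_const κ)
  have hDc : Continuous D := continuous_iff_continuousAt.2 fun s => (hDd s).continuousAt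
  -- the initial value for which the displacement is tangent to the quadric to first order at `0`
  set C₀ : Ambient d := (-(-(Z 0).1 + inner ℝ (Z 0).2.2 e) / 2) • (0, -1, n) with hC₀
  set ζ : ℝ → Ambient d := fun s => C₀ + ∫ x in (0 : ℝ)..s, D x with hζ
  have hζd : ∀ s, HasDerivAt ζ (D s) s := fun s =>
    ((hDc.integral_hasStrictDerivAt 0 s).hasDerivAt).const_add _
  have hζ0 : ζ 0 = C₀ := by simp [hζ]
  have hD0 : D 0 = Z 0 := by simp [hD, hA]
  -- the null constraint propagates from the past endpoint
  have hnull : ∀ s, inner ℝ (D s).2.2 n - (D s).2.1 = -T s / (2 * (ℓ / lapse e)) := by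
    have hφd : ∀ s, HasDerivAt (fun s => ambientForm d (D s) ((ℓ / lapse e) • κ) + 1 / 2 * T s)
        0 s := fun s => by
      have e1 := hF1 s (stdVelocity ℓ n e s)
      rw [fderiv_embedding_stdVelocity hℓ.ne' t₀ hn hen he] at e1
      refine ((hasDerivAt_ambientForm (hDd s) (hasDerivAt_const s ((ℓ / lapse e) • κ))).add
        ((hTd s).const_mul (1 / 2))).congr_deriv ?_
      rw [e1, map_zero]
      ring
    have hφ : ∀ s, ambientForm d (D s) ((ℓ / lapse e) • κ) =
        ℓ / lapse e * (inner ℝ (Z s).2.2 n - (Z s).2.1) := fun s => by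
      rw [map_smul, smul_eq_mul, ambientForm_apply]
      simp only [hD, hκ, Prod.fst_add, Prod.snd_add, Prod.smul_fst, Prod.smul_snd, inner_add_left,
        real_inner_smul_left, hnn, smul_eq_mul]
      ring
    have hlim : Tendsto (fun s => ambientForm d (D s) ((ℓ / lapse e) • κ) + 1 / 2 * T s) atBot
        (𝓝 0) := by
      simp only [hφ]
      have c : Continuous fun X : Ambient d => ℓ / lapse e * (inner ℝ X.2.2 n - X.2.1) := by fun_prop
      have h1 := ((c.tendsto 0).comp hZbot).add (hTbot.const_mul (1 / 2))
      simpa using h1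
    intro s
    have hconst : ∀ r, ambientForm d (D r) ((ℓ / lapse e) • κ) + 1 / 2 * T r =
        ambientForm d (D s) ((ℓ / lapse e) • κ) + 1 / 2 * T s := fun r =>
      is_const_of_deriv_eq_zero (fun x => (hφd x).differentiableAt) (fun x => (hφd x).deriv) r s
    have h0 : ambientForm d (D s) ((ℓ / lapse e) • κ) + 1 / 2 * T s = 0 :=
      tendsto_nhds_unique (tendsto_const_nhds.congr fun r => (hconst r).symm) hlim
    rw [map_smul, smul_eq_mul, ambientForm_apply] at h0
    simp only [hκ, mul_zero, neg_zero, zero_sub, mul_one] at h0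
    rw [eq_div_iff (by positivity)]
    linarith
  -- the displacement stays tangent to the quadric
  have htan : ∀ s, ambientForm d (ζ s) (embedding ℓ t₀ (γ s)) = 0 := by
    have hXd : ∀ s, HasDerivAt (fun s => embedding ℓ t₀ (γ s)) ((ℓ / lapse e) • κ) s := fun s => by
      rw [← fderiv_embedding_stdVelocity hℓ.ne' t₀ hn hen he s]
      exact (differentiableAt_embedding ℓ t₀
        (stdGeodesic_mem_bulk ℓ t₀ hn hen he s)).hasFDerivAt.comp_hasDerivAt s
        (hasDerivAt_stdGeodesic ℓ t₀ n e s)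
    set ψ : ℝ → ℝ := fun s => ambientForm d (D s) (embedding ℓ t₀ (γ s))
      + ambientForm d (ζ s) ((ℓ / lapse e) • κ) with hψ
    have h1 : ∀ s, HasDerivAt (fun s => ambientForm d (ζ s) (embedding ℓ t₀ (γ s))) (ψ s) s :=
      fun s => hasDerivAt_ambientForm (hζd s) (hXd s)
    have h2 : ∀ s, HasDerivAt ψ 0 s := fun s => by
      refine ((hasDerivAt_ambientForm (hDd s) (hXd s)).add (hasDerivAt_ambientForm (hζd s)
        (hasDerivAt_const s ((ℓ / lapse e) • κ)))).congr_deriv ?_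
      rw [hF2, map_zero, map_smul, smul_eq_mul, ambientForm_apply]
      simp only [hκ, mul_zero, neg_zero, zero_sub, mul_one, add_zero]
      have := hnull s
      rw [eq_div_iff (by positivity)] at this
      linarith
    have h3 : ψ 0 = 0 := by
      simp only [hψ, hζ0, hD0]
      rw [ambientForm_position t₀ hℓ.ne' hn hen he, map_smul, smul_eq_mul, ambientForm_apply]
      simp [hC₀, hκ, real_inner_smul_left, hn]
      ring
    have h4 : ∀ s, ψ s = 0 := fun s => by
      rw [← h3]
      exact is_const_of_deriv_eq_zero (fun x => (h2 x).differentiableAt) (fun x => (h2 x).deriv) s 0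
    intro s
    have h5 := is_const_of_deriv_eq_zero (fun x => (h1 x).differentiableAt)
      (fun x => by rw [(h1 x).deriv, h4]) s 0
    rw [h5, hζ0, ambientForm_position t₀ hℓ.ne' hn hen he]
    simp [hC₀, real_inner_smul_left, real_inner_comm e n, hen]
  set η : ℝ → Chart d := fun s => stdPullback ℓ n e s (ζ s) with hη
  have hηc : ContDiff ℝ 2 η :=
    contDiff_stdPullback (contDiff_two_of_hasDerivAt hζd hDd (hGc.add (hac.smul continuous_const)))
  have hdisp : displacement ℓ t₀ γ η = ζ := funext fun s =>
    fderiv_embedding_stdPullback hℓ.ne' t₀ hn hen he s (htan s)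
  have hdζ : deriv ζ = D := funext fun s => (hζd s).deriv
  have hdD : deriv D = fun s => G s + a s • κ := funext fun s => (hDd s).deriv
  have hdev : IsDeviationField ℓ h γ η := by
    rw [hγ, isDeviationField_stdGeodesic_iff hℓ.ne' t₀ hh hn hen he hηc, ← hγ, hdisp, hdζ, hdD]
    refine ⟨hF1, fun s => ?_⟩
    rw [map_smul, smul_eq_mul, ambientForm_apply]
    simp only [mul_zero, neg_zero, zero_sub, mul_one]
    have := hnull s
    rw [eq_div_iff (by positivity)] at this
    linarith
  -- asymptotics of the displacement
  have hP : ∀ s, HasDerivAt (fun s => (ζ s).1) ((Z s).1) s := fun s => by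
    have h1 := (ContinuousLinearMap.fst ℝ ℝ
      (ℝ × EuclideanSpace ℝ (Fin d))).hasFDerivAt.comp_hasDerivAt s (hζd s)
    refine h1.congr_deriv ?_
    simp [hD, hκ]
  set Q : EuclideanSpace ℝ (Fin d) →L[ℝ] EuclideanSpace ℝ (Fin d) :=
    ContinuousLinearMap.id ℝ _ - (innerSL ℝ n).smulRight n with hQ
  have hQa : ∀ x, Q x = x - (inner ℝ x n) • n := fun x => by
    simp [hQ, real_inner_comm]
  have hQn : Q n = 0 := by rw [hQa, hnn, one_smul, sub_self]
  have hQd : ∀ s, HasDerivAt (fun s => Q (ζ s).2.2) (Q (Z s).2.2) s := fun s => by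
    exact ((Q ∘L (ContinuousLinearMap.snd ℝ ℝ _ ∘L
      ContinuousLinearMap.snd ℝ ℝ _)).hasFDerivAt.comp_hasDerivAt s (hζd s)).congr_deriv
      (by simp [hD, hκ, hQn])
  have hAtop : A =o[atTop] fun s : ℝ => s ^ 1 :=
    isLittleO_pow_succ_of_hasDerivAt_atTop (k := 0) hAd (by simpa using ha1)
  have hAbot : A =o[atBot] fun s : ℝ => s ^ 1 :=
    isLittleO_pow_succ_of_hasDerivAt_atBot (k := 0) hAd (by simpa using ha2)
  have hZo : ∀ {l : Filter ℝ} {z : Ambient d}, Tendsto Z l (𝓝 z) →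
      Tendsto (fun s : ℝ => ‖s‖) l atTop → Z =o[l] fun s : ℝ => s ^ 1 := fun h1 h2 => by
    refine (h1.isBigO_one ℝ).trans_isLittleO ?_
    simpa only [pow_one] using isLittleO_const_left.2 (Or.inr h2)
  have hAκ : ∀ {l : Filter ℝ}, A =o[l] (fun s : ℝ => s ^ 1) →
      (fun s => A s • κ) =o[l] fun s : ℝ => s ^ 1 := fun h1 => by
    simpa using h1.smul_isBigO (isBigO_const_const κ (one_ne_zero (α := ℝ)) _)
  have hsq : ∀ {l : Filter ℝ}, ζ =o[l] (fun s : ℝ => s ^ (1 + 1)) →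
      Tendsto (fun s : ℝ => (s ^ 2)⁻¹ • ζ s) l (𝓝 0) := fun h1 => by
    rw [tendsto_zero_iff_norm_tendsto_zero]
    refine h1.norm_norm.tendsto_div_nhds_zero.congr fun s => ?_
    simp [norm_smul, div_eq_inv_mul]
  set V := ∫ x, G x with hV
  have hc1 : Continuous fun X : Ambient d => X.1 := continuous_fst
  have hc2 : Continuous fun X : Ambient d => Q X.2.2 := by fun_prop
  have htop : Tendsto η atTop (𝓝 (-(lapse e * 1 ^ 2 * V.1), (lapse e / ℓ * 1) • Q V.2.2)) := by
    refine tendsto_stdPullback (eventually_ne_atTop 0)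
      tendsto_inv_japanese_atTop tendsto_div_japanese_atTop hen ?_ ?_
      (hsq (isLittleO_pow_succ_of_hasDerivAt_atTop hζd
        ((hZo hZtop tendsto_abs_atTop_atTop).add (hAκ hAtop))))
    · exact tendsto_inv_smul_of_hasDerivAt_atTop hP ((hc1.tendsto V).comp hZtop)
    · simp only [← hQa]
      exact tendsto_inv_smul_of_hasDerivAt_atTop hQd ((hc2.tendsto V).comp hZtop)
  have hbot : Tendsto η atBot (𝓝 0) := by
    have : Tendsto η atBot (𝓝 (-(lapse e * (-1) ^ 2 * (0 : Ambient d).1),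
        (lapse e / ℓ * (-1)) • Q (0 : Ambient d).2.2)) := by
      refine tendsto_stdPullback (eventually_ne_atBot 0)
        tendsto_inv_japanese_atBot tendsto_div_japanese_atBot hen ?_ ?_
        (hsq (isLittleO_pow_succ_of_hasDerivAt_atBot hζd
          ((hZo hZbot tendsto_abs_atBot_atTop).add (hAκ hAbot))))
      · exact tendsto_inv_smul_of_hasDerivAt_atBot hP ((hc1.tendsto 0).comp hZbot)
      · simp only [← hQa]
        exact tendsto_inv_smul_of_hasDerivAt_atBot hQd ((hc2.tendsto 0).comp hZbot)
    simpa only [Prod.fst_zero, Prod.snd_zero, mul_zero, neg_zero, map_zero, smul_zero,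
      Prod.mk_zero_zero] using this
  have hV1 : V.1 = ∫ s, (G s).1 := by
    rw [hV]; exact fst_integral hGi
  have hVb : ∀ b, inner ℝ V.2.2 b = ∫ s, inner ℝ (G s).2.2 b := fun b => by
    have e1 := snd_integral hGi
    have e2 := snd_integral hGi.snd
    rw [hV, e1, e2, real_inner_comm, ← integral_inner hGi.snd.snd]
    simp only [real_inner_comm]
  have hGb : ∀ b, Integrable fun s => inner ℝ (G s).2.2 b := fun b => by
    simpa only [real_inner_comm] using hGi.snd.snd.const_inner (𝕜 := ℝ) b
  refine ⟨_, ⟨η, hdev, hbot, htop⟩, ?_, ?_, ?_⟩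
  · simp only [real_inner_smul_left, hQa, inner_sub_left, hnn]
    ring
  · -- the averaged tilt is the time component, up to an integration by parts
    have e1 : ∀ s, HasDerivAt (fun s => s * T s) (T s - 2 * (ℓ / lapse e) * (s *
        (inner ℝ (G s).2.2 n - (G s).2.1))) s := fun s => by
      refine ((hasDerivAt_id s).mul (hTd s)).congr_deriv ?_
      have e2 := hF1 s (stdVelocity ℓ n e s)
      rw [ambientForm_velocity t₀ hℓ.ne' hn hen he] at e2
      simp only [hκ, Prod.fst_add, Prod.snd_add, Prod.smul_fst, Prod.smul_snd, inner_add_left,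
        real_inner_smul_left, hnn, smul_eq_mul] at e2
      simp only [id]
      linear_combination (2 * s) * e2
    have e2 : ∀ s, s * (inner ℝ (G s).2.2 n - (G s).2.1) =
        T s / (ℓ / lapse e) + (G s).1 - inner ℝ (G s).2.2 e := fun s => by
      have e3 := hF2 s
      rw [ambientForm_position t₀ hℓ.ne' hn hen he] at e3
      simp only [hκ, Prod.fst_add, Prod.snd_add, Prod.smul_fst, Prod.smul_snd, inner_add_left,
        real_inner_smul_left, hnn, smul_eq_mul, real_inner_comm e n, hen] at e3
      rw [← e3]
      field_simp
      ring
    have i1 : Integrable fun s => s * (inner ℝ (G s).2.2 n - (G s).2.1) := by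
      simp only [e2]
      exact ((hTi.div_const _).add hGi.fst).sub (hGb e)
    have i2 : ∫ s, (T s - 2 * (ℓ / lapse e) * (s * (inner ℝ (G s).2.2 n - (G s).2.1))) = 0 - 0 :=
      integral_of_hasDerivAt_of_tendsto e1 (hTi.sub (i1.const_mul _)) hsTbot hsTtop
    rw [integral_sub hTi (i1.const_mul _), integral_const_mul] at i2
    simp only [e2] at i2
    have i3 : ∫ s, (T s / (ℓ / lapse e) + (G s).1 - inner ℝ (G s).2.2 e) =
        (∫ s, T s) / (ℓ / lapse e) + V.1 - inner ℝ V.2.2 e := by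
      have i4 : Integrable fun s => T s / (ℓ / lapse e) + (G s).1 := (hTi.div_const _).add hGi.fst
      rw [integral_sub i4 (hGb e), integral_add (hTi.div_const _) hGi.fst, integral_div, hV1, hVb]
    rw [i3] at i2
    have e4 : inner ℝ (Q V.2.2) e = inner ℝ V.2.2 e := by
      rw [hQa, inner_sub_left, real_inner_smul_left, real_inner_comm e n, hen]
      ring
    simp only [real_inner_smul_left, e4]
    change lapse e ^ 2 * (∫ s, T s) = _
    field_simp at i2 ⊢
    linarith
  · intro b hb
    have e1 : ∀ s, acceleration h (γ s) (stdVelocity ℓ n e s) (stdAcceleration ℓ n e s)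
        (variationField n e b s) = -(ℓ / lapse e * inner ℝ (G s).2.2 b
          + inner ℝ e b / lapse e ^ 2 * T s) := fun s => by
      have e2 := hF1 s (variationField n e b s)
      rw [ambientForm_variation t₀ hℓ.ne' hn hen he hb, hF2] at e2
      simp only [hκ, Prod.snd_add, Prod.smul_snd, inner_add_left,
        real_inner_smul_left, hb] at e2
      linarith
    have e4 : inner ℝ (Q V.2.2) b = inner ℝ V.2.2 b := by
      rw [hQa, inner_sub_left, real_inner_smul_left, hb]
      ring
    simp only [e1]
    rw [integral_neg, integral_add ((hGb b).const_mul _) (hTi.const_mul _), integral_const_mul,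
      integral_const_mul, ← hVb]
    simp only [real_inner_smul_left, e4]
    change _ = -(_ + _ * (∫ s, T s))
    field_simp

end

/-! ### Uniqueness of the arrival deviation -/

section

variable {ℓ : ℝ} {h : Chart d → Form d} {n e : EuclideanSpace ℝ (Fin d)}

/-- The limit at an end of a standard null geodesic of a vector field whose displacement is
affine. -/
theorem tendsto_stdPullback_affine {l : Filter ℝ} {σ : ℝ} (hne : ∀ᶠ s in l, s ≠ 0)
    (hinv : Tendsto (fun s : ℝ => s⁻¹) l (𝓝 0))
    (h0 : Tendsto (fun s => (japanese s)⁻¹) l (𝓝 0))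
    (h1 : Tendsto (fun s => s / japanese s) l (𝓝 σ))
    (hen : inner ℝ e n = 0) (C₀ C₁ : Ambient d) :
    Tendsto (fun s => stdPullback ℓ n e s (C₀ + s • C₁)) l
      (𝓝 (-(lapse e * σ ^ 2 * C₁.1),
        (lapse e / ℓ * σ) • (C₁.2.2 - (inner ℝ C₁.2.2 n) • n))) := by
  have h2 : Tendsto (fun s : ℝ => s⁻¹ • (C₀ + s • C₁)) l (𝓝 C₁) := by
    have h3 := (hinv.smul_const C₀).add_const C₁
    rw [zero_smul, zero_add] at h3
    refine h3.congr' ?_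
    filter_upwards [hne] with s hs
    rw [smul_add, inv_smul_smul₀ hs]
  have c2 : Continuous fun X : Ambient d => X.2.2 - (inner ℝ X.2.2 n) • n := by fun_prop
  refine tendsto_stdPullback hne h0 h1 hen ((continuous_fst.tendsto C₁).comp h2)
    (((c2.tendsto C₁).comp h2).congr fun s => ?_) ?_
  · simp only [Function.comp_apply, Prod.smul_snd, real_inner_smul_left, smul_sub, smul_smul]
  · have h3 := hinv.smul h2
    rw [zero_smul] at h3
    refine h3.congr fun s => ?_
    rw [smul_smul, pow_two, mul_inv]

/-- The arrival deviation is unique: the difference of the displacements of two deviation fields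
is affine, and its slope, which the past endpoint fixes, determines its limit at the future
endpoint. -/
theorem IsArrivalDeviation.eq_of_stdGeodesic (hℓ : 0 < ℓ) (hh : IsAdmissiblePerturbation ℓ h)
    (t₀ : ℝ) (hn : ‖n‖ = 1) (hen : inner ℝ e n = 0) (he : ‖e‖ < 1) {v₁ v₂ : Chart d}
    (hv₁ : IsArrivalDeviation ℓ h (stdGeodesic ℓ t₀ n e) v₁)
    (hv₂ : IsArrivalDeviation ℓ h (stdGeodesic ℓ t₀ n e) v₂) : v₁ = v₂ := by
  obtain ⟨η₁, hη₁, hbot₁, htop₁⟩ := hv₁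
  obtain ⟨η₂, hη₂, hbot₂, htop₂⟩ := hv₂
  have hq := lapse_pos he
  have hγ := isCompleteNullGeodesic_stdGeodesic hℓ.ne' t₀ hn hen he
  obtain ⟨a₁, b₁⟩ := (isDeviationField_stdGeodesic_iff hℓ.ne' t₀ hh hn hen he hη₁.contDiff).1 hη₁
  obtain ⟨a₂, b₂⟩ := (isDeviationField_stdGeodesic_iff hℓ.ne' t₀ hh hn hen he hη₂.contDiff).1 hη₂
  set γ := stdGeodesic ℓ t₀ n e with hγd
  have hd1 : ∀ {η : ℝ → Chart d}, ContDiff ℝ 2 η → ∀ s, HasDerivAt (displacement ℓ t₀ γ η)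
      (deriv (displacement ℓ t₀ γ η) s) s := fun hη s => by
    rw [deriv_displacement ℓ t₀ hγ.mem_bulk hγ.contDiff hη]
    exact hasDerivAt_fderiv_embedding_apply ℓ t₀ (hγ.mem_bulk s)
      (hasDerivAt_of_contDiff_two hγ.contDiff s) (hasDerivAt_of_contDiff_two hη s)
  have hd2 : ∀ {η : ℝ → Chart d}, ContDiff ℝ 2 η → ∀ s, HasDerivAt
      (deriv (displacement ℓ t₀ γ η)) (deriv (deriv (displacement ℓ t₀ γ η)) s) s := fun hη s =>
    (hasDerivAt_deriv_displacement ℓ t₀ hγ.mem_bulk hγ.contDiff hη s).differentiableAt.hasDerivAt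
  set ζ : ℝ → Ambient d := fun s => displacement ℓ t₀ γ η₁ s - displacement ℓ t₀ γ η₂ s with hζ
  set D : ℝ → Ambient d := fun s =>
    deriv (displacement ℓ t₀ γ η₁) s - deriv (displacement ℓ t₀ γ η₂) s with hD
  set E : ℝ → Ambient d := fun s =>
    deriv (deriv (displacement ℓ t₀ γ η₁)) s - deriv (deriv (displacement ℓ t₀ γ η₂)) s with hE
  have hζd : ∀ s, HasDerivAt ζ (D s) s := fun s => (hd1 hη₁.contDiff s).sub (hd1 hη₂.contDiff s)
  have hDd : ∀ s, HasDerivAt D (E s) s := fun s => (hd2 hη₁.contDiff s).sub (hd2 hη₂.contDiff s)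
  set κ : Ambient d := (ℓ / lapse e) • (0, 1, n) with hκ
  have hXd : ∀ s, HasDerivAt (fun s => embedding ℓ t₀ (γ s)) κ s := fun s => by
    rw [hκ, ← fderiv_embedding_stdVelocity hℓ.ne' t₀ hn hen he s]
    exact (differentiableAt_embedding ℓ t₀ (hγ.mem_bulk s)).hasFDerivAt.comp_hasDerivAt s
      (hasDerivAt_stdGeodesic ℓ t₀ n e s)
  have hDκ : ∀ s, ambientForm d (D s) κ = 0 := fun s => by
    simp only [hD, map_sub, sub_apply]
    linarith [b₁ s, b₂ s]
  have htan : ∀ s, ambientForm d (ζ s) (embedding ℓ t₀ (γ s)) = 0 := fun s => by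
    simp only [hζ, displacement, map_sub, sub_apply]
    rw [ambientForm_fderiv_embedding_position t₀ (hγ.mem_bulk s),
      ambientForm_fderiv_embedding_position t₀ (hγ.mem_bulk s), sub_zero]
  have hE0 : ∀ s, E s = 0 := fun s => by
    refine eq_zero_of_orthogonal hℓ.ne' t₀ (hγ.mem_bulk s) (fun w => ?_) ?_
    · simp only [hE, map_sub, sub_apply]
      rw [a₁, a₂, sub_self]
    · have h1 : ∀ s, ambientForm d (D s) (embedding ℓ t₀ (γ s)) + ambientForm d (ζ s) κ = 0 :=
        fun s => by
          refine (hasDerivAt_ambientForm (hζd s) (hXd s)).unique ?_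
          simp only [htan]
          exact hasDerivAt_const s 0
      have h2 := (hasDerivAt_ambientForm (hDd s) (hXd s)).add
        (hasDerivAt_ambientForm (hζd s) (hasDerivAt_const s κ))
      have h3 : HasDerivAt ((fun s => ambientForm d (D s) (embedding ℓ t₀ (γ s)))
          + fun s => ambientForm d (ζ s) κ) 0 s := by
        rw [show ((fun s => ambientForm d (D s) (embedding ℓ t₀ (γ s)))
          + fun s => ambientForm d (ζ s) κ) = fun _ => 0 from funext h1]
        exact hasDerivAt_const s 0
      have h4 := h2.unique h3
      rw [hDκ, map_zero] at h4
      linarith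
  have hDc : ∀ s, D s = D 0 := fun s =>
    is_const_of_deriv_eq_zero (fun x => (hDd x).differentiableAt)
      (fun x => by rw [(hDd x).deriv, hE0]) s 0
  have hζc : ∀ s, ζ s = ζ 0 + s • D 0 := fun s => by
    have h1 : ∀ s, HasDerivAt (fun s => ζ s - s • D 0) 0 s := fun s => by
      refine ((hζd s).sub ((hasDerivAt_id s).smul_const (D 0))).congr_deriv ?_
      rw [hDc, one_smul, sub_self]
    have := is_const_of_deriv_eq_zero (fun x => (h1 x).differentiableAt) (fun x => (h1 x).deriv) s 0
    rw [zero_smul, sub_zero] at this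
    rw [← this, sub_add_cancel]
  have hη : (fun s => η₁ s - η₂ s) = fun s => stdPullback ℓ n e s (ζ 0 + s • D 0) := funext fun s => by
    rw [← hζc, hζ]
    simp only [displacement, ← map_sub]
    rw [hγd, stdPullback_fderiv_embedding hℓ.ne' t₀ hn hen he]
  have hb := hbot₁.sub hbot₂
  have ht := htop₁.sub htop₂
  rw [hη] at hb ht
  have kb := tendsto_nhds_unique hb (tendsto_stdPullback_affine (eventually_ne_atBot 0)
    tendsto_inv_atBot_zero tendsto_inv_japanese_atBot tendsto_div_japanese_atBot hen (ζ 0) (D 0))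
  have kt := tendsto_nhds_unique ht (tendsto_stdPullback_affine (eventually_ne_atTop 0)
    tendsto_inv_atTop_zero tendsto_inv_japanese_atTop tendsto_div_japanese_atTop hen (ζ 0) (D 0))
  rw [sub_self] at kb
  have k1 := congrArg Prod.fst kb
  have k2 := congrArg Prod.snd kb
  simp only [Prod.fst_zero, Prod.snd_zero] at k1 k2
  rw [← sub_eq_zero, kt]
  refine Prod.ext ?_ ?_
  · simp only [Prod.fst_zero]
    linarith
  · simp only [Prod.snd_zero]
    rw [mul_one, ← neg_eq_zero, ← neg_smul, ← mul_neg_one, ← k2]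

end

/-! ### Classification of null geodesics -/

section

variable {ℓ : ℝ} {h : Chart d → Form d} {n e : EuclideanSpace ℝ (Fin d)}

theorem redshift_add_one {x : Chart d} (hx : x ∈ bulk d) :
    1 + redshift x = 2 / (1 - ‖x.2‖ ^ 2) := by
  have hne := (one_sub_normSq_pos hx).ne'
  rw [redshift]
  field_simp
  ring

/-- The immersion onto the quadric is injective up to the periodicity of time. -/
theorem eq_of_embedding_eq (hℓ : 0 < ℓ) (t₀ : ℝ) {x y : Chart d} (hx : x ∈ bulk d)
    (hy : y ∈ bulk d) (hxy : embedding ℓ t₀ x = embedding ℓ t₀ y) :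
    x.2 = y.2 ∧ Real.cos ((x.1 - t₀) / ℓ) = Real.cos ((y.1 - t₀) / ℓ) ∧
      Real.sin ((x.1 - t₀) / ℓ) = Real.sin ((y.1 - t₀) / ℓ) := by
  have h1 := congrArg Prod.fst hxy
  have h2 := congrArg (fun X => X.2.1) hxy
  have h3 := congrArg (fun X => X.2.2) hxy
  simp only [embedding] at h1 h2 h3
  have hrx := redshift_pos hx
  have hry := redshift_pos hy
  have hA : redshift x = redshift y := by
    have e1 : (ℓ * redshift x) ^ 2 = (ℓ * redshift y) ^ 2 := by
      have cx := Real.sin_sq_add_cos_sq ((x.1 - t₀) / ℓ)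
      have cy := Real.sin_sq_add_cos_sq ((y.1 - t₀) / ℓ)
      calc (ℓ * redshift x) ^ 2 = (ℓ * redshift x * Real.cos ((x.1 - t₀) / ℓ)) ^ 2
            + (ℓ * redshift x * Real.sin ((x.1 - t₀) / ℓ)) ^ 2 := by
            linear_combination (-(ℓ * redshift x) ^ 2) * cx
        _ = (ℓ * redshift y) ^ 2 := by
            rw [h1, h2]
            linear_combination (ℓ * redshift y) ^ 2 * cy
    exact mul_left_cancel₀ hℓ.ne' ((pow_left_inj₀ (by positivity) (by positivity) two_ne_zero).1 e1)
  refine ⟨?_, ?_, ?_⟩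
  · have e1 : ∀ {x : Chart d}, x ∈ bulk d → 2 * ℓ / (1 - ‖x.2‖ ^ 2) = ℓ * (1 + redshift x) :=
      fun hx => by rw [redshift_add_one hx]; ring
    rw [e1 hx, e1 hy, hA] at h3
    exact (smul_right_injective _ (by positivity : ℓ * (1 + redshift y) ≠ 0)) h3
  · rw [hA] at h1
    exact mul_left_cancel₀ (by positivity) h1
  · rw [hA] at h2
    exact mul_left_cancel₀ (by positivity) h2

theorem IsCompleteNullGeodesic.embedding_eq_line (hℓ : ℓ ≠ 0) (t₀ s₀ : ℝ) {γ : ℝ → Chart d}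
    (hγ : IsCompleteNullGeodesic ℓ γ) (s : ℝ) :
    embedding ℓ t₀ (γ s) = embedding ℓ t₀ (γ s₀)
      + (s - s₀) • fderiv ℝ (embedding ℓ t₀) (γ s₀) (deriv γ s₀) := by
  have h1 : ∀ s, HasDerivAt (fun s => embedding ℓ t₀ (γ s))
      (fderiv ℝ (embedding ℓ t₀) (γ s) (deriv γ s)) s := fun s =>
    (differentiableAt_embedding ℓ t₀ (hγ.mem_bulk s)).hasFDerivAt.comp_hasDerivAt s
      (hasDerivAt_of_contDiff_two hγ.contDiff s)
  have h2 : ∀ s, HasDerivAt (fun s => fderiv ℝ (embedding ℓ t₀) (γ s) (deriv γ s)) 0 s := fun s => by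
    refine (hasDerivAt_fderiv_embedding_apply ℓ t₀ (hγ.mem_bulk s)
      (hasDerivAt_of_contDiff_two hγ.contDiff s)
      (hasDerivAt_deriv_of_contDiff_two hγ.contDiff s)).congr_deriv ?_
    rw [add_comm]
    exact hγ.ambient_acceleration hℓ t₀ s
  have h3 : ∀ s, fderiv ℝ (embedding ℓ t₀) (γ s) (deriv γ s) =
      fderiv ℝ (embedding ℓ t₀) (γ s₀) (deriv γ s₀) := fun s =>
    is_const_of_deriv_eq_zero (fun x => (h2 x).differentiableAt) (fun x => (h2 x).deriv) s s₀
  have h4 : ∀ s, HasDerivAt (fun s => embedding ℓ t₀ (γ s)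
      - (s - s₀) • fderiv ℝ (embedding ℓ t₀) (γ s₀) (deriv γ s₀)) 0 s := fun s => by
    refine ((h1 s).sub (((hasDerivAt_id s).sub_const s₀).smul_const
      (fderiv ℝ (embedding ℓ t₀) (γ s₀) (deriv γ s₀)))).congr_deriv ?_
    rw [h3, one_smul, sub_self]
  have h5 := is_const_of_deriv_eq_zero (fun x => (h4 x).differentiableAt)
    (fun x => (h4 x).deriv) s s₀
  rw [sub_self, zero_smul, sub_zero] at h5
  rw [← h5, sub_add_cancel]

/-- Every complete null geodesic is an affine reparametrization of a standard one. The parameter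
`s₀` is that of the point closest to the origin. -/
theorem IsCompleteNullGeodesic.exists_eq_stdGeodesic (hℓ : 0 < ℓ) {γ : ℝ → Chart d}
    (hγ : IsCompleteNullGeodesic ℓ γ) :
    ∃ (t₀ : ℝ) (n e : EuclideanSpace ℝ (Fin d)) (κ s₀ : ℝ), ‖n‖ = 1 ∧ inner ℝ e n = 0 ∧
      ‖e‖ < 1 ∧ κ ≠ 0 ∧ γ = fun s => stdGeodesic ℓ t₀ n e (κ * (s - s₀)) := by
  -- the lightlike direction of the line
  have hK : ∀ t₀ s₀ : ℝ, ambientForm d (fderiv ℝ (embedding ℓ t₀) (γ s₀) (deriv γ s₀))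
      (fderiv ℝ (embedding ℓ t₀) (γ s₀) (deriv γ s₀)) = 0 := fun t₀ s₀ => by
    rw [ambientForm_fderiv_embedding hℓ.ne' t₀ (hγ.mem_bulk s₀), hγ.null]
  have hK0 : ∀ t₀ s₀ : ℝ, fderiv ℝ (embedding ℓ t₀) (γ s₀) (deriv γ s₀) ≠ 0 := fun t₀ s₀ h0 => by
    refine hγ.velocity_ne_zero s₀ (metric_nondegenerate hℓ.ne' (hγ.mem_bulk s₀) fun w => ?_)
    rw [← ambientForm_fderiv_embedding hℓ.ne' t₀ (hγ.mem_bulk s₀), h0]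
    simp
  have hk0 : ∀ t₀ s₀ : ℝ, (fderiv ℝ (embedding ℓ t₀) (γ s₀) (deriv γ s₀)).2.2 ≠ 0 :=
    fun t₀ s₀ h0 => by
      have h1 := hK t₀ s₀
      rw [ambientForm_apply, h0, inner_zero_left, add_zero] at h1
      refine hK0 t₀ s₀ (Prod.ext ?_ (Prod.ext ?_ h0))
      · simp only [Prod.fst_zero]; nlinarith
      · simp only [Prod.fst_zero, Prod.snd_zero]; nlinarith
  set k := (fderiv ℝ (embedding ℓ 0) (γ 0) (deriv γ 0)).2.2 with hk
  set x : ℝ → EuclideanSpace ℝ (Fin d) := fun s => (2 * ℓ / (1 - ‖(γ s).2‖ ^ 2)) • (γ s).2 with hx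
  have hxl : ∀ s, x s = x 0 + s • k := fun s => by
    have := congrArg (fun X => X.2.2) (hγ.embedding_eq_line hℓ.ne' 0 0 s)
    simpa [embedding] using this
  obtain ⟨s₀, hs₀⟩ : ∃ s₀, inner ℝ (x s₀) k = 0 := by
    have hkk : inner ℝ k k ≠ (0 : ℝ) := inner_self_ne_zero.2 (hk0 0 0)
    refine ⟨-inner ℝ (x 0) k / inner ℝ k k, ?_⟩
    rw [hxl, inner_add_left, real_inner_smul_left k, div_mul_cancel₀ _ hkk, add_neg_cancel]
  set t₀ := (γ s₀).1 with ht₀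
  set K := fderiv ℝ (embedding ℓ t₀) (γ s₀) (deriv γ s₀) with hKd
  have hline := hγ.embedding_eq_line hℓ.ne' t₀ s₀
  have hK3 : K.2.2 = k := by
    have h1 := congrArg (fun X => X.2.2) (hline (s₀ + 1))
    have h2 : x (s₀ + 1) = x s₀ + K.2.2 := by simpa [embedding] using h1
    rw [hxl, hxl s₀, add_smul, one_smul, ← add_assoc] at h2
    exact (add_left_cancel h2).symm
  set c := ℓ * redshift (γ s₀) with hc
  have hc0 : 0 < c := mul_pos hℓ (redshift_pos (hγ.mem_bulk s₀))
  have hY : embedding ℓ t₀ (γ s₀) = (c, 0, x s₀) := by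
    simp [embedding, ht₀, hc, hx]
  have hK1 : K.1 = 0 := by
    have h1 := ambientForm_fderiv_embedding_position (ℓ := ℓ) t₀ (hγ.mem_bulk s₀) (deriv γ s₀)
    rw [hY, ← hKd, ambientForm_apply, hK3, real_inner_comm, hs₀] at h1
    simpa [hc0.ne'] using h1
  have hK2 : ‖k‖ ^ 2 = K.2.1 ^ 2 := by
    have h1 := hK t₀ s₀
    rw [← hKd, ambientForm_apply, hK3, hK1, real_inner_self_eq_norm_sq] at h1
    linarith
  have hK20 : K.2.1 ≠ 0 := fun h0 => by
    rw [h0] at hK2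
    exact hk0 0 0 (by simpa using hK2)
  have hcℓ : c ^ 2 = ℓ ^ 2 + ‖x s₀‖ ^ 2 := by
    have h1 := ambientForm_embedding_self ℓ t₀ (hγ.mem_bulk s₀)
    rw [hY, ambientForm_apply, real_inner_self_eq_norm_sq] at h1
    linarith
  set e := c⁻¹ • x s₀ with he
  set n := (K.2.1)⁻¹ • k with hn
  have hn1 : ‖n‖ = 1 := by
    have : ‖n‖ ^ 2 = 1 := by
      rw [hn, norm_smul, mul_pow, hK2, Real.norm_eq_abs, sq_abs]
      field_simp
    exact (pow_eq_one_iff_of_nonneg (norm_nonneg n) two_ne_zero).1 this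
  have hen : inner ℝ e n = 0 := by
    rw [he, hn, real_inner_smul_left, real_inner_smul_right, hs₀]
    simp
  have he2 : ‖e‖ ^ 2 = 1 - (ℓ / c) ^ 2 := by
    rw [he, norm_smul, mul_pow, Real.norm_eq_abs, sq_abs]
    field_simp
    linarith
  have he1 : ‖e‖ < 1 := by
    have : 0 < ℓ / c := by positivity
    refine (sq_lt_one_iff₀ (norm_nonneg _)).1 ?_
    rw [he2]
    nlinarith
  have hq : ℓ / lapse e = c := by
    have : lapse e = ℓ / c := by
      rw [lapse, he2, sub_sub_cancel, Real.sqrt_sq (by positivity)]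
    rw [this]
    field_simp
  refine ⟨t₀, n, e, K.2.1 / c, s₀, hn1, hen, he1, div_ne_zero hK20 hc0.ne', ?_⟩
  set σ : ℝ → ℝ := fun s => K.2.1 / c * (s - s₀) with hσ
  have hemb : ∀ s, embedding ℓ t₀ (γ s) = embedding ℓ t₀ (stdGeodesic ℓ t₀ n e (σ s)) := fun s => by
    rw [embedding_stdGeodesic hℓ.ne' t₀ hn1 hen he1, hq, hline, hY, ← hKd]
    refine Prod.ext ?_ (Prod.ext ?_ ?_)
    · simp [hK1]
    · simp [hσ]
      field_simp
    · simp only [Prod.snd_add, Prod.smul_snd, hK3, hσ, he, hn, smul_add, smul_smul]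
      congr 2
      · rw [mul_inv_cancel₀ hc0.ne', one_smul]
      · field_simp
  have key := fun s => eq_of_embedding_eq hℓ t₀ (hγ.mem_bulk s)
    (stdGeodesic_mem_bulk ℓ t₀ hn1 hen he1 (σ s)) (hemb s)
  -- the two times agree at `s₀` and differ by a locally constant multiple of the period
  set δ : ℝ → ℝ := fun s => ((γ s).1 - t₀) / ℓ - ((stdGeodesic ℓ t₀ n e (σ s)).1 - t₀) / ℓ with hδ
  have hδd : Differentiable ℝ δ := by
    have h1 : Differentiable ℝ γ := hγ.contDiff.differentiable two_ne_zero
    have h2 : Differentiable ℝ (stdGeodesic ℓ t₀ n e) :=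
      (contDiff_stdGeodesic (k := 1) ℓ t₀ n e).differentiable one_ne_zero
    have h3 : Differentiable ℝ σ := by fun_prop
    exact ((h1.fst.sub_const t₀).div_const ℓ).sub (((h2.comp h3).fst.sub_const t₀).div_const ℓ)
  have hδs : ∀ s, Real.sin (δ s) = 0 := fun s => by
    rw [hδ, Real.sin_sub, (key s).2.1, (key s).2.2]
    ring
  have hδc : ∀ s, Real.cos (δ s) = 1 := fun s => by
    rw [hδ, Real.cos_sub, (key s).2.1, (key s).2.2]
    linarith [Real.sin_sq_add_cos_sq (((stdGeodesic ℓ t₀ n e (σ s)).1 - t₀) / ℓ)]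
  have hδ' : ∀ s, deriv δ s = 0 := fun s => by
    have h1 := (hδd s).hasDerivAt.sin
    rw [hδc, one_mul] at h1
    refine h1.unique ?_
    simp only [hδs]
    exact hasDerivAt_const s 0
  have hδ0 : ∀ s, δ s = 0 := fun s => by
    rw [is_const_of_deriv_eq_zero hδd hδ' s s₀]
    simp [hδ, hσ, stdGeodesic, ht₀]
  funext s
  refine Prod.ext ?_ (key s).1
  have := hδ0 s
  simp only [hδ] at this
  field_simp at this
  linarith

/-! ### Affine reparametrization -/

theorem deriv_comp_affine {E : Type*} [NormedAddCommGroup E] [NormedSpace ℝ E] (κ s₀ : ℝ)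
    (f : ℝ → E) :
    deriv (fun s => f (κ * (s - s₀))) = fun s => κ • deriv f (κ * (s - s₀)) := funext fun s => by
  rw [deriv_comp_sub_const (f := fun u => f (κ * u)), deriv_comp_mul_left]

theorem tiltDensity_comp_affine (h : Chart d → Form d) (γ : ℝ → Chart d) (κ s₀ s : ℝ) :
    tiltDensity h (fun s => γ (κ * (s - s₀))) s = κ ^ 2 * tiltDensity h γ (κ * (s - s₀)) := by
  rw [tiltDensity, deriv_comp_affine, tiltDensity]
  simp only [map_smul, smul_apply, smul_eq_mul]
  ring

theorem integrable_tiltDensity_comp_affine {γ : ℝ → Chart d} {κ : ℝ} (hκ : κ ≠ 0) (s₀ : ℝ)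
    (hγ : Integrable (tiltDensity h γ)) :
    Integrable (tiltDensity h fun s => γ (κ * (s - s₀))) := by
  have := (((hγ.comp_mul_left' hκ).comp_sub_right s₀).const_mul (κ ^ 2))
  exact this.congr (Eventually.of_forall fun s => (tiltDensity_comp_affine h γ κ s₀ s).symm)

theorem averagedTilt_comp_affine (h : Chart d → Form d) (γ : ℝ → Chart d) {κ : ℝ} (hκ : κ ≠ 0)
    (s₀ : ℝ) :
    averagedTilt h (fun s => γ (κ * (s - s₀))) = |κ| * averagedTilt h γ := by
  rw [averagedTilt]
  simp only [tiltDensity_comp_affine]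
  rw [integral_const_mul, integral_sub_right_eq_self (fun u => tiltDensity h γ (κ * u)),
    Measure.integral_comp_mul_left, smul_eq_mul, abs_inv, averagedTilt, ← sq_abs]
  have := abs_pos.2 hκ
  field_simp

theorem acceleration_smul (g : Chart d → Form d) (x v a w : Chart d) (κ : ℝ) :
    acceleration g x (κ • v) (κ • κ • a) w = κ ^ 2 * acceleration g x v a w := by
  simp only [acceleration, christoffel, map_smul, smul_apply, smul_eq_mul]
  ring

theorem IsDeviationField.comp_affine {γ η : ℝ → Chart d} (hη : IsDeviationField ℓ h γ η)
    (κ s₀ : ℝ) :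
    IsDeviationField ℓ h (fun s => γ (κ * (s - s₀))) fun s => η (κ * (s - s₀)) where
  contDiff := hη.contDiff.comp (contDiff_const.mul (contDiff_id.sub contDiff_const))
  geodesic s w := by
    have h2 : ∀ f : ℝ → Chart d, deriv (deriv fun s => f (κ * (s - s₀))) =
        fun s => κ • κ • deriv (deriv f) (κ * (s - s₀)) := fun f => by
      rw [deriv_comp_affine]
      funext s
      rw [deriv_fun_const_smul_field, deriv_comp_affine]
    have h1 := (hη.geodesic (κ * (s - s₀)) w).const_mul (κ ^ 2)
    rw [mul_zero] at h1
    refine h1.congr_of_eventuallyEq (Eventually.of_forall fun ε => ?_)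
    simp only [h2]
    simp only [deriv_comp_affine, smul_comm ε κ, ← smul_add, acceleration_smul]
  null s := by
    have h1 := (hη.null (κ * (s - s₀))).const_mul (κ ^ 2)
    rw [mul_zero] at h1
    refine h1.congr_of_eventuallyEq (Eventually.of_forall fun ε => ?_)
    simp only [deriv_comp_affine, smul_comm ε κ, ← smul_add, map_smul, smul_apply, smul_eq_mul]
    ring

theorem IsArrivalDeviation.comp_affine {γ : ℝ → Chart d} {v : Chart d}
    (hv : IsArrivalDeviation ℓ h γ v) {κ : ℝ} (hκ : 0 < κ) (s₀ : ℝ) :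
    IsArrivalDeviation ℓ h (fun s => γ (κ * (s - s₀))) v := by
  obtain ⟨η, hη, hb, ht⟩ := hv
  exact ⟨_, hη.comp_affine κ s₀,
    hb.comp ((tendsto_atBot_add_const_right _ (-s₀) tendsto_id).const_mul_atBot hκ),
    ht.comp ((tendsto_atTop_add_const_right _ (-s₀) tendsto_id).const_mul_atTop hκ)⟩

theorem isArrivalDeviation_comp_affine_iff {γ : ℝ → Chart d} {v : Chart d} {κ : ℝ} (hκ : 0 < κ)
    (s₀ : ℝ) :
    IsArrivalDeviation ℓ h (fun s => γ (κ * (s - s₀))) v ↔ IsArrivalDeviation ℓ h γ v := by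
  refine ⟨fun hv => ?_, fun hv => hv.comp_affine hκ s₀⟩
  have := hv.comp_affine (inv_pos.2 hκ) (-(κ * s₀))
  convert this using 2 with s
  congr 1
  field_simp
  ring

/-! ### Endpoints -/

theorem tendsto_stdGeodesic_atTop (ℓ t₀ : ℝ) (n e : EuclideanSpace ℝ (Fin d)) :
    Tendsto (stdGeodesic ℓ t₀ n e) atTop (𝓝 (t₀ + ℓ * (Real.pi / 2), n)) := by
  have h0 := tendsto_inv_japanese_atTop
  have h1 : Tendsto (fun s => (1 + lapse e * (japanese s)⁻¹)⁻¹) atTop (𝓝 1) := by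
    have := ((h0.const_mul (lapse e)).const_add 1).inv₀ (by norm_num)
    simpa using this
  have h2 := h1.smul ((h0.smul_const e).add (tendsto_div_japanese_atTop.smul_const n))
  rw [zero_smul, one_smul, zero_add, one_smul] at h2
  refine Tendsto.prodMk_nhds (((Real.tendsto_arctan_atTop.mono_right
    nhdsWithin_le_nhds).const_mul ℓ).const_add t₀) (h2.congr fun s => ?_)
  have hR := japanese_pos s
  have hq := lapse_add_japanese_pos e s
  rw [div_eq_inv_mul, mul_smul, ← smul_add, smul_smul]
  congr 1
  field_simp
  rw [add_comm (japanese s), div_self hq.ne']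

end

section

variable {ℓ : ℝ} {h : Chart d → Form d} {n e b : EuclideanSpace ℝ (Fin d)}

/-! ### First variation of the averaged tilt -/

theorem continuous_variationVelocity (he : ‖e‖ < 1) : Continuous (variationVelocity n e b) := by
  have hq0 := lapse_pos he
  have c1 := continuous_japanese
  have c2 : Continuous fun s : ℝ => lapse e + japanese s := continuous_const.add c1
  have p : ∀ s, 0 < japanese s := japanese_pos
  have p' : ∀ s, 0 < lapse e + japanese s := lapse_add_japanese_pos e
  have k1 : Continuous fun s : ℝ => -(s / (japanese s * (lapse e + japanese s) ^ 2)) :=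
    (continuous_id.div (c1.mul (c2.pow 2)) fun s => (mul_pos (p s) (pow_pos (p' s) 2)).ne').neg
  have k2 : Continuous fun s : ℝ =>
      2 * (inner ℝ e b / lapse e) * s / (japanese s * (lapse e + japanese s) ^ 3) :=
    (continuous_const.mul continuous_id).div (c1.mul (c2.pow 3))
      fun s => (mul_pos (p s) (pow_pos (p' s) 3)).ne'
  have k3 : Continuous fun s : ℝ => inner ℝ e b / lapse e / (lapse e + japanese s) ^ 2 :=
    continuous_const.div (c2.pow 2) fun s => (pow_pos (p' s) 2).ne'
  have k4 : Continuous fun s : ℝ => e + s • n := by fun_prop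
  exact continuous_const.prodMk (((k1.smul continuous_const).sub (k2.smul k4)).add
    (k3.smul continuous_const))

/-- The first variation of the integrand of the averaged tilt. -/
def tiltVariation (ℓ : ℝ) (h : Chart d → Form d) (t₀ : ℝ) (n e b : EuclideanSpace ℝ (Fin d))
    (s : ℝ) : ℝ :=
  fderiv ℝ h (stdGeodesic ℓ t₀ n e s) (variationField n e b s) (stdVelocity ℓ n e s)
      (stdVelocity ℓ n e s)
    + h (stdGeodesic ℓ t₀ n e s) (variationVelocity n e b s) (stdVelocity ℓ n e s)
    + h (stdGeodesic ℓ t₀ n e s) (stdVelocity ℓ n e s) (variationVelocity n e b s)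

theorem hasDerivAt_tiltDensity_line (hh : IsAdmissiblePerturbation ℓ h) (t₀ : ℝ) (s : ℝ) {ε : ℝ}
    (hn : ‖n‖ = 1) (hen : inner ℝ (e + ε • b) n = 0) (he : ‖e + ε • b‖ < 1) :
    HasDerivAt (fun r : ℝ => tiltDensity h (stdGeodesic ℓ t₀ n (e + r • b)) s)
      (tiltVariation ℓ h t₀ n (e + ε • b) b s) ε := by
  simp only [tiltDensity_stdGeodesic]
  exact hasDerivAt_form_apply (γ := fun r => stdGeodesic ℓ t₀ n (e + r • b) s)
    (ξ := fun r => stdVelocity ℓ n (e + r • b) s) (χ := fun r => stdVelocity ℓ n (e + r • b) s)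
    hh.contDiffOn (hasDerivAt_stdGeodesic_line ℓ t₀ s he) (hasDerivAt_stdVelocity_line ℓ s he)
    (hasDerivAt_stdVelocity_line ℓ s he) (stdGeodesic_mem_bulk ℓ t₀ hn hen he s)

theorem exists_tiltVariation_bound (hℓ : 0 < ℓ) (hh : IsAdmissiblePerturbation ℓ h) (t₀ : ℝ)
    (hn : ‖n‖ = 1) (b : EuclideanSpace ℝ (Fin d)) {q : ℝ} (hq : 0 < q) :
    ∃ C : ℝ, ∀ e : EuclideanSpace ℝ (Fin d), inner ℝ e n = 0 → ‖e‖ < 1 → q ≤ lapse e →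
      ∀ s, |tiltVariation ℓ h t₀ n e b s| ≤ C / japanese s ^ 2 := by
  obtain ⟨M, hM, H⟩ := exists_bounds_stdGeodesic hℓ hh t₀
  refine ⟨M / q ^ 3 * ((1 + 1 / q) * ‖b‖) * (ℓ + 3) ^ 2
    + 2 * (M / q ^ 2 * ((1 + 3 / q) * ‖b‖) * (ℓ + 3)), fun e hen he hqe s => ?_⟩
  have hR := japanese_pos s
  have hq' := lapse_pos he
  obtain ⟨h1, h2⟩ := H n e hn hen he s
  have h3 := norm_stdVelocity_le hℓ hn he.le s
  have h4 : ‖variationField n e b s‖ ≤ (1 + 1 / q) * ‖b‖ / japanese s :=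
    (norm_variationField_le hn hen he b s).trans (by gcongr)
  have h5 : ‖variationVelocity n e b s‖ ≤ (1 + 3 / q) * ‖b‖ / japanese s ^ 2 :=
    (norm_variationVelocity_le hn hen he b s).trans (by gcongr)
  have h1' : ‖h (stdGeodesic ℓ t₀ n e s)‖ ≤ M * (japanese s / q) ^ 2 := h1.trans (by gcongr)
  have h2' : ‖fderiv ℝ h (stdGeodesic ℓ t₀ n e s)‖ ≤ M * (japanese s / q) ^ 3 :=
    h2.trans (by gcongr)
  have g1 := (fderiv ℝ h (stdGeodesic ℓ t₀ n e s) (variationField n e b s)).le_opNorm₂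
    (stdVelocity ℓ n e s) (stdVelocity ℓ n e s)
  have g2 := (h (stdGeodesic ℓ t₀ n e s)).le_opNorm₂ (variationVelocity n e b s)
    (stdVelocity ℓ n e s)
  have g3 := (h (stdGeodesic ℓ t₀ n e s)).le_opNorm₂ (stdVelocity ℓ n e s)
    (variationVelocity n e b s)
  have g4 := (fderiv ℝ h (stdGeodesic ℓ t₀ n e s)).le_opNorm (variationField n e b s)
  rw [tiltVariation, ← Real.norm_eq_abs]
  refine (norm_add₃_le).trans ?_
  calc _ ≤ M * (japanese s / q) ^ 3 * ((1 + 1 / q) * ‖b‖ / japanese s) *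
          ((ℓ + 3) / japanese s ^ 2) * ((ℓ + 3) / japanese s ^ 2)
        + M * (japanese s / q) ^ 2 * ((1 + 3 / q) * ‖b‖ / japanese s ^ 2) *
          ((ℓ + 3) / japanese s ^ 2)
        + M * (japanese s / q) ^ 2 * ((ℓ + 3) / japanese s ^ 2) *
          ((1 + 3 / q) * ‖b‖ / japanese s ^ 2) := by
        refine add_le_add (add_le_add (g1.trans ?_) (g2.trans (by gcongr))) (g3.trans (by gcongr))
        have g5 := g4.trans (mul_le_mul h2' h4 (norm_nonneg _) (by positivity))
        gcongr
    _ = _ := by field_simp; ring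

theorem continuous_tiltVariation (hh : IsAdmissiblePerturbation ℓ h) (t₀ : ℝ) (hn : ‖n‖ = 1)
    (hen : inner ℝ e n = 0) (he : ‖e‖ < 1) : Continuous (tiltVariation ℓ h t₀ n e b) := by
  have c1 := continuous_stdVelocity ℓ n e
  have c2 : Continuous (variationField n e b) :=
    continuous_iff_continuousAt.2 fun s => (hasDerivAt_variationField he s).continuousAt
  have c3 : Continuous (variationVelocity n e b) := continuous_variationVelocity he
  have d0 := continuous_form_stdGeodesic hh t₀ hn hen he
  have d1 := continuous_fderiv_form_stdGeodesic hh t₀ hn hen he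
  exact ((((d1.clm_apply c2).clm_apply c1).clm_apply c1).add
    ((d0.clm_apply c3).clm_apply c1)).add ((d0.clm_apply c1).clm_apply c3)

/-- Up to a boundary term which vanishes at both ends, the first variation of the averaged tilt is
the integral of the contraction of the variation field with the Euler-Lagrange covector. -/
theorem integral_tiltVariation (hℓ : 0 < ℓ) (hh : IsAdmissiblePerturbation ℓ h) (t₀ : ℝ)
    (hn : ‖n‖ = 1) (hen : inner ℝ e n = 0) (he : ‖e‖ < 1) (b : EuclideanSpace ℝ (Fin d)) :
    ∫ s, tiltVariation ℓ h t₀ n e b s =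
      -2 * ∫ s, acceleration h (stdGeodesic ℓ t₀ n e s) (stdVelocity ℓ n e s)
        (stdAcceleration ℓ n e s) (variationField n e b s) := by
  have hq := lapse_pos he
  have hb := stdGeodesic_mem_bulk ℓ t₀ hn hen he
  have c2 : Continuous (variationField n e b) :=
    continuous_iff_continuousAt.2 fun s => (hasDerivAt_variationField he s).continuousAt
  obtain ⟨C, hC⟩ := exists_tiltVariation_bound hℓ hh t₀ hn b hq
  have i1 : Integrable (tiltVariation ℓ h t₀ n e b) :=
    (integrable_inv_japanese_sq C).mono'
      (continuous_tiltVariation hh t₀ hn hen he).aestronglyMeasurable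
      (Eventually.of_forall (hC e hen he le_rfl))
  have hω := norm_variationField_le hn hen he b
  have i2 : Integrable fun s => acceleration h (stdGeodesic ℓ t₀ n e s) (stdVelocity ℓ n e s)
      (stdAcceleration ℓ n e s) (variationField n e b s) := by
    obtain ⟨C', hC'0, hC'⟩ := exists_accelerationForm_bound hℓ hh t₀ hn hen he
    refine (integrable_inv_japanese_sq (C' * ((1 + 1 / lapse e) * ‖b‖))).mono' ?_
      (Eventually.of_forall fun s => ?_)
    · simp only [← accelerationForm_apply]
      exact ((continuous_accelerationForm_stdGeodesic hh t₀ hn hen he).clm_apply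
        c2).aestronglyMeasurable
    · have hR := japanese_pos s
      refine (abs_acceleration_le _ _ _ _).trans ?_
      calc _ ≤ C' / japanese s * ((1 + 1 / lapse e) * ‖b‖ / japanese s) :=
            mul_le_mul (hC' s) (hω s) (norm_nonneg _) (by positivity)
        _ = _ := by field_simp
  have e1 : ∀ s, HasDerivAt (fun s => 2 * h (stdGeodesic ℓ t₀ n e s) (stdVelocity ℓ n e s)
      (variationField n e b s)) (tiltVariation ℓ h t₀ n e b s
        + 2 * acceleration h (stdGeodesic ℓ t₀ n e s) (stdVelocity ℓ n e s)
        (stdAcceleration ℓ n e s) (variationField n e b s)) s := fun s => by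
    refine ((hasDerivAt_form_apply hh.contDiffOn (hasDerivAt_stdGeodesic ℓ t₀ n e s)
      (hasDerivAt_stdVelocity ℓ n e s) (hasDerivAt_variationField he s) (hb s)).const_mul
      2).congr_deriv ?_
    rw [tiltVariation, acceleration, christoffel, hh.symm _ (hb s) (variationVelocity n e b s)]
    ring
  obtain ⟨M, hM, H⟩ := exists_bounds_stdGeodesic hℓ hh t₀
  have e2 : ∀ {l : Filter ℝ}, Tendsto (fun s => (japanese s)⁻¹) l (𝓝 0) →
      Tendsto (fun s => 2 * h (stdGeodesic ℓ t₀ n e s) (stdVelocity ℓ n e s)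
      (variationField n e b s)) l (𝓝 0) := fun {l} hl => by
    have h1 := hl.const_mul (2 * (M / lapse e ^ 2 * (ℓ + 3) * ((1 + 1 / lapse e) * ‖b‖)))
    rw [mul_zero] at h1
    refine squeeze_zero_norm (fun s => ?_) h1
    have hR := japanese_pos s
    have h2 := (h (stdGeodesic ℓ t₀ n e s)).le_opNorm₂ (stdVelocity ℓ n e s)
      (variationField n e b s)
    have h3 := (H n e hn hen he s).1
    have h4 := norm_stdVelocity_le hℓ hn he.le s
    have h5 := hω s
    rw [norm_mul, Real.norm_two]
    calc _ ≤ 2 * (M * (japanese s / lapse e) ^ 2 * ((ℓ + 3) / japanese s ^ 2) *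
          ((1 + 1 / lapse e) * ‖b‖ / japanese s)) := by
          refine mul_le_mul_of_nonneg_left (h2.trans ?_) zero_le_two
          gcongr
      _ = _ := by field_simp
  have e3 := integral_of_hasDerivAt_of_tendsto e1 (i1.add (i2.const_mul 2))
    (e2 tendsto_inv_japanese_atBot) (e2 tendsto_inv_japanese_atTop)
  rw [integral_add i1 (i2.const_mul 2), integral_const_mul] at e3
  linarith

theorem hasDerivAt_averagedTilt_line (hℓ : 0 < ℓ) (hh : IsAdmissiblePerturbation ℓ h) (t₀ : ℝ)
    (hn : ‖n‖ = 1) (hen : inner ℝ e n = 0) (he : ‖e‖ < 1) (hb : inner ℝ n b = 0) :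
    HasDerivAt (fun ε : ℝ => averagedTilt h (stdGeodesic ℓ t₀ n (e + ε • b)))
      (-2 * ∫ s, acceleration h (stdGeodesic ℓ t₀ n e s) (stdVelocity ℓ n e s)
        (stdAcceleration ℓ n e s) (variationField n e b s)) 0 := by
  have hen' : ∀ ε : ℝ, inner ℝ (e + ε • b) n = 0 := fun ε => by
    rw [inner_add_left, real_inner_smul_left, hen, real_inner_comm, hb, mul_zero, add_zero]
  have hcont : Continuous fun ε : ℝ => e + ε • b := by fun_prop
  have hU : {ε : ℝ | ‖e + ε • b‖ < 1 ∧ lapse e / 2 < lapse (e + ε • b)} ∈ 𝓝 (0 : ℝ) := by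
    have h1 : ∀ᶠ ε in 𝓝 (0 : ℝ), ‖e + ε • b‖ < 1 :=
      hcont.norm.continuousAt.eventually_lt continuousAt_const (by simpa using he)
    have h2 : ∀ᶠ ε in 𝓝 (0 : ℝ), lapse e / 2 < lapse (e + ε • b) :=
      continuousAt_const.eventually_lt (continuous_lapse.comp hcont).continuousAt
        (by simpa using lapse_pos he)
    exact h1.and h2
  obtain ⟨C, hC⟩ := exists_tiltVariation_bound hℓ hh t₀ hn b (half_pos (lapse_pos he))
  have key := hasDerivAt_integral_of_dominated_loc_of_deriv_le (μ := volume) (x₀ := (0 : ℝ))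
    (F := fun ε s => tiltDensity h (stdGeodesic ℓ t₀ n (e + ε • b)) s)
    (F' := fun ε s => tiltVariation ℓ h t₀ n (e + ε • b) b s) (bound := fun s => C / japanese s ^ 2)
    hU ?_ ?_ ?_ ?_ (integrable_inv_japanese_sq C) ?_
  · have := key.2
    simp only [zero_smul, add_zero, integral_tiltVariation hℓ hh t₀ hn hen he] at this
    exact this
  · filter_upwards [hU] with ε hε
    exact (continuous_tiltDensity hh t₀ hn (hen' ε) hε.1).aestronglyMeasurable
  · simp only [zero_smul, add_zero]
    exact integrable_tiltDensity_stdGeodesic hℓ hh t₀ hn hen he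
  · simp only [zero_smul, add_zero]
    exact (continuous_tiltVariation hh t₀ hn hen he).aestronglyMeasurable
  · exact Eventually.of_forall fun s ε hε => hC _ (hen' ε) hε.1 hε.2.le s
  · exact Eventually.of_forall fun s ε hε => hasDerivAt_tiltDensity_line hh t₀ s hn (hen' ε) hε.1

/-! ### The averaged tilt of the null geodesics with given endpoints -/

/-- The integral of `H` along a standard null geodesic, with the weight which turns it into
the averaged tilt, up to the factor `lapse e ^ 2`, if `H` is the regular part of the perturbation.
Unlike the averaged tilt it is continuous up to `‖e‖ = 1`. -/
def weightedTilt (ℓ : ℝ) (H : Chart d → Form d) (t₀ : ℝ) (n e : EuclideanSpace ℝ (Fin d)) : ℝ :=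
  ∫ s, japanese s ^ 2 * H (stdGeodesic ℓ t₀ n e s) (stdVelocity ℓ n e s) (stdVelocity ℓ n e s)

theorem weightedTilt_eq {H : Chart d → Form d}
    (hH : ∀ x ∈ bulk d, H x = confFactor x ^ 2 • h x) (t₀ : ℝ) (hn : ‖n‖ = 1)
    (hen : inner ℝ e n = 0) (he : ‖e‖ < 1) :
    weightedTilt ℓ H t₀ n e = lapse e ^ 2 * averagedTilt h (stdGeodesic ℓ t₀ n e) := by
  rw [weightedTilt, averagedTilt, ← integral_const_mul]
  congr 1
  funext s
  have hb := stdGeodesic_mem_bulk ℓ t₀ hn hen he s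
  have hR := japanese_pos s
  have hq := lapse_pos he
  have h1 := confFactor_mul_redshift hb
  rw [redshift_stdGeodesic ℓ t₀ hn hen he] at h1
  have h2 : confFactor (stdGeodesic ℓ t₀ n e s) = lapse e / japanese s := by
    field_simp at h1 ⊢
    linarith
  rw [hH _ hb, tiltDensity_stdGeodesic, h2]
  simp only [smul_apply, smul_eq_mul]
  field_simp

/-- The limiting null geodesics with `‖e‖ = 1` run along the boundary. -/
theorem weightedTilt_eq_zero {H : Chart d → Form d}
    (hH : ∀ x ∈ boundary d, ∀ v : Chart d, inner ℝ x.2 v.2 = 0 →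
      confMetric ℓ x v v = 0 → H x v v = 0) (t₀ : ℝ) (hn : ‖n‖ = 1)
    (hen : inner ℝ e n = 0) (he : ‖e‖ = 1) : weightedTilt ℓ H t₀ n e = 0 := by
  have hq : lapse e = 0 := by simp [lapse, he]
  have hee : inner ℝ e e = (1 : ℝ) := by rw [real_inner_self_eq_norm_sq, he, one_pow]
  have hnn : inner ℝ n n = (1 : ℝ) := by rw [real_inner_self_eq_norm_sq, hn, one_pow]
  have hne : inner ℝ n e = 0 := by rw [real_inner_comm, hen]
  rw [weightedTilt]
  convert integral_zero ℝ ℝ using 2 with s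
  funext s
  have hR := japanese_pos s
  have hx : ‖(stdGeodesic ℓ t₀ n e s).2‖ ^ 2 = 1 := by
    rw [norm_stdGeodesic_snd_sq ℓ t₀ hn hen he.le, hq, sub_zero, add_zero, div_self hR.ne']
  rw [hH, mul_zero]
  · exact (pow_eq_one_iff_of_nonneg (norm_nonneg _) two_ne_zero).1 hx
  · simp only [stdGeodesic, stdVelocity, hq, real_inner_smul_left, real_inner_smul_right,
      inner_add_left, inner_sub_right, hee, hnn, hne, hen]
    ring
  · rw [confMetric_apply, hx]
    simp only [stdVelocity, hq, real_inner_smul_left, real_inner_smul_right,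
      inner_sub_left, inner_sub_right, hee, hnn, hne, hen, ← japanese_sq]
    have h2 := japanese_sq s
    field_simp
    ring_nf
    rw [h2]
    linear_combination (-4 * ℓ ^ 2 * (japanese s ^ 2 + 1 + s ^ 2)) * h2

theorem continuousOn_weightedTilt (hℓ : 0 < ℓ) {H : Chart d → Form d}
    (hH : ContinuousOn H (compactification d)) (t₀ : ℝ) (hn : ‖n‖ = 1) :
    ContinuousOn (weightedTilt ℓ H t₀ n) {e | inner ℝ e n = 0 ∧ ‖e‖ ≤ 1} := by
  obtain ⟨M, hM⟩ := (isCompact_slab (d := d) (t₀ - 2 * ℓ) (t₀ + 2 * ℓ)).exists_bound_of_continuousOn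
    (hH.mono (slab_subset_compactification _ _))
  refine continuousOn_of_dominated (bound := fun s => |M| * (ℓ + 3) ^ 2 / japanese s ^ 2) ?_ ?_
    (integrable_inv_japanese_sq _) (Eventually.of_forall fun s => ?_)
  · rintro e ⟨hen, he⟩
    have c1 := continuous_stdVelocity ℓ n e
    have c2 : Continuous fun s => H (stdGeodesic ℓ t₀ n e s) :=
      hH.comp_continuous (contDiff_stdGeodesic (k := 0) ℓ t₀ n e).continuous
        (stdGeodesic_mem_compactification ℓ t₀ hn hen he)
    exact ((continuous_japanese.pow 2).mul
      ((c2.clm_apply c1).clm_apply c1)).aestronglyMeasurable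
  · rintro e ⟨hen, he⟩
    refine Eventually.of_forall fun s => ?_
    have hR := japanese_pos s
    have h1 := (H (stdGeodesic ℓ t₀ n e s)).le_opNorm₂ (stdVelocity ℓ n e s) (stdVelocity ℓ n e s)
    have h2 := norm_stdVelocity_le hℓ hn he s
    have h3 : ‖H (stdGeodesic ℓ t₀ n e s)‖ ≤ |M| :=
      (hM _ ⟨stdGeodesic_fst_mem hℓ t₀ n e s, mem_closedBall_zero_iff.2
        (stdGeodesic_mem_compactification ℓ t₀ hn hen he s)⟩).trans (le_abs_self M)
    rw [norm_mul, norm_pow, Real.norm_eq_abs (japanese s), abs_of_pos hR]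
    calc _ ≤ japanese s ^ 2 * (|M| * ((ℓ + 3) / japanese s ^ 2) * ((ℓ + 3) / japanese s ^ 2)) := by
          refine mul_le_mul_of_nonneg_left (h1.trans ?_) (by positivity)
          gcongr
      _ = _ := by field_simp
  · have hR := japanese_pos s
    have c0 := continuous_lapse (d := d)
    have p : ∀ e : EuclideanSpace ℝ (Fin d), lapse e + japanese s ≠ 0 :=
      fun e => (lapse_add_japanese_pos e s).ne'
    have c1 : Continuous fun e : EuclideanSpace ℝ (Fin d) => stdGeodesic ℓ t₀ n e s :=
      continuous_const.prodMk (((c0.add continuous_const).inv₀ p).smul (by fun_prop))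
    have c2 : Continuous fun e : EuclideanSpace ℝ (Fin d) => stdVelocity ℓ n e s := by
      have k1 : Continuous fun e : EuclideanSpace ℝ (Fin d) =>
          (japanese s * (lapse e + japanese s) ^ 2)⁻¹ :=
        (continuous_const.mul ((c0.add continuous_const).pow 2)).inv₀ fun e =>
          mul_ne_zero hR.ne' (pow_ne_zero 2 (p e))
      have k2 : Continuous fun e : EuclideanSpace ℝ (Fin d) =>
          (lapse e * japanese s + 1) • n - s • e := by fun_prop
      exact continuous_const.prodMk (k1.smul k2)
    have c3 : ContinuousOn (fun e => H (stdGeodesic ℓ t₀ n e s)) {e | inner ℝ e n = 0 ∧ ‖e‖ ≤ 1} :=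
      hH.comp c1.continuousOn fun e he => stdGeodesic_mem_compactification ℓ t₀ hn he.1 he.2 s
    exact continuousOn_const.mul ((c3.clm_apply c2.continuousOn).clm_apply c2.continuousOn)

theorem confMetric_endpoint {p v : Chart d} (hp : p ∈ boundary d) :
    confMetric ℓ p v v = -v.1 ^ 2 + ℓ ^ 2 * ‖v.2‖ ^ 2 := by
  rw [confMetric_apply, show ‖p.2‖ = 1 from hp, real_inner_self_eq_norm_sq]
  ring

/-- If some null geodesic had negative averaged tilt, then among the null geodesics with the same
endpoints there would be one for which `lapse e ^ 2 * averagedTilt` is minimal and negative. At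
the minimum the spatial part of the arrival deviation vanishes, and its time component is
negative. -/
theorem averagedTilt_stdGeodesic_nonneg (hℓ : 0 < ℓ) (hh : IsAdmissiblePerturbation ℓ h)
    (hc : BoundaryCausalityToLinearOrder ℓ h) (t₀ : ℝ)
    (hn : ‖n‖ = 1) (hen : inner ℝ e n = 0) (he : ‖e‖ < 1) :
    0 ≤ averagedTilt h (stdGeodesic ℓ t₀ n e) := by
  by_contra! hneg
  obtain ⟨H, hH1, hH2, hH3⟩ := hh.boundary_regular
  set S : Set (EuclideanSpace ℝ (Fin d)) := {e | inner ℝ e n = 0 ∧ ‖e‖ ≤ 1} with hS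
  have hSc : IsCompact S := by
    have h1 : IsClosed {e : EuclideanSpace ℝ (Fin d) | inner ℝ e n = 0} :=
      isClosed_eq (by fun_prop) continuous_const
    refine (isCompact_closedBall (0 : EuclideanSpace ℝ (Fin d)) 1).of_isClosed_subset
      (h1.inter (isClosed_le continuous_norm continuous_const)) fun x hx => ?_
    exact mem_closedBall_zero_iff.2 hx.2
  obtain ⟨f, ⟨hfn, hf1⟩, hfm⟩ := hSc.exists_isMinOn ⟨e, hen, he.le⟩
    (continuousOn_weightedTilt hℓ hH1.continuousOn t₀ hn)
  have hfneg : weightedTilt ℓ H t₀ n f < 0 := by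
    refine (hfm (show e ∈ S from ⟨hen, he.le⟩)).trans_lt ?_
    change weightedTilt ℓ H t₀ n e < 0
    rw [weightedTilt_eq hH2 t₀ hn hen he]
    exact mul_neg_of_pos_of_neg (pow_pos (lapse_pos he) 2) hneg
  have hf : ‖f‖ < 1 := lt_of_le_of_ne hf1 fun h1 =>
    hfneg.ne (weightedTilt_eq_zero hH3 t₀ hn hfn h1)
  rw [weightedTilt_eq hH2 t₀ hn hfn hf] at hfneg
  obtain ⟨v, hv, hvn, hv1, hv2⟩ := exists_isArrivalDeviation hℓ hh t₀ hn hfn hf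
  have hvn' : inner ℝ n v.2 = 0 := by rw [real_inner_comm, hvn]
  have hv0 : v.2 = 0 := by
    have hl : HasDerivAt (fun ε : ℝ => f + ε • v.2) v.2 0 := by
      simpa using ((hasDerivAt_id (0 : ℝ)).smul_const v.2).const_add f
    have hc : Continuous fun ε : ℝ => f + ε • v.2 := by fun_prop
    have hU : ∀ᶠ ε in 𝓝 (0 : ℝ), ‖f + ε • v.2‖ < 1 :=
      hc.norm.continuousAt.eventually_lt continuousAt_const (by simpa using hf)
    have hd := (hl.norm_sq.const_sub 1).fun_mul
      (hasDerivAt_averagedTilt_line hℓ hh t₀ hn hfn hf hvn')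
    have hen' : ∀ ε : ℝ, inner ℝ (f + ε • v.2) n = 0 := fun ε => by
      rw [inner_add_left, real_inner_smul_left, hfn, hvn, mul_zero, add_zero]
    have heq : ∀ ε : ℝ, ‖f + ε • v.2‖ < 1 → (1 - ‖f + ε • v.2‖ ^ 2) *
        averagedTilt h (stdGeodesic ℓ t₀ n (f + ε • v.2)) =
        weightedTilt ℓ H t₀ n (f + ε • v.2) := fun ε hε => by
      rw [weightedTilt_eq hH2 t₀ hn (hen' ε) hε, lapse_sq hε.le]
    have hmin : IsLocalMin (fun ε : ℝ => (1 - ‖f + ε • v.2‖ ^ 2) *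
        averagedTilt h (stdGeodesic ℓ t₀ n (f + ε • v.2))) 0 := by
      filter_upwards [hU] with ε hε
      rw [heq ε hε, heq 0 (by simpa using hf), zero_smul, add_zero]
      exact hfm (show f + ε • v.2 ∈ S from ⟨hen' ε, hε.le⟩)
    have h0 := hmin.hasDerivAt_eq_zero hd
    have h1 := hv2 v.2 hvn'
    simp only [zero_smul, add_zero] at h0
    rw [← lapse_sq hf.le] at h0
    have h2 : ℓ ^ 2 * inner ℝ v.2 v.2 = 0 := by linarith
    have h3 := (mul_eq_zero.1 h2).resolve_left (by positivity)
    exact inner_self_eq_zero.1 h3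
  rw [hv0, inner_zero_left, mul_zero, add_zero] at hv1
  have hv1' : v.1 < 0 := by
    by_contra! h1
    rw [hv1] at hfneg
    exact absurd hfneg (not_lt.2 (by positivity))
  have hp : ((t₀ + ℓ * (Real.pi / 2), n) : Chart d) ∈ boundary d := hn
  refine hc _ (isCompleteNullGeodesic_stdGeodesic hℓ.ne' t₀ hn hfn hf)
    (isFutureDirected_stdGeodesic hℓ t₀) _ hp (tendsto_stdGeodesic_atTop ℓ t₀ n f) v hv ⟨?_, hv1'⟩
  rw [confMetric_endpoint hp, hv0]
  simp [sq_nonneg]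

/-- If the arrival deviation is past-directed, then the averaged tilt is negative. -/
theorem averagedTilt_neg_of_isPastDirected (hℓ : 0 < ℓ) (hh : IsAdmissiblePerturbation ℓ h)
    (t₀ : ℝ) (hn : ‖n‖ = 1) (hen : inner ℝ e n = 0) (he : ‖e‖ < 1) {p v : Chart d}
    (hp : p ∈ boundary d) (hv : IsArrivalDeviation ℓ h (stdGeodesic ℓ t₀ n e) v)
    (hpv : IsPastDirected ℓ p v) : averagedTilt h (stdGeodesic ℓ t₀ n e) < 0 := by
  obtain ⟨w, hw, -, hw1, -⟩ := exists_isArrivalDeviation hℓ hh t₀ hn hen he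
  obtain rfl := hv.eq_of_stdGeodesic hℓ hh t₀ hn hen he hw
  obtain ⟨h1, h2⟩ := hpv
  rw [confMetric_endpoint hp] at h1
  have h3 : ℓ * ‖v.2‖ ≤ -v.1 :=
    abs_le_of_sq_le_sq' (by nlinarith) (by linarith) |>.2
  have h4 : ℓ * inner ℝ v.2 e < -v.1 := by
    have h5 := real_inner_le_norm v.2 e
    rcases (norm_nonneg v.2).eq_or_lt with h0 | h0
    · rw [← h0, zero_mul] at h5
      nlinarith
    · have : ‖v.2‖ * ‖e‖ < ‖v.2‖ := mul_lt_of_lt_one_right h0 he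
      nlinarith
  have h6 := pow_pos (lapse_pos he) 2
  by_contra! h7
  have : 0 ≤ 2 * ℓ * (v.1 + ℓ * inner ℝ v.2 e) := hw1 ▸ mul_nonneg h6.le h7
  nlinarith

end

end AdS

end

theorem theorem1 (d : ℕ) (hd : 2 ≤ d) (ℓ : ℝ) (hℓ : 0 < ℓ) (h : AdS.Chart d → AdS.Form d)
    (hh : AdS.IsAdmissiblePerturbation ℓ h) :
    (∀ γ : ℝ → AdS.Chart d, AdS.IsCompleteNullGeodesic ℓ γ →
      MeasureTheory.Integrable (AdS.tiltDensity h γ)) ∧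
    (∀ γ : ℝ → AdS.Chart d, AdS.IsCompleteNullGeodesic ℓ γ → AdS.IsFutureDirected γ →
      (∃ p ∈ AdS.boundary d, Filter.Tendsto γ Filter.atTop (nhds p)) ∧
      ∃! v : AdS.Chart d, AdS.IsArrivalDeviation ℓ h γ v) ∧
    (AdS.BoundaryCausalityToLinearOrder ℓ h ↔
      ∀ γ : ℝ → AdS.Chart d, AdS.IsCompleteNullGeodesic ℓ γ → 0 ≤ AdS.averagedTilt h γ) := by
  -- the sign of the scale factor is the time orientation
  have hpos : ∀ {t₀ κ s₀ : ℝ} {n e : EuclideanSpace ℝ (Fin d)},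
      AdS.IsFutureDirected (fun s => AdS.stdGeodesic ℓ t₀ n e (κ * (s - s₀))) → 0 < κ := by
    intro t₀ κ s₀ n e hf
    have h1 := hf s₀
    rw [AdS.deriv_comp_affine, AdS.deriv_stdGeodesic] at h1
    have h2 : 0 < κ * (ℓ / (1 + (κ * (s₀ - s₀)) ^ 2)) := h1
    exact pos_of_mul_pos_left h2 (by positivity)
  refine ⟨fun γ hγ => ?_, fun γ hγ hf => ?_, fun hc γ hγ => ?_, fun hI γ hγ hf p hp _ v hv hpv => ?_⟩
  · obtain ⟨t₀, n, e, κ, s₀, hn, hen, he, hκ, rfl⟩ := hγ.exists_eq_stdGeodesic hℓ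
    exact AdS.integrable_tiltDensity_comp_affine hκ s₀
      (AdS.integrable_tiltDensity_stdGeodesic hℓ hh t₀ hn hen he)
  · obtain ⟨t₀, n, e, κ, s₀, hn, hen, he, -, rfl⟩ := hγ.exists_eq_stdGeodesic hℓ
    have hκ := hpos hf
    refine ⟨⟨(t₀ + ℓ * (Real.pi / 2), n), hn, (AdS.tendsto_stdGeodesic_atTop ℓ t₀ n e).comp
      ((Filter.tendsto_atTop_add_const_right _ (-s₀) Filter.tendsto_id).const_mul_atTop hκ)⟩, ?_⟩
    simp only [AdS.isArrivalDeviation_comp_affine_iff hκ]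
    obtain ⟨v, hv, -⟩ := AdS.exists_isArrivalDeviation hℓ hh t₀ hn hen he
    exact ⟨v, hv, fun w hw => hw.eq_of_stdGeodesic hℓ hh t₀ hn hen he hv⟩
  · obtain ⟨t₀, n, e, κ, s₀, hn, hen, he, hκ, rfl⟩ := hγ.exists_eq_stdGeodesic hℓ
    rw [AdS.averagedTilt_comp_affine h _ hκ]
    exact mul_nonneg (abs_nonneg κ) (AdS.averagedTilt_stdGeodesic_nonneg hℓ hh hc t₀ hn hen he)
  · obtain ⟨t₀, n, e, κ, s₀, hn, hen, he, -, rfl⟩ := hγ.exists_eq_stdGeodesic hℓ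
    rw [AdS.isArrivalDeviation_comp_affine_iff (hpos hf)] at hv
    exact absurd (hI _ (AdS.isCompleteNullGeodesic_stdGeodesic hℓ.ne' t₀ hn hen he))
      (not_le.2 (AdS.averagedTilt_neg_of_isPastDirected hℓ hh t₀ hn hen he hp hv hpv))
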